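/- For $\mathbb R^3$-valued tempered distributions on $\mathbb R^2$ write $\|f\|_{\dot H^s}=\|(-\Delta)^{s/2}f\|_{L^2(\mathbb R^2)}$. The space $\dot H^{1/2}$ consists of those $f$ for which $\hat f$ is a locally integrable function and $\|f\|_{\dot H^{1/2}}<\infty$. The space $\dot H^{3/2}$ consists of those $f$ with $\partial_x f,\partial_y f\in\dot H^{1/2}$; here $\|\cdot\|_{\dot H^{3/2}}$ is a seminorm, which vanishes exactly on the constants. For $u=u(t)$, $t\in[0,T]$, put $\|u\|_{C^0_{[0,T]}\dot H^s}=\sup_{0\le t\le T}\|u(t)\|_{\dot H^s}$ and $\|u\|_{L^2_{[0,T]}\dot H^s}=\bigl(\int_0^T\|u(t)\|_{\dot H^s}^2\,dt\bigr)^{1/2}$. The symbol $\wedge$ denotes the cross product in $\mathbb R^3$. **Theorem.** For every $K>0$ there are $T>0$ and $A>0$, depending only on $K$, with the following properties. For all $\mathbb R^3$-valued initial data $(u_0,u_1)\in\dot H^{3/2}\times\dot H^{1/2}$ with $$\|u_0\|_{\dot H^{3/2}}+\|u_1\|_{\dot H^{1/2}}\le K,$$ the Cauchy problem $$(-\partial_t^2+\Delta)u=2\,u_x\wedge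 u_y,\qquad u|_{t=0}=u_0,\qquad \partial_tu|_{t=0}=u_1$$ has a unique $\mathbb R^3$-valued solution $u$ on $[0,T]$ with $$\|u\|_{C^0_{[0,T]}\dot H^{3/2}}<\infty,\qquad \|\partial_tu\|_{C^0_{[0,T]}\dot H^{1/2}}<\infty,\qquad \|u_x\wedge u_y\|_{L^2_{[0,T]}\dot H^{1/2}}\le A,$$ where "solution" means that for all $t\in[0,T]$ $$u(t)=\cos(t\sqrt{-\Delta})\,u_0+\frac{\sin(t\sqrt{-\Delta})}{\sqrt{-\Delta}}\,u_1-\int_0^t\frac{\sin((t-s)\sqrt{-\Delta})}{\sqrt{-\Delta}}\,2\,(u_x\wedge u_y)(s)\,ds .$$ For this solution, $u$ and $\partial_tu$ are continuous functions of $t\in[0,T]$ with values in $\dot H^{3/2}$ and $\dot H^{1/2}$, respectively. Furthermore, the map $(u_0,u_1)\mapsto(u,\partial_tu)$ from $\dot H^{3/2}\times\dot H^{1/2}$ to $C^0_{[0,T]}\dot H^{3/2}\times C^0_{[0,T]}\dot H^{1/2}$ is continuous on the set $\{(u_0,u_1):\|u_0\|_{\dot H^{3/2}}+\|u_1\|_{\dot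 H^{1/2}}\le K\}$. -/

import Mathlib

open MeasureTheory Set
open scoped ENNReal SchwartzMap FourierTransform LineDeriv Matrix

noncomputable section

namespace WaveCMC

/-- The plane `ℝ²`, with its Euclidean norm and Lebesgue measure. -/
abbrev Plane : Type := EuclideanSpace ℝ (Fin 2)

/-- `ℂ³` with its Hermitian norm; real-valued objects take values in `ℝ³ ⊆ ℂ³`. -/
abbrev C3 : Type := EuclideanSpace ℂ (Fin 3)

/-- Tempered distributions on the plane with values in `ℂ³`. -/
abbrev Dist : Type := 𝓢'(Plane, C3)

/-- The space `L²(ℝ²; ℂ³)`. -/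
abbrev L2 : Type := Lp C3 2 (volume : Measure Plane)

/-- A tempered distribution is real-valued (that is, `ℝ³`-valued) if its values on real-valued
test functions are real vectors. -/
def IsReal (f : Dist) : Prop :=
  ∀ φ : 𝓢(Plane, ℂ), (∀ x, (φ x).im = 0) → ∀ i, (f φ i).im = 0

/-- `IsFracLaplacian s f g` says that `(-Δ)^{s/2} f = g ∈ L²`, for orders `s < 2`.
It reads `𝓕 f = (2π|ξ|)^{-s} 𝓕 g`, since `(-Δ)^{s/2}` has the symbol `(2π|ξ|)^s` in the present
normalisation of the Fourier transform.

If `s < 1` then `(2π|ξ|)^{-s} 𝓕 g` is locally integrable and this is an identity of tempered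
distributions: `f` is the honest representative, without an additive constant.
If `1 ≤ s < 2` then `(2π|ξ|)^{-s} 𝓕 g` need not be locally integrable at the origin, and the
identity is tested on functions which vanish at the origin: `f` is determined by `g` up to an
additive constant, and the constants are the functions annihilated by `(-Δ)^{s/2}`. -/
def IsFracLaplacian (s : ℝ) (f : Dist) (g : L2) : Prop :=
  ∀ φ : 𝓢(Plane, ℂ), (1 ≤ s → φ 0 = 0) →
    (𝓕 f) φ = ∫ ξ, (φ ξ * (((2 * Real.pi * ‖ξ‖) ^ (-s) : ℝ) : ℂ)) • (𝓕 g : L2) ξ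

/-- The homogeneous Sobolev (semi)norm `‖f‖_{Ḣ^s} = ‖(-Δ)^{s/2} f‖_{L²}`, which is `∞` if
`f ∉ Ḣ^s`. (There is at most one `g` with `IsFracLaplacian s f g`.) -/
def hdotNorm (s : ℝ) (f : Dist) : ℝ≥0∞ :=
  ⨅ (g : L2) (_ : IsFracLaplacian s f g), ‖g‖ₑ

/-- The norm `‖u‖_{C⁰_{[0,T]} Ḣ^s}`, the supremum over `t ∈ [0,T]` of `‖u(t)‖_{Ḣ^s}`. -/
def supHdotNorm (T s : ℝ) (u : ℝ → Dist) : ℝ≥0∞ :=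
  ⨆ t ∈ Icc 0 T, hdotNorm s (u t)

/-- `u` is a continuous function of `t ∈ [0,T]` with values in `Ḣ^s`: the map
`t ↦ (-Δ)^{s/2} u(t)` is continuous with values in `L²`. -/
def IsContinuousInHdot (T s : ℝ) (u : ℝ → Dist) : Prop :=
  ∃ g : ℝ → L2, ContinuousOn g (Icc 0 T) ∧ ∀ t ∈ Icc 0 T, IsFracLaplacian s (u t) (g t)

/-- The norm `‖F‖_{L²_{[0,T]} Ḣ^s}`: the `L²([0,T]; L²)` norm of the (strongly measurable)
function `t ↦ (-Δ)^{s/2} F(t)`; it is `∞` if there is no such function. -/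
def l2HdotNorm (T s : ℝ) (F : ℝ → Dist) : ℝ≥0∞ :=
  ⨅ (G : ℝ → L2) (_ : AEStronglyMeasurable G (volume.restrict (Icc 0 T)))
    (_ : ∀ᵐ t ∂(volume.restrict (Icc 0 T)), IsFracLaplacian s (F t) (G t)),
    eLpNorm G 2 (volume.restrict (Icc 0 T))

/-- The tempered distribution `f` is given by the function `p`. -/
def IsGivenBy (f : Dist) (p : Plane → C3) : Prop :=
  ∀ φ : 𝓢(Plane, ℂ), Integrable (fun x => φ x • p x) ∧ f φ = ∫ x, φ x • p x

/-- `h = f ∧ g`, the pointwise cross product: `f`, `g` and `h` are functions, and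
`h(x) = f(x) ∧ g(x)` for almost every `x`. -/
def IsWedge (f g h : Dist) : Prop :=
  ∃ p q : Plane → C3, IsGivenBy f p ∧ IsGivenBy g q ∧
    IsGivenBy h (fun x => WithLp.toLp 2 ((p x).ofLp ⨯₃ (q x).ofLp))

/-- The partial derivative `f_x`. -/
def dx (f : Dist) : Dist := ∂_{(EuclideanSpace.single 0 1 : Plane)} f

/-- The partial derivative `f_y`. -/
def dy (f : Dist) : Dist := ∂_{(EuclideanSpace.single 1 1 : Plane)} f

/-- The operator `cos(t √(-Δ))` on tempered distributions. -/
def cosProp (t : ℝ) (f : Dist) : Dist :=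
  TemperedDistribution.fourierMultiplierCLM C3
    (fun ξ : Plane => ((Real.cos (t * (2 * Real.pi * ‖ξ‖)) : ℝ) : ℂ)) f

/-- The operator `sin(t √(-Δ)) / √(-Δ)` on tempered distributions; its symbol is
`sin(t r) / r = t sinc(t r)` with `r = 2π|ξ|`. -/
def sinProp (t : ℝ) (f : Dist) : Dist :=
  TemperedDistribution.fourierMultiplierCLM C3
    (fun ξ : Plane => ((t * Real.sinc (t * (2 * Real.pi * ‖ξ‖)) : ℝ) : ℂ)) f

/-- `v = ∂_t u` on `[0,T]`, in the sense of tempered distributions on the plane (one-sided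
derivatives at the end points). -/
def IsTimeDeriv (T : ℝ) (u v : ℝ → Dist) : Prop :=
  ∀ t ∈ Icc 0 T, ∀ φ : 𝓢(Plane, ℂ),
    HasDerivWithinAt (fun s => u s φ) (v t φ) (Icc 0 T) t

/-- `u` solves the integral equation
`u(t) = cos(t√(-Δ)) u₀ + sin(t√(-Δ))/√(-Δ) u₁ - ∫₀ᵗ sin((t-s)√(-Δ))/√(-Δ) (2 F(s)) ds` for
`t ∈ [0,T]`, that is, Duhamel's formula for `(-∂_t² + Δ) u = 2 F` with data `(u₀, u₁)`. The
integral is the weak one, against test functions. -/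
def SolvesDuhamel (T : ℝ) (u₀ u₁ : Dist) (F u : ℝ → Dist) : Prop :=
  ∀ t ∈ Icc 0 T, ∀ φ : 𝓢(Plane, ℂ),
    IntervalIntegrable (fun s => sinProp (t - s) ((2 : ℂ) • F s) φ) volume 0 t ∧
    u t φ = cosProp t u₀ φ + sinProp t u₁ φ -
      ∫ s in (0 : ℝ)..t, sinProp (t - s) ((2 : ℂ) • F s) φ

/-- `u`, with time derivative `v = ∂_t u`, is a real-valued Duhamel solution on `[0,T]` of
`(-∂_t² + Δ) u = 2 u_x ∧ u_y`, `u(0) = u₀`, `∂_t u(0) = u₁`, with `‖u‖_{C⁰ Ḣ^{3/2}} < ∞`,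
`‖∂_t u‖_{C⁰ Ḣ^{1/2}} < ∞` and `‖u_x ∧ u_y‖_{L² Ḣ^{1/2}} ≤ A`. Here `F` is `u_x ∧ u_y`. -/
structure IsSolution (T A : ℝ) (u₀ u₁ : Dist) (u v : ℝ → Dist) : Prop where
  real : ∀ t ∈ Icc 0 T, IsReal (u t)
  timeDeriv : IsTimeDeriv T u v
  bounded : supHdotNorm T (3 / 2) u < ∞
  bounded_timeDeriv : supHdotNorm T (1 / 2) v < ∞
  duhamel : ∃ F : ℝ → Dist, (∀ t ∈ Icc 0 T, IsWedge (dx (u t)) (dy (u t)) (F t)) ∧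
    l2HdotNorm T (1 / 2) F ≤ ENNReal.ofReal A ∧ SolvesDuhamel T u₀ u₁ F u

/-- The set of real-valued initial data with `‖u₀‖_{Ḣ^{3/2}} + ‖u₁‖_{Ḣ^{1/2}} ≤ K`. -/
def dataBall (K : ℝ) : Set (Dist × Dist) :=
  {d | IsReal d.1 ∧ IsReal d.2 ∧
    hdotNorm (3 / 2) d.1 + hdotNorm (1 / 2) d.2 ≤ ENNReal.ofReal K}

end WaveCMC

end

noncomputable section

namespace WaveCMC

/-! ### Temperate growth of the symbols cos(tr) and sin(tr)/r -/

section TemperateSymbols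

/-! Write r = 2π|ξ|. For a solution u, the function r^{3/2} û has the form e^{itr} p(t) + e^{-itr}
q(t), with p and q constant in t when there is no forcing. Everything rests on a bilinear estimate
for free waves: the null form u_x ∧ v_y + v_x ∧ u_y is bounded in L²_t Ḣ^{1/2} by the product of the
sizes of the data in Ḣ^{3/2} × Ḣ^{1/2}. At a fixed output frequency ξ the null form of two half
waves is an integral over η of e^{2πit(±|η|±|ξ-η|)} against a kernel k(ξ,η). Duality and Plancherel
in t (`lintegral_oscillatory_sq_le`) reduce the estimate to the statement that the push-forward of
|k(ξ,η)|² dη under the phase has a density bounded uniformly in ξ. In elliptic coordinates (μ,ν)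
with foci 0 and ξ the phase is, up to sign, |ξ| cosh μ or |ξ| cos ν, a function of one coordinate
only. Thanks to the determinant in the null form, the weight integrated over the other coordinate is
at most a constant times |ξ||sinh μ| or |ξ||sin ν|, the Jacobian of the remaining one-dimensional
substitution (`lintegral_nullKernelC_le`).

The estimate is proved for bounded data supported in annuli and extended by density
(`exists_nullFormCurve_free`). For a forced wave, p(t) = c + ∫₀ᵗ h is a superposition of free waves
switched on at different times, so the estimate persists with ‖c‖ replaced by ‖c‖ + ∫‖h‖ ≤ ‖c‖ + √T
‖h‖ (`exists_nullFormCurve_primitive`). The factor √T is the only source of smallness.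

The unknown of the fixed point problem is the curve H = r^{1/2} 𝓕(u_x ∧ u_y) in L²([0,T];L²).
Sending H to the nonlinearity of the wave with forcing H is a contraction of the ball of radius 64K²
when 128K√T = 1 (`norm_nullFormCurve_sub_le_of_small`). This gives existence with A = 32K²,
uniqueness, and Lipschitz dependence on the data.

The rest is translation. Duhamel's formula is equivalent to û(t) = û₀ + r^{-1/2} ∫₀ᵗ r^{1/2} ∂_tû ds
(`solvesDuhamel_iff`), a form which keeps the additive constant that Ḣ^{3/2} does not see. The
pointwise product of gradients has the null form as its Fourier transform (`fourier_wedge`). Reality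
of u is invariance under a(ξ) ↦ conj a(-ξ), which the fixed point inherits from the data by
uniqueness (`IsSelfConsistent.reflCurve_eq`). -/

theorem hasTemperateGrowth_of_fderiv_family {E : Type*} [NormedAddCommGroup E]
    [InnerProductSpace ℝ E] (g : ℕ → E → ℝ) (c B : ℕ → ℝ)
    (hd : ∀ k x, HasFDerivAt (g k) ((c k * g (k + 1) x) • innerSL ℝ x) x)
    (hb : ∀ k x, |g k x| ≤ B k) (k : ℕ) : (g k).HasTemperateGrowth := by
  have hfd : ∀ k, fderiv ℝ (g k) = fun x => (c k * g (k + 1) x) • innerSL ℝ x :=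
    fun k => funext fun x => (hd k x).fderiv
  -- The induction treats all k at once, since n+1 derivatives of `g k` cost n derivatives of `g (k
  -- + 1)`. The Leibniz rule supplies 2^n as the sum of the binomial coefficients, and B k covers
  -- the order zero.
  have key : ∀ n : ℕ, ∀ k, ContDiff ℝ n (g k) ∧ ∃ (N : ℕ) (C : ℝ), 0 ≤ C ∧ ∀ m ≤ n, ∀ x,
      ‖iteratedFDeriv ℝ m (g k) x‖ ≤ C * (1 + ‖x‖) ^ N := by
    intro n
    induction n with
    | zero =>
      intro k
      refine ⟨?_, 0, B k, (abs_nonneg _).trans (hb k 0), ?_⟩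
      · exact contDiff_zero.2 (Differentiable.continuous (𝕜 := ℝ)
          fun x => (hd k x).differentiableAt)
      · intro m hm x
        obtain rfl : m = 0 := by omega
        simpa using hb k x
    | succ n ih =>
      intro k
      obtain ⟨h1, N, C, hC, hN⟩ := ih (k + 1)
      have hL := (innerSL ℝ (E := E)).hasTemperateGrowth
      obtain ⟨N', C', hC', hN'⟩ := hL.norm_iteratedFDeriv_le_uniform n
      have hcg : ContDiff ℝ n (fun x => c k * g (k + 1) x) := contDiff_const.mul h1
      have hB : 0 ≤ B k := (abs_nonneg _).trans (hb k 0)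
      refine ⟨?_, N + N', B k + 2 ^ n * (|c k| * C * C'), by positivity, ?_⟩
      · rw [Nat.cast_succ]
        refine contDiff_succ_iff_fderiv.2 ⟨fun x => (hd k x).differentiableAt, by simp, ?_⟩
        rw [hfd]
        exact hcg.smul (hL.1.of_le (by exact_mod_cast le_top))
      · intro m hm x
        have h1x : (1 : ℝ) ≤ (1 + ‖x‖) ^ (N + N') := one_le_pow₀ (by linarith [norm_nonneg x])
        rcases m with _ | m
        · simp only [norm_iteratedFDeriv_zero, Real.norm_eq_abs]
          calc |g k x| ≤ B k * 1 := by simpa using hb k x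
            _ ≤ _ := by gcongr; linarith [show 0 ≤ 2 ^ n * (|c k| * C * C') by positivity]
        · rw [← norm_iteratedFDeriv_fderiv, hfd]
          have hmn : m ≤ n := by omega
          refine (norm_iteratedFDeriv_smul_le hcg (hL.1.of_le (by exact_mod_cast le_top)) x
            (by exact_mod_cast hmn)).trans ?_
          have hterm : ∀ i ∈ Finset.range (m + 1),
              (m.choose i : ℝ) * ‖iteratedFDeriv ℝ i (fun x => c k * g (k + 1) x) x‖ *
                ‖iteratedFDeriv ℝ (m - i) (fun x => innerSL ℝ (E := E) x) x‖
              ≤ (m.choose i : ℝ) * ((|c k| * C * C') * (1 + ‖x‖) ^ (N + N')) := by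
            intro i hi
            have hi' : i ≤ m := by simpa [Nat.lt_succ_iff] using hi
            have e1 : ‖iteratedFDeriv ℝ i (fun x => c k * g (k + 1) x) x‖
                ≤ |c k| * (C * (1 + ‖x‖) ^ N) := by
              have : (fun x => c k * g (k + 1) x) = c k • g (k + 1) := rfl
              rw [this, iteratedFDeriv_const_smul_apply
                ((h1.of_le (by exact_mod_cast hi'.trans hmn)).contDiffAt), norm_smul,
                Real.norm_eq_abs]
              gcongr
              exact hN i (hi'.trans hmn) x
            have e2 := hN' (m - i) (by omega) x
            rw [mul_assoc]
            refine mul_le_mul_of_nonneg_left ?_ (by positivity)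
            calc _ ≤ (|c k| * (C * (1 + ‖x‖) ^ N)) * (C' * (1 + ‖x‖) ^ N') := by gcongr
              _ = _ := by rw [pow_add]; ring
          refine (Finset.sum_le_sum hterm).trans ?_
          rw [← Finset.sum_mul]
          have : (∑ i ∈ Finset.range (m + 1), (m.choose i : ℝ)) = 2 ^ m := by
            exact_mod_cast Nat.sum_range_choose m
          rw [this, ← mul_assoc]
          gcongr
          have : (2 : ℝ) ^ m ≤ 2 ^ n := pow_le_pow_right₀ (by norm_num) hmn
          have h0 : 0 ≤ |c k| * C * C' := by positivity
          nlinarith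
  refine ⟨contDiff_infty.2 fun n => (key n k).1, fun n => ?_⟩
  obtain ⟨-, N, C, -, h⟩ := key n k
  exact ⟨N, C, h n le_rfl⟩

/-- The moments `∫_{-1}^1 cos(xτ) (1-τ²)^k dτ`, multiples of `x^{-k-1/2} J_{k+1/2}(x)`. -/
def besselMoment (k : ℕ) (x : ℝ) : ℝ := ∫ τ in (-1 : ℝ)..1, Real.cos (x * τ) * (1 - τ ^ 2) ^ k

theorem besselMoment_abs_le (k : ℕ) (x : ℝ) : |besselMoment k x| ≤ 2 := by
  have := intervalIntegral.norm_integral_le_of_norm_le_const (a := -1) (b := 1) (C := 1)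
    (f := fun τ => Real.cos (x * τ) * (1 - τ ^ 2) ^ k) ?_
  · simpa [besselMoment, show (1 : ℝ) + 1 = 2 by norm_num] using this
  · intro τ hτ
    rw [Set.uIoc_of_le (by norm_num)] at hτ
    have h1 : |1 - τ ^ 2| ≤ 1 := by
      rw [abs_le]; constructor <;> nlinarith [hτ.1, hτ.2]
    rw [norm_mul, norm_pow, Real.norm_eq_abs, Real.norm_eq_abs]
    exact mul_le_one₀ (Real.abs_cos_le_one _) (by positivity) (pow_le_one₀ (abs_nonneg _) h1)

/-- Differentiation under the integral produces τ(1-τ²)^k, which is a multiple of the derivative of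
(1-τ²)^{k+1}. This vanishes at ±1, so integration by parts leaves no boundary term and yields the
factor x. -/
theorem besselMoment_hasDerivAt (k : ℕ) (x : ℝ) :
    HasDerivAt (besselMoment k) (-(1 / (2 * (k + 1))) * x * besselMoment (k + 1) x) x := by
  have h := (intervalIntegral.hasDerivAt_integral_of_dominated_loc_of_deriv_le (μ := volume)
    (a := -1) (b := 1)
    (F := fun x τ => Real.cos (x * τ) * (1 - τ ^ 2) ^ k)
    (F' := fun x τ => (-Real.sin (x * τ) * τ) * (1 - τ ^ 2) ^ k) (x₀ := x) (s := univ)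
    (bound := fun _ => 1) Filter.univ_mem
    (Filter.Eventually.of_forall fun y => (by fun_prop : Continuous _).aestronglyMeasurable)
    ((by fun_prop : Continuous _).intervalIntegrable _ _)
    ((by fun_prop : Continuous _).aestronglyMeasurable) ?_ (by simp) ?_).2
  · refine h.congr_deriv ?_
    have hp := intervalIntegral.integral_mul_deriv_eq_deriv_mul (a := -1) (b := 1)
      (u := fun τ => Real.sin (x * τ)) (u' := fun τ => Real.cos (x * τ) * x)
      (v := fun τ => (1 - τ ^ 2) ^ (k + 1))
      (v' := fun τ => ((k + 1 : ℕ) : ℝ) * (1 - τ ^ 2) ^ k * (-(2 * τ)))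
      (fun τ _ => by
        have := ((hasDerivAt_id τ).const_mul x).sin
        simpa using this)
      (fun τ _ => by
        have := (((hasDerivAt_id τ).pow 2).const_sub 1).pow (k + 1)
        refine this.congr_deriv ?_
        simp)
      ((by fun_prop : Continuous _).intervalIntegrable _ _)
      ((by fun_prop : Continuous _).intervalIntegrable _ _)
    have e1 : (∫ τ in (-1 : ℝ)..1, Real.sin (x * τ) *
        (((k + 1 : ℕ) : ℝ) * (1 - τ ^ 2) ^ k * (-(2 * τ))))
        = (2 * ((k : ℝ) + 1)) * ∫ τ in (-1 : ℝ)..1, (-Real.sin (x * τ) * τ) * (1 - τ ^ 2) ^ k := by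
      rw [← intervalIntegral.integral_const_mul]
      congr 1; ext τ; push_cast; ring
    have e2 : (∫ τ in (-1 : ℝ)..1, Real.cos (x * τ) * x * (1 - τ ^ 2) ^ (k + 1))
        = x * besselMoment (k + 1) x := by
      rw [besselMoment, ← intervalIntegral.integral_const_mul]
      congr 1; ext τ; ring
    rw [e1, e2] at hp
    simp only [one_pow, sub_self, ne_eq, Nat.add_eq_zero_iff, one_ne_zero, and_false,
      not_false_eq_true, zero_pow, mul_zero, even_two, Even.neg_pow, zero_sub] at hp
    have hk : (2 * ((k : ℝ) + 1)) ≠ 0 := by positivity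
    rw [← mul_right_inj' hk, hp]
    field_simp
  · refine Filter.Eventually.of_forall fun τ hτ y _ => ?_
    rw [Set.uIoc_of_le (by norm_num)] at hτ
    have h1 : |1 - τ ^ 2| ≤ 1 := by
      rw [abs_le]; constructor <;> nlinarith [hτ.1, hτ.2]
    have h2 : |τ| ≤ 1 := abs_le.2 ⟨hτ.1.le, hτ.2⟩
    rw [norm_mul, norm_pow, norm_mul, norm_neg, Real.norm_eq_abs, Real.norm_eq_abs,
      Real.norm_eq_abs]
    exact mul_le_one₀ (mul_le_one₀ (Real.abs_sin_le_one _) (abs_nonneg _) h2)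
      (by positivity) (pow_le_one₀ (abs_nonneg _) h1)
  · refine Filter.Eventually.of_forall fun τ _ y _ => ?_
    have := (((hasDerivAt_id y).mul_const τ).cos).mul_const ((1 - τ ^ 2) ^ k)
    simpa using this

theorem besselMoment_zero (x : ℝ) : besselMoment 0 x = 2 * Real.sinc x := by
  rcases eq_or_ne x 0 with rfl | hx
  · norm_num [besselMoment]
  · have h := intervalIntegral.integral_comp_mul_left (a := -1) (b := 1) Real.cos hx
    simp only [besselMoment, pow_zero, mul_one]
    rw [h, integral_cos, Real.sinc_of_ne_zero hx]
    simp
    field_simp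
    ring

/-- A radial family closed under `f ↦ f'(x)/x`, starting with the cosine. -/
def besselFamily : ℕ → ℝ → ℝ
  | 0 => Real.cos
  | k + 1 => besselMoment k

theorem besselFamily_hasDerivAt (k : ℕ) : ∃ c : ℝ, ∀ x,
    HasDerivAt (besselFamily k) (c * x * besselFamily (k + 1) x) x := by
  rcases k with _ | k
  · refine ⟨-(1 / 2), fun x => (Real.hasDerivAt_cos x).congr_deriv ?_⟩
    simp only [besselFamily, besselMoment_zero]
    rcases eq_or_ne x 0 with rfl | hx
    · simp
    · rw [Real.sinc_of_ne_zero hx]; field_simp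
  · exact ⟨_, besselMoment_hasDerivAt k⟩

theorem besselFamily_abs_le (k : ℕ) (x : ℝ) : |besselFamily k x| ≤ 2 := by
  rcases k with _ | k
  · exact (Real.abs_cos_le_one x).trans (by norm_num)
  · exact besselMoment_abs_le k x

/-- The multipliers act by pointwise products only when their symbols have temperate growth, and |ξ|
is not smooth at the origin. The relation f'(x) = c x f₊(x) cures this: the gradient of f(a|ξ|) is c
a² f₊(a|ξ|) ξ, where the factor |ξ| cancels the singularity of ∇|ξ|. At ξ = 0 differentiability
comes from f'(0) = 0. -/
theorem hasTemperateGrowth_besselFamily (a : ℝ) (k : ℕ) :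
    (fun ξ : Plane => besselFamily k (a * ‖ξ‖)).HasTemperateGrowth := by
  choose c hc using besselFamily_hasDerivAt
  refine hasTemperateGrowth_of_fderiv_family (fun k ξ => besselFamily k (a * ‖ξ‖))
    (fun k => c k * a ^ 2) (fun _ => 2) ?_ (fun k ξ => besselFamily_abs_le k _) k
  intro k ξ
  rcases eq_or_ne ξ 0 with rfl | hξ
  · have h0 : HasDerivAt (besselFamily k) 0 0 := by simpa using hc k 0
    have h1 := hasDerivAt_iff_isLittleO_nhds_zero.1 h0
    rw [hasFDerivAt_iff_isLittleO_nhds_zero]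
    have ht : Filter.Tendsto (fun h : Plane => a * ‖h‖) (nhds 0) (nhds 0) := by
      have : Continuous fun h : Plane => a * ‖h‖ := by fun_prop
      simpa using this.tendsto 0
    have h2 := h1.comp_tendsto ht
    have h3 : (fun h : Plane => a * ‖h‖) =O[nhds 0] fun h => h :=
      Asymptotics.IsBigO.of_bound |a| (Filter.Eventually.of_forall fun h => by
        simp [norm_mul])
    refine (h2.trans_isBigO h3).congr_left fun h => ?_
    simp
  · have hn : HasFDerivAt (fun x : Plane => ‖x‖) (‖ξ‖⁻¹ • innerSL ℝ ξ) ξ := by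
      have h := (hasStrictFDerivAt_norm_sq ξ).hasFDerivAt.sqrt (by simpa using hξ)
      refine (h.congr_of_eventuallyEq ?_).congr_fderiv ?_
      · exact Filter.Eventually.of_forall fun x => by simp
      · ext v
        simp
        field_simp
    refine ((hc k (a * ‖ξ‖)).comp_hasFDerivAt ξ (hn.const_mul a)).congr_fderiv ?_
    ext v
    have : ‖ξ‖ ≠ 0 := by simpa using hξ
    simp
    field_simp

theorem hasTemperateGrowth_cosSymbol (t : ℝ) :
    (fun ξ : Plane => ((Real.cos (t * (2 * Real.pi * ‖ξ‖)) : ℝ) : ℂ)).HasTemperateGrowth := by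
  have h := hasTemperateGrowth_besselFamily (t * (2 * Real.pi)) 0
  simp only [besselFamily, mul_assoc] at h
  simp only [mul_assoc]
  exact Function.Complex.hasTemperateGrowth_ofReal.comp h

theorem hasTemperateGrowth_sinSymbol (t : ℝ) :
    (fun ξ : Plane => ((t * Real.sinc (t * (2 * Real.pi * ‖ξ‖)) : ℝ) : ℂ)).HasTemperateGrowth := by
  have h := (Function.HasTemperateGrowth.const (E := Plane) (t / 2)).mul
    (hasTemperateGrowth_besselFamily (t * (2 * Real.pi)) 1)
  simp only [besselFamily, besselMoment_zero, mul_assoc] at h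
  simp only [mul_assoc]
  refine (congrArg Function.HasTemperateGrowth (funext fun ξ => ?_)).mp
    (Function.Complex.hasTemperateGrowth_ofReal.comp h)
  simp only [Function.comp, Pi.mul_apply]
  congr 1
  ring

end TemperateSymbols

/-! ### The Fourier transform on L¹ ∩ L² -/

section FourierL2

variable {V F : Type*} [NormedAddCommGroup V] [InnerProductSpace ℝ V] [FiniteDimensional ℝ V]
  [MeasurableSpace V] [BorelSpace V] [NormedAddCommGroup F] [InnerProductSpace ℂ F]

theorem continuous_fourier_of_integrable {h : V → F} (h1 : Integrable h) : Continuous (𝓕 h) :=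
  VectorFourier.fourierIntegral_continuous (L := innerₗ V) Real.continuous_fourierChar
    continuous_inner h1

theorem norm_fourier_le_integral (h : V → F) (x : V) : ‖𝓕 h x‖ ≤ ∫ v, ‖h v‖ :=
  VectorFourier.norm_fourierIntegral_le_integral_norm Real.fourierChar volume (innerₗ V) h x

variable [CompleteSpace F]

/-- Smooth functions with compact support in U are Schwartz functions. The open set is kept general
for the sake of the punctured plane, on which the weights (2π|ξ|)^{-s} are continuous. -/
theorem ae_eq_zero_on_of_forall_schwartz {f : V → F} {U : Set V} (hU : IsOpen U)
    (hf : LocallyIntegrableOn f U)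
    (h : ∀ φ : 𝓢(V, ℂ), tsupport φ ⊆ U → ∫ x, φ x • f x = 0) : ∀ᵐ x, x ∈ U → f x = 0 := by
  refine hU.ae_eq_zero_of_integral_contDiff_smul_eq_zero hf fun g hg hc hs => ?_
  have h1 : HasCompactSupport (Complex.ofRealCLM ∘ g) := hc.comp_left rfl
  have h2 : ContDiff ℝ (⊤ : ℕ∞) (Complex.ofRealCLM ∘ g) :=
    Complex.ofRealCLM.contDiff.comp hg
  have h3 := h (h1.toSchwartzMap h2) ?_
  · simpa using h3
  · refine (closure_mono ?_).trans hs
    intro x hx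
    simp only [Function.mem_support] at hx ⊢
    intro h0
    exact hx (by simp [h0])

theorem ae_eq_of_forall_schwartz {f g : V → F} (hf : LocallyIntegrable f)
    (hg : LocallyIntegrable g)
    (hfi : ∀ φ : 𝓢(V, ℂ), Integrable fun x => φ x • f x)
    (hgi : ∀ φ : 𝓢(V, ℂ), Integrable fun x => φ x • g x)
    (h : ∀ φ : 𝓢(V, ℂ), ∫ x, φ x • f x = ∫ x, φ x • g x) : f =ᵐ[volume] g := by
  have h0 := ae_eq_zero_on_of_forall_schwartz (f := f - g) (U := univ) isOpen_univ
    (locallyIntegrableOn_univ.2 (hf.sub hg)) fun φ _ => by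
      simp only [Pi.sub_apply, smul_sub]
      rw [integral_sub (hfi φ) (hgi φ), h φ, sub_self]
  filter_upwards [h0] with x hx
  exact sub_eq_zero.1 (hx (mem_univ x))

theorem integral_fourier_smul_eq_of_integrable {f : V → ℂ} {g : V → F} (hf : Integrable f)
    (hg : Integrable g) : ∫ ξ, 𝓕 f ξ • g ξ = ∫ x, f x • 𝓕 g x := by
  have := VectorFourier.integral_fourierIntegral_smul_eq_flip (L := innerₗ V) (μ := volume)
    (ν := volume) Real.continuous_fourierChar continuous_inner hf hg
  simpa using! this

theorem integrable_smul_of_memLp_two {α : Type*} [MeasurableSpace α] {μ : Measure α}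
    {E : Type*} [NormedAddCommGroup E] [NormedSpace ℂ E] {f : α → ℂ} {g : α → E}
    (hf : MemLp f 2 μ) (hg : MemLp g 2 μ) : Integrable (fun x => f x • g x) μ :=
  memLp_one_iff_integrable.1 (hg.smul (r := 1) hf)

/-- Both transforms have the same integrals against Schwartz functions: the L² one by its
compatibility with distributions, the integral one by Fubini. -/
theorem fourier_toLp_ae_eq {h : V → F} (h1 : Integrable h) (h2 : MemLp h 2) :
    ((𝓕 (h2.toLp h) : Lp F 2 (volume : Measure V)) : V → F) =ᵐ[volume] 𝓕 h := by
  have hcont : Continuous (𝓕 h) := continuous_fourier_of_integrable h1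
  have hbd : ∀ x, ‖𝓕 h x‖ ≤ ∫ v, ‖h v‖ := norm_fourier_le_integral h
  refine ae_eq_of_forall_schwartz ((Lp.memLp _).locallyIntegrable (by norm_num))
    hcont.locallyIntegrable ?_ ?_ ?_
  · intro φ
    exact integrable_smul_of_memLp_two (φ.memLp 2 volume) (Lp.memLp _)
  · intro φ
    exact (φ.integrable.norm.mul_const _).mono'
      (φ.continuous.smul hcont).aestronglyMeasurable
      (Filter.Eventually.of_forall fun x => by
        rw [norm_smul]; gcongr; exact hbd x)
  · intro φ
    have e1 := congrArg (fun T => T φ) (Lp.fourier_toTemperedDistribution_eq (h2.toLp h))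
    simp only [TemperedDistribution.fourier_apply, Lp.toTemperedDistribution_apply] at e1
    rw [← e1, ← integral_fourier_smul_eq_of_integrable φ.integrable h1]
    refine integral_congr_ae ?_
    filter_upwards [h2.coeFn_toLp] with x hx
    rw [hx, SchwartzMap.fourier_coe]

theorem lintegral_fourier_sq_eq {h : V → F} (h1 : Integrable h) (h2 : MemLp h 2) :
    ∫⁻ x, ‖𝓕 h x‖ₑ ^ 2 = ∫⁻ x, ‖h x‖ₑ ^ 2 := by
  have e : eLpNorm (𝓕 h) 2 volume = eLpNorm h 2 volume := by
    rw [← eLpNorm_congr_ae (fourier_toLp_ae_eq h1 h2), ← Lp.enorm_def, ← eLpNorm_congr_ae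
      h2.coeFn_toLp, ← Lp.enorm_def, ← ofReal_norm, ← ofReal_norm, Lp.norm_fourier_eq]
  rw [eLpNorm_eq_lintegral_rpow_enorm_toReal (by norm_num) (by norm_num),
    eLpNorm_eq_lintegral_rpow_enorm_toReal (by norm_num) (by norm_num)] at e
  have := congrArg (fun z : ℝ≥0∞ => z ^ (2 : ℝ)) e
  simp only [← ENNReal.rpow_mul, ENNReal.toReal_ofNat, one_div, ne_eq,
    OfNat.ofNat_ne_zero, not_false_eq_true, inv_mul_cancel₀, ENNReal.rpow_one] at this
  simpa using this

end FourierL2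

/-! ### A dual restriction estimate -/

theorem lintegral_mul_sq_le {α : Type*} [MeasurableSpace α] (μ : Measure α) {f g : α → ℝ≥0∞}
    (hf : AEMeasurable f μ) (hg : AEMeasurable g μ) :
    (∫⁻ x, f x * g x ∂μ) ^ 2 ≤ (∫⁻ x, f x ^ 2 ∂μ) * ∫⁻ x, g x ^ 2 ∂μ := by
  have h := ENNReal.lintegral_mul_le_Lp_mul_Lq μ Real.HolderConjugate.two_two hf hg
  calc _ ≤ ((∫⁻ x, f x ^ (2 : ℝ) ∂μ) ^ (1 / (2 : ℝ)) * (∫⁻ x, g x ^ (2 : ℝ) ∂μ) ^ (1 / (2 : ℝ))) ^ 2 := by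
        gcongr; exact h
    _ = _ := by
      rw [mul_pow, ← ENNReal.rpow_two, ← ENNReal.rpow_two, ← ENNReal.rpow_mul, ← ENNReal.rpow_mul]
      simp

/-- A dual form of the restriction estimate: if the push-forward of `|k|² μ` under `a` has density
at most `C`, then `H ↦ ∫ e^{2πita} k H dμ` is bounded from `L²(μ)` to `L²(dt)`. -/
theorem lintegral_oscillatory_sq_le {Ω F : Type*} [MeasurableSpace Ω] {μ : Measure Ω} [SFinite μ]
    [NormedAddCommGroup F] [InnerProductSpace ℂ F] [CompleteSpace F]
    {a k : Ω → ℝ} {H : Ω → F} {C : ℝ≥0∞} (ha : Measurable a) (hk : Measurable k)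
    (hpush : ∀ h : ℝ → ℝ≥0∞, Measurable h → ∫⁻ ω, ‖k ω‖ₑ ^ 2 * h (a ω) ∂μ ≤ C * ∫⁻ x, h x)
    (hH : AEStronglyMeasurable H μ) (hkH : Integrable (fun ω => k ω • H ω) μ) {s : Set ℝ}
    (hs : MeasurableSet s) (hs' : volume s ≠ ∞) :
    ∫⁻ t in s, ‖∫ ω, Complex.exp (2 * Real.pi * t * a ω * Complex.I) • (k ω • H ω) ∂μ‖ₑ ^ 2
      ≤ C * ∫⁻ ω, ‖H ω‖ₑ ^ 2 ∂μ := by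
  set I : ℝ → F := fun t =>
    ∫ ω, Complex.exp (2 * Real.pi * t * a ω * Complex.I) • (k ω • H ω) ∂μ with hI
  have hexp : ∀ (t : ℝ) ω, ‖Complex.exp (2 * Real.pi * t * a ω * Complex.I)‖ = 1 := fun t ω => by
    have := Complex.norm_exp_ofReal_mul_I (2 * Real.pi * t * a ω)
    simpa using this
  have hmeas : ∀ t : ℝ, Measurable fun ω => Complex.exp (2 * Real.pi * t * a ω * Complex.I) :=
    fun t => by fun_prop
  have hIb : ∀ t, ‖I t‖ ≤ ∫ ω, ‖k ω • H ω‖ ∂μ := fun t => by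
    refine (norm_integral_le_integral_norm _).trans (le_of_eq ?_)
    refine integral_congr_ae (Filter.Eventually.of_forall fun ω => ?_)
    simp [norm_smul, hexp]
  have hIc : Continuous I := by
    refine continuous_of_dominated (bound := fun ω => ‖k ω • H ω‖) ?_ ?_ hkH.norm ?_
    · exact fun t => (hmeas t).aestronglyMeasurable.smul hkH.1
    · exact fun t => Filter.Eventually.of_forall fun ω => by simp [norm_smul, hexp]
    · exact Filter.Eventually.of_forall fun ω => by fun_prop
  -- The dual function is the oscillatory integral itself. Cutting it off to s, of finite measure,
  -- puts it in L¹ ∩ L².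
  set ψ : ℝ → F := s.indicator I with hψ
  have hψm : AEStronglyMeasurable ψ volume := hIc.aestronglyMeasurable.indicator hs
  have hIm : MemLp I ∞ (volume.restrict s) := memLp_top_of_bound hIc.aestronglyMeasurable _
    (Filter.Eventually.of_forall hIb)
  have : IsFiniteMeasure (volume.restrict s) := ⟨by simpa using hs'.lt_top⟩
  have hψ1 : Integrable ψ := (integrable_indicator_iff hs).2
    (memLp_one_iff_integrable.1 (hIm.mono_exponent le_top))
  have hψ2 : MemLp ψ 2 := (memLp_indicator_iff_restrict hs).2 (hIm.mono_exponent le_top)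
  have hcontF : Continuous (𝓕 ψ) := continuous_fourier_of_integrable hψ1
  set S := ∫⁻ t in s, ‖I t‖ₑ ^ 2 with hS
  have hSψ : S = ∫⁻ t, ‖ψ t‖ₑ ^ 2 := by
    rw [hS, ← lintegral_indicator hs]
    refine lintegral_congr fun t => ?_
    by_cases ht : t ∈ s <;> simp [hψ, ht]
  have hfin : S ≠ ∞ := by
    rw [hSψ]
    have := hψ2.eLpNorm_lt_top
    rw [eLpNorm_eq_lintegral_rpow_enorm_toReal (by norm_num) (by norm_num)] at this
    have := ENNReal.rpow_lt_top_of_nonneg (y := 2) (by norm_num) this.ne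
    rw [← ENNReal.rpow_mul] at this
    simpa using this.ne
  have hint : Integrable (fun p : ℝ × Ω => inner ℂ (ψ p.1)
      (Complex.exp (2 * Real.pi * p.1 * a p.2 * Complex.I) • (k p.2 • H p.2)))
      (volume.prod μ) := by
    refine (hψ1.norm.mul_prod hkH.norm).mono' ?_ ?_
    · refine AEStronglyMeasurable.inner hψm.comp_fst (AEStronglyMeasurable.smul ?_ hkH.1.comp_snd)
      have : Measurable fun p : ℝ × Ω => Complex.exp (2 * Real.pi * p.1 * a p.2 * Complex.I) := by
        fun_prop
      exact this.aestronglyMeasurable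
    · refine Filter.Eventually.of_forall fun p => (norm_inner_le_norm _ _).trans ?_
      rw [norm_smul, hexp, one_mul]
  -- By Fubini, ‖I‖² = ⟨ψ, I⟩ becomes the pairing of k H with 𝓕ψ evaluated at the phase a.
  have key : ((S.toReal : ℝ) : ℂ) = ∫ ω, inner ℂ (𝓕 ψ (a ω)) (k ω • H ω) ∂μ := by
    have e1 : ((S.toReal : ℝ) : ℂ) = ∫ t, inner ℂ (ψ t) (I t) := by
      rw [hSψ]
      have : ∀ t, inner ℂ (ψ t) (I t) = ((‖ψ t‖ ^ 2 : ℝ) : ℂ) := fun t => by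
        by_cases ht : t ∈ s
        · simp [hψ, ht, inner_self_eq_norm_sq_to_K]
        · simp [hψ, ht]
      simp_rw [this]
      rw [integral_complex_ofReal, integral_eq_lintegral_of_nonneg_ae (f := fun t => ‖ψ t‖ ^ 2)
        (Filter.Eventually.of_forall fun t => sq_nonneg ‖ψ t‖) (hψm.norm.pow 2)]
      congr 3
      ext t
      rw [ENNReal.ofReal_pow (norm_nonneg _), ofReal_norm]
    rw [e1]
    have e2 : ∀ t, inner ℂ (ψ t) (I t) = ∫ ω, inner ℂ (ψ t)
        (Complex.exp (2 * Real.pi * t * a ω * Complex.I) • (k ω • H ω)) ∂μ := fun t => by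
      rw [hI]
      refine (integral_inner ?_ _).symm
      exact hkH.bdd_smul 1 (hmeas t).aestronglyMeasurable
        (Filter.Eventually.of_forall fun ω => (hexp t ω).le)
    simp_rw [e2]
    rw [integral_integral_swap hint]
    refine integral_congr_ae (Filter.Eventually.of_forall fun ω => ?_)
    simp only
    have e3 : ∀ t : ℝ, inner ℂ (ψ t)
        (Complex.exp (2 * Real.pi * t * a ω * Complex.I) • (k ω • H ω))
        = (starRingEnd ℂ) (inner ℂ (k ω • H ω)
          (Complex.exp (↑(-2 * Real.pi * t * a ω) * Complex.I) • ψ t)) := fun t => by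
      rw [inner_conj_symm, inner_smul_left, inner_smul_right, ← Complex.exp_conj]
      congr 2
      simp only [map_mul, map_neg, map_ofNat, Complex.conj_ofReal, Complex.conj_I, Complex.ofReal_mul,
        Complex.ofReal_neg, Complex.ofReal_ofNat]
      ring
    simp_rw [e3]
    rw [integral_conj, integral_inner, inner_conj_symm, Real.fourier_real_eq_integral_exp_smul]
    · refine hψ1.bdd_smul 1 (Continuous.aestronglyMeasurable (by fun_prop)) (Filter.Eventually.of_forall fun t => ?_)
      exact (Complex.norm_exp_ofReal_mul_I _).le
  have hle : S ≤ ∫⁻ ω, (‖k ω‖ₑ * ‖𝓕 ψ (a ω)‖ₑ) * ‖H ω‖ₑ ∂μ := by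
    calc S = ‖((S.toReal : ℝ) : ℂ)‖ₑ := by
          rw [← ofReal_norm, Complex.norm_real, Real.norm_of_nonneg ENNReal.toReal_nonneg,
            ENNReal.ofReal_toReal hfin]
      _ ≤ ∫⁻ ω, ‖inner ℂ (𝓕 ψ (a ω)) (k ω • H ω)‖ₑ ∂μ := by
          rw [key]; exact enorm_integral_le_lintegral_enorm _
      _ ≤ _ := by
          refine lintegral_mono fun ω => ?_
          rw [← ofReal_norm, ← ofReal_norm, ← ofReal_norm, ← ofReal_norm,
            ← ENNReal.ofReal_mul (norm_nonneg _), ← ENNReal.ofReal_mul (by positivity)]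
          refine ENNReal.ofReal_le_ofReal ((norm_inner_le_norm _ _).trans (le_of_eq ?_))
          rw [norm_smul]; ring
  -- Cauchy-Schwarz in ω, then the push-forward bound with |𝓕ψ|² as the test function, then
  -- Plancherel, which returns S. One factor S is cancelled at the end, which is why S must be known
  -- to be finite.
  have hsq : S ^ 2 ≤ (C * S) * ∫⁻ ω, ‖H ω‖ₑ ^ 2 ∂μ := by
    calc S ^ 2 ≤ _ := pow_le_pow_left' hle 2
      _ ≤ (∫⁻ ω, (‖k ω‖ₑ * ‖𝓕 ψ (a ω)‖ₑ) ^ 2 ∂μ) * ∫⁻ ω, ‖H ω‖ₑ ^ 2 ∂μ :=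
          lintegral_mul_sq_le μ (hk.enorm.mul
            (hcontF.enorm.measurable.comp ha)).aemeasurable hH.enorm
      _ ≤ _ := by
          gcongr
          simp_rw [mul_pow]
          refine (hpush (fun x => ‖𝓕 ψ x‖ₑ ^ 2) (hcontF.enorm.measurable.pow_const 2)).trans ?_
          rw [lintegral_fourier_sq_eq hψ1 hψ2, hSψ]
  rcases eq_or_ne S 0 with h0 | h0
  · rw [h0]; exact zero_le
  · rw [sq, mul_right_comm] at hsq
    exact (ENNReal.mul_le_mul_iff_left h0 hfin).1 hsq

/-! ### The weight of the null form in elliptic coordinates -/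

section Pushforward

/-- What matters is that the value is linear in the width S: it will be matched with the Jacobian of
the phase. -/
theorem lintegral_lorentzian {b S : ℝ} (hb : 0 < b) (hS : 0 < S) (c : ℝ) :
    ∫⁻ x, ENNReal.ofReal (S ^ 2 / (S ^ 2 + (b * (x - c)) ^ 2)) = ENNReal.ofReal (S * Real.pi / b) := by
  have hbS : b / S ≠ 0 := (div_pos hb hS).ne'
  have hf : ∀ x, S ^ 2 / (S ^ 2 + (b * (x - c)) ^ 2) = (1 + (b / S * (x - c)) ^ 2)⁻¹ := fun x => by
    field_simp
  simp_rw [hf]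
  have hi : Integrable fun x : ℝ => (1 + (b / S * (x - c)) ^ 2)⁻¹ :=
    (integrable_inv_one_add_sq.comp_mul_left' hbS).comp_sub_right c
  rw [← ofReal_integral_eq_lintegral_ofReal hi
    (Filter.Eventually.of_forall fun x => by positivity)]
  rw [integral_sub_right_eq_self (fun x : ℝ => (1 + (b / S * x) ^ 2)⁻¹) c,
    Measure.integral_comp_mul_left (fun x : ℝ => (1 + x ^ 2)⁻¹), integral_univ_inv_one_add_sq,
    abs_of_pos (by positivity)]
  congr 1
  simp
  field_simp

theorem abs_le_abs_sinh (x : ℝ) : |x| ≤ |Real.sinh x| := by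
  rw [Real.abs_sinh]; exact Real.self_le_sinh_iff.2 (abs_nonneg x)

/-- The weight of the null form in elliptic coordinates, with `S = sinh μ` and `σ = sin ν`. -/
theorem ellipticWeight_le {S σ m : ℝ} (hm : |m| ≤ |σ|) :
    4 * (S ^ 2 * σ ^ 2 / (S ^ 2 + σ ^ 2) ^ 2) ≤ 4 * (S ^ 2 / (S ^ 2 + m ^ 2)) := by
  have h1 : m ^ 2 ≤ σ ^ 2 := sq_le_sq.2 hm
  rcases (sq_nonneg S).eq_or_lt with h | h
  · rw [← h]; simp
  · refine mul_le_mul_of_nonneg_left ?_ (by norm_num)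
    rw [div_le_div_iff₀ (by positivity) (by positivity)]
    have : 0 ≤ m ^ 2 := sq_nonneg m
    nlinarith [mul_nonneg h.le h.le, mul_nonneg h.le (sq_nonneg σ), sq_nonneg (σ ^ 2)]

/-- Since |sinh μ| ≥ |μ|, the weight lies below a Lorentzian of width |σ|. The constant is larger
than needed, so that it agrees with the one for the integral over ν. -/
theorem lintegral_ellipticWeight_sinh_le (σ : ℝ) :
    ∫⁻ μ, ENNReal.ofReal (4 * (Real.sinh μ ^ 2 * σ ^ 2 / (Real.sinh μ ^ 2 + σ ^ 2) ^ 2))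
      ≤ ENNReal.ofReal (16 * Real.pi ^ 2 * |σ|) := by
  rcases eq_or_ne σ 0 with rfl | hσ
  · simp
  have hσ' : 0 < |σ| := abs_pos.2 hσ
  calc _ ≤ ∫⁻ μ, ENNReal.ofReal 4 * ENNReal.ofReal (|σ| ^ 2 / (|σ| ^ 2 + (1 * (μ - 0)) ^ 2)) := by
        refine lintegral_mono fun μ => ?_
        rw [← ENNReal.ofReal_mul (by norm_num)]
        refine ENNReal.ofReal_le_ofReal ?_
        have := ellipticWeight_le (S := |σ|) (abs_le_abs_sinh μ)
        rw [sq_abs] at this ⊢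
        rw [one_mul, sub_zero]
        refine (le_of_eq ?_).trans this
        rw [mul_comm (Real.sinh μ ^ 2), add_comm (Real.sinh μ ^ 2)]
    _ = _ := by
        rw [lintegral_const_mul' _ _ ENNReal.ofReal_ne_top, lintegral_lorentzian one_pos hσ']
    _ ≤ _ := by
        rw [← ENNReal.ofReal_mul (by norm_num)]
        refine ENNReal.ofReal_le_ofReal ?_
        have := Real.pi_gt_three
        nlinarith [mul_pos hσ' Real.pi_pos]

/-- The sine vanishes at -π, 0 and π. Within π/2 of each zero c one has |sin ν| ≥ (2/π)|ν - c|, so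
three Lorentzians of integral 2π²|S| dominate the weight. -/
theorem lintegral_ellipticWeight_sin_le (S : ℝ) :
    ∫⁻ ν in Icc (-Real.pi) Real.pi,
      ENNReal.ofReal (4 * (S ^ 2 * Real.sin ν ^ 2 / (S ^ 2 + Real.sin ν ^ 2) ^ 2))
      ≤ ENNReal.ofReal (16 * Real.pi ^ 2 * |S|) := by
  rcases eq_or_ne S 0 with rfl | hS
  · simp
  have hS' : 0 < |S| := abs_pos.2 hS
  have hb : 0 < 2 / Real.pi := by positivity
  have hpi := Real.pi_pos
  set L : ℝ → ℝ → ℝ≥0∞ := fun c ν =>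
    ENNReal.ofReal 4 * ENNReal.ofReal (|S| ^ 2 / (|S| ^ 2 + (2 / Real.pi * (ν - c)) ^ 2)) with hL
  have hLm : ∀ c, Measurable (L c) := fun c => by fun_prop
  have hLi : ∀ c, ∫⁻ ν, L c ν = ENNReal.ofReal (2 * Real.pi ^ 2 * |S|) := fun c => by
    rw [hL, lintegral_const_mul' _ _ ENNReal.ofReal_ne_top, lintegral_lorentzian hb hS',
      ← ENNReal.ofReal_mul (by norm_num)]
    congr 1
    field_simp
    ring
  have hpt : ∀ ν ∈ Icc (-Real.pi) Real.pi,
      ENNReal.ofReal (4 * (S ^ 2 * Real.sin ν ^ 2 / (S ^ 2 + Real.sin ν ^ 2) ^ 2))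
      ≤ L (-Real.pi) ν + L 0 ν + L Real.pi ν := by
    intro ν hν
    have key : ∀ c, |ν - c| ≤ Real.pi / 2 → |Real.sin (ν - c)| = |Real.sin ν| →
        ENNReal.ofReal (4 * (S ^ 2 * Real.sin ν ^ 2 / (S ^ 2 + Real.sin ν ^ 2) ^ 2)) ≤ L c ν := by
      intro c hc hs
      rw [hL]
      simp only
      rw [← ENNReal.ofReal_mul (by norm_num), sq_abs]
      refine ENNReal.ofReal_le_ofReal (ellipticWeight_le ?_)
      rw [← hs, abs_mul, abs_of_pos hb]
      exact Real.mul_abs_le_abs_sin hc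
    rcases le_total ν (-(Real.pi / 2)) with h1 | h1
    · refine (key (-Real.pi) ?_ ?_).trans ?_
      · rw [abs_le]; constructor <;> linarith [hν.1]
      · rw [sub_neg_eq_add, Real.sin_add_pi, abs_neg]
      · rw [add_assoc]; exact le_self_add
    · rcases le_total ν (Real.pi / 2) with h2 | h2
      · refine (key 0 ?_ (by simp)).trans ?_
        · rw [sub_zero, abs_le]; exact ⟨h1, h2⟩
        · rw [add_right_comm]; exact le_add_self
      · refine (key Real.pi ?_ ?_).trans le_add_self
        · rw [abs_le]; constructor <;> linarith [hν.2]
        · rw [Real.sin_sub_pi, abs_neg]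
  calc _ ≤ ∫⁻ ν in Icc (-Real.pi) Real.pi, (L (-Real.pi) ν + L 0 ν + L Real.pi ν) :=
        setLIntegral_mono (by fun_prop) hpt
    _ ≤ ∫⁻ ν, (L (-Real.pi) ν + L 0 ν + L Real.pi ν) := setLIntegral_le_lintegral _ _
    _ = _ := by rw [lintegral_add_left (by fun_prop), lintegral_add_left (hLm _), hLi, hLi, hLi]
    _ ≤ _ := by
      rw [← ENNReal.ofReal_add (by positivity) (by positivity),
        ← ENNReal.ofReal_add (by positivity) (by positivity)]
      refine ENNReal.ofReal_le_ofReal ?_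
      nlinarith [mul_pos hS' (sq_pos_of_pos hpi)]

/-- Substitution x = ρ cosh μ on each half line, where cosh is injective; hence the factor 2. -/
theorem lintegral_comp_cosh_le {ρ : ℝ} (hρ : 0 < ρ) (h : ℝ → ℝ≥0∞) :
    ∫⁻ μ, ENNReal.ofReal (ρ * |Real.sinh μ|) * h (ρ * Real.cosh μ) ≤ 2 * ∫⁻ x, h x := by
  have key : ∀ s : Set ℝ, MeasurableSet s → InjOn Real.cosh s →
      ∫⁻ μ in s, ENNReal.ofReal (ρ * |Real.sinh μ|) * h (ρ * Real.cosh μ) ≤ ∫⁻ x, h x := by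
    intro s hs hi
    have e := lintegral_image_eq_lintegral_abs_deriv_mul (f := fun μ => ρ * Real.cosh μ)
      (f' := fun μ => ρ * Real.sinh μ) hs
      (fun μ _ => ((Real.hasDerivAt_cosh μ).const_mul ρ).hasDerivWithinAt)
      (fun x hx y hy hxy => hi hx hy (mul_left_cancel₀ hρ.ne' hxy)) h
    simp only [abs_mul, abs_of_pos hρ] at e
    rw [← e]
    exact setLIntegral_le_lintegral _ _
  have h1 := key (Ici 0) measurableSet_Ici Real.cosh_strictMonoOn.injOn
  have h2 := key (Ici 0)ᶜ measurableSet_Ici.compl fun x hx y hy hxy => by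
    simp only [mem_compl_iff, mem_Ici, not_le] at hx hy
    have := Real.cosh_strictMonoOn.injOn (x₁ := -x) (x₂ := -y) (by simpa using hx.le)
      (by simpa using hy.le) (by simpa using hxy)
    linarith
  rw [← lintegral_add_compl _ (measurableSet_Ici (a := (0 : ℝ))), two_mul]
  exact add_le_add h1 h2

theorem lintegral_comp_cos_le {ρ : ℝ} (hρ : 0 < ρ) (h : ℝ → ℝ≥0∞) :
    ∫⁻ ν in Icc (-Real.pi) Real.pi, ENNReal.ofReal (ρ * |Real.sin ν|) * h (ρ * Real.cos ν)
      ≤ 2 * ∫⁻ x, h x := by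
  have key : ∀ s : Set ℝ, MeasurableSet s → InjOn Real.cos s →
      ∫⁻ μ in s, ENNReal.ofReal (ρ * |Real.sin μ|) * h (ρ * Real.cos μ) ≤ ∫⁻ x, h x := by
    intro s hs hi
    have e := lintegral_image_eq_lintegral_abs_deriv_mul (f := fun μ => ρ * Real.cos μ)
      (f' := fun μ => ρ * (-Real.sin μ)) hs
      (fun μ _ => ((Real.hasDerivAt_cos μ).const_mul ρ).hasDerivWithinAt)
      (fun x hx y hy hxy => hi hx hy (mul_left_cancel₀ hρ.ne' hxy)) h
    simp only [abs_mul, abs_of_pos hρ, abs_neg] at e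
    rw [← e]
    exact setLIntegral_le_lintegral _ _
  have h1 := key (Icc 0 Real.pi) measurableSet_Icc Real.strictAntiOn_cos.injOn
  have h2 := key (Icc (-Real.pi) 0) measurableSet_Icc fun x hx y hy hxy => by
    have := Real.strictAntiOn_cos.injOn (x₁ := -x) (x₂ := -y)
      ⟨by linarith [hx.2], by linarith [hx.1]⟩ ⟨by linarith [hy.2], by linarith [hy.1]⟩
      (by simpa using hxy)
    linarith
  rw [← Icc_union_Icc_eq_Icc (b := (0 : ℝ)) (by linarith [Real.pi_pos]) Real.pi_pos.le, two_mul]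
  exact (lintegral_union_le _ _ _).trans (add_le_add h2 h1)

/-- Elliptic coordinates with foci `0` and `ξ`. -/
def ellipticCoord (ξ w : ℂ) : ℂ := ξ * (1 + Complex.cosh w) / 2

/-- The complex cosine is surjective, cosh(iz) = cos z, and a shift of z by a multiple of 2π brings
the imaginary part of w = iz into [-π, π]. -/
theorem ellipticCoord_surj {ξ : ℂ} (hξ : ξ ≠ 0) (η : ℂ) :
    ∃ w : ℂ, w.im ∈ Icc (-Real.pi) Real.pi ∧ ellipticCoord ξ w = η := by
  obtain ⟨z, hz⟩ := Complex.cos_surjective (2 * η / ξ - 1)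
  obtain ⟨m, hm, -⟩ := existsUnique_add_zsmul_mem_Ioc Real.two_pi_pos z.re (-Real.pi)
  refine ⟨(z + m • (2 * Real.pi : ℂ)) * Complex.I, ?_, ?_⟩
  · have : ((z + m • (2 * Real.pi : ℂ)) * Complex.I).im = z.re + m • (2 * Real.pi) := by
      simp
    rw [this]
    exact ⟨hm.1.le, hm.2.trans (by linarith)⟩
  · rw [ellipticCoord, Complex.cosh_mul_I, zsmul_eq_mul, Complex.cos_add_int_mul_two_pi, hz]
    field_simp
    ring

theorem Complex.det_mul_restrictScalars (c : ℂ) :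
    ((ContinuousLinearMap.toSpanSingleton ℂ c).restrictScalars ℝ : ℂ →L[ℝ] ℂ).det = ‖c‖ ^ 2 := by
  have : ((ContinuousLinearMap.toSpanSingleton ℂ c).restrictScalars ℝ : ℂ →L[ℝ] ℂ).det
      = Algebra.norm ℝ c := by
    rw [Algebra.norm_apply, ContinuousLinearMap.det]
    refine congrArg LinearMap.det (LinearMap.ext fun z => ?_)
    simp [mul_comm]
  rw [this, Algebra.norm_complex_eq]
  exact Complex.normSq_eq_norm_sq c

/-- Only surjectivity is used: the measure of an image is at most the integral of the Jacobian, so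
the fact that w and -w have the same image does no harm. The map is holomorphic, so its real
Jacobian is the squared modulus of the derivative. -/
theorem lintegral_le_ellipticCoord {ξ : ℂ} (hξ : ξ ≠ 0) {f : ℂ → ℝ≥0∞} (hf : Measurable f) :
    ∫⁻ η, f η ≤ ∫⁻ w in {w : ℂ | w.im ∈ Icc (-Real.pi) Real.pi},
      ENNReal.ofReal (‖ξ * Complex.sinh w / 2‖ ^ 2) * f (ellipticCoord ξ w) := by
  set D := {w : ℂ | w.im ∈ Icc (-Real.pi) Real.pi}
  have hD : MeasurableSet D := Complex.measurable_im measurableSet_Icc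
  have hcont : Continuous (ellipticCoord ξ) := by unfold ellipticCoord; fun_prop
  have hd : ∀ w, HasDerivAt (ellipticCoord ξ) (ξ * Complex.sinh w / 2) w := fun w =>
    (((Complex.hasDerivAt_cosh w).const_add 1).const_mul ξ).div_const 2
  have hJ : Measurable fun w => ENNReal.ofReal (‖ξ * Complex.sinh w / 2‖ ^ 2) := by fun_prop
  have hle : (volume : Measure ℂ) ≤ Measure.map (ellipticCoord ξ)
      ((volume.restrict D).withDensity fun w => ENNReal.ofReal (‖ξ * Complex.sinh w / 2‖ ^ 2)) := by
    refine Measure.le_iff.2 fun s hs => ?_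
    rw [Measure.map_apply hcont.measurable hs, withDensity_apply _ (hcont.measurable hs),
      Measure.restrict_restrict (hcont.measurable hs)]
    have hsub : s ⊆ ellipticCoord ξ '' (ellipticCoord ξ ⁻¹' s ∩ D) := by
      intro η hη
      obtain ⟨w, hw, rfl⟩ := ellipticCoord_surj hξ η
      exact ⟨w, ⟨hη, hw⟩, rfl⟩
    refine (measure_mono hsub).trans ?_
    refine (addHaar_image_le_lintegral_abs_det_fderiv volume
      ((hcont.measurable hs).inter hD)
      (fun w _ => ((hd w).hasFDerivAt.restrictScalars ℝ).hasFDerivWithinAt)).trans (le_of_eq ?_)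
    refine lintegral_congr fun w => ?_
    rw [Complex.det_mul_restrictScalars, abs_of_nonneg (by positivity)]
  refine (lintegral_mono' hle le_rfl).trans (le_of_eq ?_)
  rw [lintegral_map hf hcont.measurable]
  exact lintegral_withDensity_eq_lintegral_mul _ hJ (hf.comp hcont.measurable)

theorem normSq_cosh_add (μ ν : ℝ) :
    Complex.cosh (⟨μ, ν⟩ : ℂ) = ⟨Real.cosh μ * Real.cos ν, Real.sinh μ * Real.sin ν⟩ ∧
    Complex.sinh (⟨μ, ν⟩ : ℂ) = ⟨Real.sinh μ * Real.cos ν, Real.cosh μ * Real.sin ν⟩ := by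
  have hz : (⟨μ, ν⟩ : ℂ) = μ + ν * Complex.I := by apply Complex.ext <;> simp
  rw [hz, Complex.cosh_add, Complex.sinh_add, Complex.cosh_mul_I, Complex.sinh_mul_I]
  constructor <;> apply Complex.ext <;>
    simp [Complex.cosh_ofReal_re, Complex.sinh_ofReal_re, Complex.cos_ofReal_re,
      Complex.sin_ofReal_re, Complex.cosh_ofReal_im, Complex.sinh_ofReal_im,
      Complex.cos_ofReal_im, Complex.sin_ofReal_im]

/-- The modulus of 1 + cosh(μ+iν) is a perfect square. With the companion formula for |ξ - η|, the
sum of the distances to the foci is |ξ| cosh μ and their difference is |ξ| cos ν. -/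
theorem norm_ellipticCoord (ξ : ℂ) (μ ν : ℝ) :
    ‖ellipticCoord ξ ⟨μ, ν⟩‖ = ‖ξ‖ / 2 * (Real.cosh μ + Real.cos ν) := by
  have h0 : 0 ≤ Real.cosh μ + Real.cos ν := by
    linarith [Real.one_le_cosh μ, Real.neg_one_le_cos ν]
  have : ‖1 + Complex.cosh (⟨μ, ν⟩ : ℂ)‖ = Real.cosh μ + Real.cos ν := by
    rw [← sq_eq_sq₀ (norm_nonneg _) h0, ← Complex.normSq_eq_norm_sq, (normSq_cosh_add μ ν).1,
      Complex.normSq_apply]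
    simp
    nlinarith [Real.cosh_sq μ, Real.sin_sq_add_cos_sq ν]
  rw [ellipticCoord, norm_div, norm_mul, this]
  simp
  ring

theorem norm_sub_ellipticCoord (ξ : ℂ) (μ ν : ℝ) :
    ‖ξ - ellipticCoord ξ ⟨μ, ν⟩‖ = ‖ξ‖ / 2 * (Real.cosh μ - Real.cos ν) := by
  have h0 : 0 ≤ Real.cosh μ - Real.cos ν := by
    linarith [Real.one_le_cosh μ, Real.cos_le_one ν]
  have : ‖1 - Complex.cosh (⟨μ, ν⟩ : ℂ)‖ = Real.cosh μ - Real.cos ν := by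
    rw [← sq_eq_sq₀ (norm_nonneg _) h0, ← Complex.normSq_eq_norm_sq, (normSq_cosh_add μ ν).1,
      Complex.normSq_apply]
    simp
    nlinarith [Real.cosh_sq μ, Real.sin_sq_add_cos_sq ν]
  have e : ξ - ellipticCoord ξ ⟨μ, ν⟩ = ξ * (1 - Complex.cosh (⟨μ, ν⟩ : ℂ)) / 2 := by
    rw [ellipticCoord]; ring
  rw [e, norm_div, norm_mul, this]
  simp
  ring

/-- The symbol of the null form, with the frequency weights of `Ḣ^{3/2} × Ḣ^{3/2} → Ḣ^{1/2}`. -/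
def nullKernelC (ξ η : ℂ) : ℝ :=
  √‖ξ‖ * ((starRingEnd ℂ η) * (ξ - η)).im / (√(‖η‖ * ‖ξ - η‖)) ^ 3

/-- With S = sinh μ and σ = sin ν, the Jacobian and |η||ξ-η| both equal (|ξ|²/4)(S²+σ²), while the
determinant is -(|ξ|²/2)Sσ. The numerator S²σ² is the gain from the null structure. -/
theorem nullKernelC_ellipticCoord (ξ : ℂ) (μ ν : ℝ) :
    ‖ξ * Complex.sinh (⟨μ, ν⟩ : ℂ) / 2‖ ^ 2 * nullKernelC ξ (ellipticCoord ξ ⟨μ, ν⟩) ^ 2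
      = 4 * ‖ξ‖ * (Real.sinh μ ^ 2 * Real.sin ν ^ 2 / (Real.sinh μ ^ 2 + Real.sin ν ^ 2) ^ 2) := by
  rcases eq_or_ne ξ 0 with rfl | hξ
  · simp
  have hρ : 0 < ‖ξ‖ := norm_pos_iff.2 hξ
  set S := Real.sinh μ
  set σ := Real.sin ν
  have hX : (Real.cosh μ + Real.cos ν) * (Real.cosh μ - Real.cos ν) = S ^ 2 + σ ^ 2 := by
    nlinarith [Real.cosh_sq μ, Real.sin_sq_add_cos_sq ν]
  have hJ : ‖ξ * Complex.sinh (⟨μ, ν⟩ : ℂ) / 2‖ ^ 2 = ‖ξ‖ ^ 2 / 4 * (S ^ 2 + σ ^ 2) := by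
    rw [norm_div, norm_mul, div_pow, mul_pow, ← Complex.normSq_eq_norm_sq (Complex.sinh _),
      (normSq_cosh_add μ ν).2, Complex.normSq_apply]
    simp
    rw [← hX]
    have : S ^ 2 = Real.cosh μ ^ 2 - 1 := by nlinarith [Real.cosh_sq μ]
    have h2 : σ ^ 2 = 1 - Real.cos ν ^ 2 := by nlinarith [Real.sin_sq_add_cos_sq ν]
    have : S * Real.cos ν * (S * Real.cos ν) + Real.cosh μ * σ * (Real.cosh μ * σ)
      = (Real.cosh μ + Real.cos ν) * (Real.cosh μ - Real.cos ν) := by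
      calc _ = S ^ 2 * Real.cos ν ^ 2 + Real.cosh μ ^ 2 * σ ^ 2 := by ring
        _ = _ := by rw [this, h2]; ring
    rw [this]; ring
  have him : ((starRingEnd ℂ (ellipticCoord ξ ⟨μ, ν⟩)) * (ξ - ellipticCoord ξ ⟨μ, ν⟩)).im
      = - (‖ξ‖ ^ 2 / 2 * (S * σ)) := by
    have e : (starRingEnd ℂ (ellipticCoord ξ ⟨μ, ν⟩)) * (ξ - ellipticCoord ξ ⟨μ, ν⟩)
        = ((‖ξ‖ ^ 2 / 4 : ℝ) : ℂ) * ((starRingEnd ℂ (1 + Complex.cosh ⟨μ, ν⟩)) *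
          (1 - Complex.cosh ⟨μ, ν⟩)) := by
      rw [← Complex.normSq_eq_norm_sq, Complex.ofReal_div, Complex.normSq_eq_conj_mul_self]
      simp only [ellipticCoord, map_div₀, map_mul, map_ofNat, Complex.ofReal_ofNat]
      ring
    rw [e, Complex.im_ofReal_mul, (normSq_cosh_add μ ν).1]
    simp
    ring
  have hsq : (√(‖ellipticCoord ξ ⟨μ, ν⟩‖ * ‖ξ - ellipticCoord ξ ⟨μ, ν⟩‖) ^ 3) ^ 2
      = (‖ξ‖ ^ 2 / 4 * (S ^ 2 + σ ^ 2)) ^ 3 := by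
    rw [← pow_mul, mul_comm 3 2, pow_mul, Real.sq_sqrt (by positivity), norm_ellipticCoord,
      norm_sub_ellipticCoord, ← hX]
    ring
  rw [nullKernelC, div_pow, mul_pow, Real.sq_sqrt (norm_nonneg _), hsq, hJ, him]
  -- This is the case of η at a focus, where division by zero makes both sides vanish.
  rcases eq_or_ne (S ^ 2 + σ ^ 2) 0 with h0 | h0
  · rw [h0]; simp
  · field_simp
    ring

/-- The phase depends on one elliptic coordinate only. Integrating the weight over the other one
leaves a multiple of |ξ||sinh μ| or |ξ||sin ν|, which is the Jacobian of the phase in the remaining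
coordinate. All powers of |ξ| cancel, so the bound is uniform. -/
theorem lintegral_nullKernelC_le (ξ : ℂ) (e : Bool) {h : ℝ → ℝ≥0∞} (hh : Measurable h) :
    ∫⁻ η, ‖nullKernelC ξ η‖ₑ ^ 2 *
        h (cond e (‖η‖ + ‖ξ - η‖) (‖η‖ - ‖ξ - η‖))
      ≤ ENNReal.ofReal (32 * Real.pi ^ 2) * ∫⁻ x, h x := by
  rcases eq_or_ne ξ 0 with rfl | hξ
  · simp [nullKernelC]
  have hρ : 0 < ‖ξ‖ := norm_pos_iff.2 hξ
  have hkm : Measurable (nullKernelC ξ) := by unfold nullKernelC; fun_prop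
  have ham : Measurable fun η : ℂ => cond e (‖η‖ + ‖ξ - η‖) (‖η‖ - ‖ξ - η‖) := by
    cases e <;> simp only [cond_true, cond_false] <;> fun_prop
  refine (lintegral_le_ellipticCoord hξ (by fun_prop)).trans ?_
  set W : ℝ → ℝ → ℝ≥0∞ := fun μ ν => ENNReal.ofReal
    (4 * (Real.sinh μ ^ 2 * Real.sin ν ^ 2 / (Real.sinh μ ^ 2 + Real.sin ν ^ 2) ^ 2)) with hW
  set g : ℝ → ℝ → ℝ≥0∞ := fun μ ν => ENNReal.ofReal ‖ξ‖ * W μ ν *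
    h (cond e (‖ξ‖ * Real.cosh μ) (‖ξ‖ * Real.cos ν)) with hg
  have hgm : Measurable (Function.uncurry g) := by
    cases e <;> simp only [hg, hW, cond_true, cond_false, Function.uncurry_def] <;> fun_prop
  have e1 : (∫⁻ w in {w : ℂ | w.im ∈ Icc (-Real.pi) Real.pi},
      ENNReal.ofReal (‖ξ * Complex.sinh w / 2‖ ^ 2) * (‖nullKernelC ξ (ellipticCoord ξ w)‖ₑ ^ 2 *
        h (cond e (‖ellipticCoord ξ w‖ + ‖ξ - ellipticCoord ξ w‖)
          (‖ellipticCoord ξ w‖ - ‖ξ - ellipticCoord ξ w‖))))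
      = ∫⁻ p in univ ×ˢ Icc (-Real.pi) Real.pi, g p.1 p.2 := by
    rw [← lintegral_indicator (show MeasurableSet {w : ℂ | w.im ∈ Icc (-Real.pi) Real.pi} from
        Complex.measurable_im measurableSet_Icc),
      ← lintegral_indicator (MeasurableSet.univ.prod measurableSet_Icc),
      ← Complex.volume_preserving_equiv_real_prod.lintegral_comp_emb
        Complex.measurableEquivRealProd.measurableEmbedding]
    refine lintegral_congr fun w => ?_
    obtain ⟨μ, ν⟩ := w
    by_cases hν : ν ∈ Icc (-Real.pi) Real.pi
    · rw [indicator_of_mem (by exact hν), indicator_of_mem (by exact ⟨mem_univ _, hν⟩)]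
      rw [Complex.measurableEquivRealProd_apply]
      simp only [hg]
      rw [← mul_assoc, ← ofReal_norm, ← ENNReal.ofReal_pow (norm_nonneg _),
        ← ENNReal.ofReal_mul (by positivity), Real.norm_eq_abs, sq_abs, nullKernelC_ellipticCoord,
        norm_ellipticCoord, norm_sub_ellipticCoord, hW, ← ENNReal.ofReal_mul hρ.le]
      congr 2
      · ring
      · cases e <;> simp only [cond_true, cond_false] <;> ring
    · rw [indicator_of_notMem (by exact hν), indicator_of_notMem (by
        intro h'; exact hν h'.2)]
  rw [e1, Measure.volume_eq_prod, ← Measure.prod_restrict, Measure.restrict_univ,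
    show ENNReal.ofReal (32 * Real.pi ^ 2) = ENNReal.ofReal (16 * Real.pi ^ 2) * 2 by
      rw [show (2 : ℝ≥0∞) = ENNReal.ofReal 2 by simp, ← ENNReal.ofReal_mul (by positivity)]
      congr 1; ring, mul_assoc]
  have hin : ∀ x : ℝ, ENNReal.ofReal ‖ξ‖ * ENNReal.ofReal (16 * Real.pi ^ 2 * |x|)
      = ENNReal.ofReal (16 * Real.pi ^ 2) * ENNReal.ofReal (‖ξ‖ * |x|) := fun x => by
    rw [← ENNReal.ofReal_mul hρ.le, ← ENNReal.ofReal_mul (by positivity)]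
    congr 1; ring
  -- For the difference of the distances the phase is |ξ| cos ν and μ is integrated first; for the
  -- sum the roles are exchanged.
  cases e
  · rw [lintegral_prod_symm (fun p : ℝ × ℝ => g p.1 p.2) hgm.aemeasurable]
    calc _ ≤ ∫⁻ ν in Icc (-Real.pi) Real.pi, ENNReal.ofReal (16 * Real.pi ^ 2) *
          (ENNReal.ofReal (‖ξ‖ * |Real.sin ν|) * h (‖ξ‖ * Real.cos ν)) := by
          refine lintegral_mono fun ν => ?_
          simp only [hg, cond_false]
          rw [lintegral_mul_const _ (by fun_prop), lintegral_const_mul _ (by fun_prop),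
            ← mul_assoc, ← hin]
          gcongr
          exact lintegral_ellipticWeight_sinh_le _
      _ ≤ _ := by
          rw [lintegral_const_mul _ (by fun_prop)]
          gcongr
          exact lintegral_comp_cos_le hρ h
  · rw [lintegral_prod (fun p : ℝ × ℝ => g p.1 p.2) hgm.aemeasurable]
    calc _ ≤ ∫⁻ μ, ENNReal.ofReal (16 * Real.pi ^ 2) *
          (ENNReal.ofReal (‖ξ‖ * |Real.sinh μ|) * h (‖ξ‖ * Real.cosh μ)) := by
          refine lintegral_mono fun μ => ?_
          simp only [hg, cond_true]
          rw [lintegral_mul_const _ (by fun_prop), lintegral_const_mul _ (by fun_prop),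
            ← mul_assoc, ← hin]
          gcongr
          exact lintegral_ellipticWeight_sin_le _
      _ ≤ _ := by
          rw [lintegral_const_mul _ (by fun_prop)]
          gcongr
          exact lintegral_comp_cosh_le hρ h

end Pushforward

/-! ### Multiplication operators, half-wave groups and pairings on L² -/

section L2Operators

theorem L2_norm_sq {F : Type*} [NormedAddCommGroup F] [InnerProductSpace ℂ F] {α : Type*}
    [MeasurableSpace α] {μ : Measure α} (a : Lp F 2 μ) : ‖a‖ ^ 2 = ∫ ξ, ‖a ξ‖ ^ 2 ∂μ := by
  have h := L2.inner_def (𝕜 := ℂ) a a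
  rw [inner_self_eq_norm_sq_to_K] at h
  have h2 : ∀ ξ, inner ℂ (a ξ) (a ξ) = ((‖a ξ‖ ^ 2 : ℝ) : ℂ) := fun ξ => by
    rw [inner_self_eq_norm_sq_to_K]; norm_cast
  simp_rw [h2] at h
  rw [integral_complex_ofReal] at h
  have h3 : ((‖a‖ ^ 2 : ℝ) : ℂ) = ((∫ ξ, ‖a ξ‖ ^ 2 ∂μ : ℝ) : ℂ) := by
    rw [← h]; norm_cast
  exact Complex.ofReal_injective h3

theorem L2_enorm_sq {F : Type*} [NormedAddCommGroup F] {α : Type*}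
    [MeasurableSpace α] {μ : Measure α} (a : Lp F 2 μ) : ‖a‖ₑ ^ 2 = ∫⁻ ξ, ‖a ξ‖ₑ ^ 2 ∂μ := by
  rw [Lp.enorm_def, eLpNorm_eq_lintegral_rpow_enorm_toReal (by norm_num) (by norm_num),
    ← ENNReal.rpow_natCast, ← ENNReal.rpow_mul]
  simp

/-- Multiplication by a bounded function on `L²`. -/
def mulOp (m : Plane → ℂ) : L2 →L[ℂ] L2 :=
  open Classical in
  if h : MemLp m ∞ (volume : Measure Plane) then
    (ContinuousLinearMap.lsmul ℂ ℂ).holderL volume ∞ 2 2 h.toLp else 0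

theorem memLp_top_of_continuous {m : Plane → ℂ} (hm : Continuous m) {C : ℝ} (hC : ∀ ξ, ‖m ξ‖ ≤ C) :
    MemLp m ∞ (volume : Measure Plane) :=
  memLp_top_of_bound hm.aestronglyMeasurable C (Filter.Eventually.of_forall hC)

theorem mulOp_coe {m : Plane → ℂ} (hm : MemLp m ∞ (volume : Measure Plane)) (a : L2) :
    (mulOp m a : Plane → C3) =ᵐ[volume] fun ξ => m ξ • a ξ := by
  rw [mulOp, dif_pos hm]
  have h := (ContinuousLinearMap.lsmul ℂ ℂ).coeFn_holder (r := 2) (hm.toLp m) a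
  filter_upwards [h, hm.coeFn_toLp] with ξ h1 h2
  simp only [ContinuousLinearMap.holderL_apply_apply]
  rw [h1, h2]
  rfl

theorem norm_mulOp_le {m : Plane → ℂ} (hm : MemLp m ∞ (volume : Measure Plane)) {C : ℝ}
    (hC : ∀ ξ, ‖m ξ‖ ≤ C) (a : L2) : ‖mulOp m a‖ ≤ C * ‖a‖ := by
  refine Lp.norm_le_mul_norm_of_ae_le_mul ?_
  filter_upwards [mulOp_coe hm a] with ξ h
  rw [h, norm_smul]
  gcongr
  exact hC ξ

/-- Dominated convergence gives strong convergence from pointwise convergence of bounded symbols.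
Convergence in operator norm is not asked for; e^{itr} is not norm continuous in t. -/
theorem tendsto_mulOp {ι : Type*} {l : Filter ι} [l.IsCountablyGenerated] {m : ι → Plane → ℂ}
    {m₀ : Plane → ℂ} {C : ℝ} (hm : ∀ i, MemLp (m i) ∞ (volume : Measure Plane))
    (hm₀ : MemLp m₀ ∞ (volume : Measure Plane)) (hC : ∀ᶠ i in l, ∀ ξ, ‖m i ξ‖ ≤ C)
    (hC₀ : ∀ ξ, ‖m₀ ξ‖ ≤ C)
    (hlim : ∀ ξ, Filter.Tendsto (fun i => m i ξ) l (nhds (m₀ ξ))) (a : L2) :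
    Filter.Tendsto (fun i => mulOp (m i) a) l (nhds (mulOp m₀ a)) := by
  rw [tendsto_iff_norm_sub_tendsto_zero]
  have hsq : Filter.Tendsto (fun i => ‖mulOp (m i) a - mulOp m₀ a‖ ^ 2) l (nhds 0) := by
    have he : ∀ i, ‖mulOp (m i) a - mulOp m₀ a‖ ^ 2 = ∫ ξ, (‖m i ξ - m₀ ξ‖ * ‖a ξ‖) ^ 2 := by
      intro i
      rw [L2_norm_sq]
      refine integral_congr_ae ?_
      filter_upwards [Lp.coeFn_sub (mulOp (m i) a) (mulOp m₀ a), mulOp_coe (hm i) a,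
        mulOp_coe hm₀ a] with ξ h1 h2 h3
      rw [h1, Pi.sub_apply, h2, h3, ← sub_smul, norm_smul]
    simp_rw [he]
    have : (0 : ℝ) = ∫ ξ : Plane, (0 : ℝ) := by simp
    rw [this]
    refine tendsto_integral_filter_of_dominated_convergence (fun ξ => (2 * C) ^ 2 * ‖a ξ‖ ^ 2)
      (Filter.Eventually.of_forall fun i => ?_) (hC.mono fun i hi => ?_)
      ((Lp.memLp a).integrable_norm_pow (by norm_num) |>.const_mul _) ?_
    · exact ((((hm i).1.sub hm₀.1).norm).mul (Lp.aestronglyMeasurable a).norm).pow 2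
    · refine Filter.Eventually.of_forall fun ξ => ?_
      rw [Real.norm_of_nonneg (by positivity), ← mul_pow]
      gcongr
      calc _ ≤ ‖m i ξ‖ + ‖m₀ ξ‖ := norm_sub_le _ _
        _ ≤ 2 * C := by linarith [hi ξ, hC₀ ξ]
    · refine Filter.Eventually.of_forall fun ξ => ?_
      have h1 := (tendsto_iff_norm_sub_tendsto_zero.1 (hlim ξ)).mul_const ‖a ξ‖
      simpa using h1.pow 2
  have := hsq.sqrt
  simpa using this

/-- Joint continuity of `(t, a) ↦ m_t · a`. -/
theorem continuous_mulOp {m : ℝ → Plane → ℂ} {B : ℝ → ℝ} (hB : Continuous B)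
    (hm : ∀ t, Continuous (m t)) (hmt : ∀ ξ, Continuous fun t => m t ξ)
    (hb : ∀ t ξ, ‖m t ξ‖ ≤ B t) : Continuous fun p : ℝ × L2 => mulOp (m p.1) p.2 := by
  have hM : ∀ t, MemLp (m t) ∞ (volume : Measure Plane) := fun t =>
    memLp_top_of_continuous (hm t) (hb t)
  rw [continuous_iff_continuousAt]
  rintro ⟨t, a⟩
  have hev : ∀ᶠ s in nhds t, B s < B t + 1 := hB.continuousAt.eventually (gt_mem_nhds (by linarith))
  have h1 : Filter.Tendsto (fun p : ℝ × L2 => mulOp (m p.1) a) (nhds (t, a))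
      (nhds (mulOp (m t) a)) := by
    have := tendsto_mulOp (l := nhds t) (C := B t + 1) hM (hM t)
      (hev.mono fun s hs ξ => (hb s ξ).trans hs.le)
      (fun ξ => (hb t ξ).trans (by linarith)) (fun ξ => (hmt ξ).tendsto t) a
    exact this.comp continuous_fst.continuousAt
  have h2 : Filter.Tendsto (fun p : ℝ × L2 => mulOp (m p.1) (p.2 - a)) (nhds (t, a)) (nhds 0) := by
    have hs : Filter.Tendsto (fun p : ℝ × L2 => B p.1 * ‖p.2 - a‖) (nhds (t, a)) (nhds 0) := by
      have : Continuous fun p : ℝ × L2 => B p.1 * ‖p.2 - a‖ := by fun_prop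
      simpa using this.tendsto (t, a)
    exact squeeze_zero_norm (fun p => norm_mulOp_le (hM p.1) (hb p.1) _) hs
  have h3 := h1.add h2
  simpa [ContinuousAt] using h3

/-- Multiplication by `e^{itr}`, with `r = 2π|ξ|`. -/
def waveOp (t : ℝ) : L2 →L[ℂ] L2 :=
  mulOp fun ξ => Complex.exp (((t * (2 * Real.pi * ‖ξ‖) : ℝ) : ℂ) * Complex.I)

theorem waveSymbol_norm (t : ℝ) (ξ : Plane) :
    ‖Complex.exp (((t * (2 * Real.pi * ‖ξ‖) : ℝ) : ℂ) * Complex.I)‖ = 1 :=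
  Complex.norm_exp_ofReal_mul_I _

theorem waveSymbol_memLp (t : ℝ) : MemLp
    (fun ξ : Plane => Complex.exp (((t * (2 * Real.pi * ‖ξ‖) : ℝ) : ℂ) * Complex.I)) ∞ volume :=
  memLp_top_of_continuous (by fun_prop) fun ξ => (waveSymbol_norm t ξ).le

theorem waveOp_coe (t : ℝ) (a : L2) : (waveOp t a : Plane → C3) =ᵐ[volume]
    fun ξ => Complex.exp (((t * (2 * Real.pi * ‖ξ‖) : ℝ) : ℂ) * Complex.I) • a ξ :=
  mulOp_coe (waveSymbol_memLp t) a

theorem norm_waveOp_le (t : ℝ) (a : L2) : ‖waveOp t a‖ ≤ ‖a‖ :=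
  (norm_mulOp_le (waveSymbol_memLp t) (fun ξ => (waveSymbol_norm t ξ).le) a).trans_eq (one_mul _)

theorem continuous_waveOp : Continuous fun p : ℝ × L2 => waveOp p.1 p.2 :=
  continuous_mulOp (B := fun _ => 1) continuous_const (fun t => by fun_prop) (fun ξ => by fun_prop)
    fun t ξ => (waveSymbol_norm t ξ).le

theorem waveOp_add (s t : ℝ) (a : L2) : waveOp (s + t) a = waveOp s (waveOp t a) := by
  refine Lp.ext ?_
  filter_upwards [waveOp_coe (s + t) a, waveOp_coe s (waveOp t a), waveOp_coe t a] with ξ h1 h2 h3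
  rw [h1, h2, h3, smul_smul, ← Complex.exp_add]
  congr 2
  push_cast
  ring

theorem waveOp_zero (a : L2) : waveOp 0 a = a := by
  refine Lp.ext ?_
  filter_upwards [waveOp_coe 0 a] with ξ h1
  rw [h1]; simp

theorem norm_waveOp (t : ℝ) (a : L2) : ‖waveOp t a‖ = ‖a‖ := by
  refine le_antisymm (norm_waveOp_le t a) ?_
  have := norm_waveOp_le (-t) (waveOp t a)
  rwa [← waveOp_add, neg_add_cancel, waveOp_zero] at this

/-- The pairing `a ↦ ∫ κ a` with a square integrable function `κ`. -/
def pairing (κ : Plane → ℂ) : L2 →L[ℂ] C3 :=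
  open Classical in
  if h : MemLp κ 2 (volume : Measure Plane) then
    (ContinuousLinearMap.lsmul ℂ ℂ).lpPairing volume 2 2 h.toLp else 0

theorem pairing_apply {κ : Plane → ℂ} (h : MemLp κ 2 (volume : Measure Plane)) (a : L2) :
    pairing κ a = ∫ ξ, κ ξ • a ξ := by
  rw [pairing, dif_pos h, ContinuousLinearMap.lpPairing_eq_integral]
  refine integral_congr_ae ?_
  filter_upwards [h.coeFn_toLp] with ξ hξ
  rw [hξ]; rfl

end L2Operators

/-! ### Square integrability of the Sobolev weights on Schwartz functions -/

section Weights

/-- In polar coordinates the area element of the plane cancels |ξ|^{-1}. This function is the common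
majorant for the squares of all the singular weights. -/
theorem integrable_inv_norm_mul : Integrable fun ξ : Plane => ‖ξ‖⁻¹ * (1 + ‖ξ‖) ^ (-(2 : ℝ)) := by
  have h := (integrable_fun_norm_addHaar (E := Plane) volume
    (f := fun x : ℝ => x⁻¹ * (1 + x) ^ (-(2 : ℝ)))).2 ?_
  · exact h
  have h1 : IntegrableOn (fun x : ℝ => (1 + ‖x‖) ^ (-(2 : ℝ))) (Ioi 0) :=
    (integrable_one_add_norm (E := ℝ) (r := 2) (by simp)).integrableOn
  refine h1.congr_fun (fun x hx => ?_) measurableSet_Ioi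
  have hx' : (0 : ℝ) < x := hx
  simp only [finrank_euclideanSpace, Fintype.card_fin, smul_eq_mul]
  rw [Real.norm_of_nonneg hx'.le]
  simp
  field_simp

theorem schwartz_decay (φ : 𝓢(Plane, ℂ)) (n : ℕ) :
    ∃ C, 0 ≤ C ∧ ∀ ξ, ‖φ ξ‖ ≤ C * ((1 + ‖ξ‖) ^ n)⁻¹ := by
  refine ⟨2 ^ n * (Finset.Iic (n, 0)).sup (fun m => SchwartzMap.seminorm ℝ m.1 m.2) φ,
    by positivity, fun ξ => ?_⟩
  have h := SchwartzMap.one_add_le_sup_seminorm_apply (𝕜 := ℝ) (m := (n, 0)) le_rfl le_rfl φ ξ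
  rw [norm_iteratedFDeriv_zero] at h
  rw [← div_eq_mul_inv, le_div_iff₀ (by positivity), mul_comm]
  exact h

/-- The weight `φ(ξ) (2π|ξ|)^{-s}`. -/
def sobWeight (s : ℝ) (φ : 𝓢(Plane, ℂ)) (ξ : Plane) : ℂ :=
  φ ξ * (((2 * Real.pi * ‖ξ‖) ^ (-s) : ℝ) : ℂ)

theorem measurable_sobWeight (s : ℝ) (φ : 𝓢(Plane, ℂ)) : Measurable (sobWeight s φ) := by
  unfold sobWeight
  exact φ.continuous.measurable.mul (by fun_prop)

theorem norm_rpow_freq (s : ℝ) (ξ : Plane) :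
    ‖(((2 * Real.pi * ‖ξ‖) ^ (-s) : ℝ) : ℂ)‖ = (2 * Real.pi) ^ (-s) * ‖ξ‖ ^ (-s) := by
  rw [Complex.norm_real, Real.norm_of_nonneg (by positivity),
    Real.mul_rpow (by positivity) (norm_nonneg _)]

theorem memLp_two_of_norm_le {κ : Plane → ℂ} (hκ : AEStronglyMeasurable κ) {C : ℝ}
    (h : ∀ ξ, ‖κ ξ‖ ^ 2 ≤ C * (‖ξ‖⁻¹ * (1 + ‖ξ‖) ^ (-(2 : ℝ)))) : MemLp κ 2 := by
  rw [memLp_two_iff_integrable_sq_norm hκ]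
  exact (integrable_inv_norm_mul.const_mul C).mono' (hκ.norm.pow 2)
    (Filter.Eventually.of_forall fun ξ => by
      rw [Real.norm_of_nonneg (by positivity)]; exact h ξ)

theorem memLp_sobWeight_half (φ : 𝓢(Plane, ℂ)) : MemLp (sobWeight (1 / 2) φ) 2 := by
  obtain ⟨C, hC, h⟩ := schwartz_decay φ 1
  refine memLp_two_of_norm_le (measurable_sobWeight _ φ).aestronglyMeasurable
    (C := (C * (2 * Real.pi) ^ (-(1 / 2) : ℝ)) ^ 2) fun ξ => ?_
  rw [sobWeight, norm_mul, norm_rpow_freq]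
  calc _ ≤ (C * ((1 + ‖ξ‖) ^ 1)⁻¹ * ((2 * Real.pi) ^ (-(1 / 2) : ℝ) * ‖ξ‖ ^ (-(1 / 2) : ℝ))) ^ 2 := by
        gcongr; exact h ξ
    _ = (C * (2 * Real.pi) ^ (-(1 / 2) : ℝ)) ^ 2 *
        ((‖ξ‖ ^ (-(1 / 2) : ℝ)) ^ 2 * (((1 + ‖ξ‖) ^ 1)⁻¹) ^ 2) := by ring
    _ = _ := by
        congr 2
        · rw [← Real.rpow_natCast, ← Real.rpow_mul (norm_nonneg _), ← Real.rpow_neg_one]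
          norm_num
        · rw [Real.rpow_neg (by positivity), pow_one, inv_pow]
          norm_num

/-- A zero at the origin gains one power of |ξ| by the mean value inequality. That turns the
non-integrable |ξ|^{-3} in the square of the 3/2-weight into |ξ|^{-1}. The constants 4C₂ and 2C₁
serve |ξ| ≤ 1 and |ξ| ≥ 1. -/
theorem schwartz_norm_le_mul_norm (φ : 𝓢(Plane, ℂ)) (h0 : φ 0 = 0) :
    ∃ C, 0 ≤ C ∧ ∀ ξ, ‖φ ξ‖ ≤ C * ‖ξ‖ * ((1 + ‖ξ‖) ^ 2)⁻¹ := by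
  obtain ⟨C₁, hC₁, h₁⟩ := schwartz_decay φ 3
  obtain ⟨C₂, hC₂⟩ := φ.decay 0 1
  have hlip : ∀ ξ, ‖φ ξ‖ ≤ C₂ * ‖ξ‖ := fun ξ => by
    have := Convex.norm_image_sub_le_of_norm_fderiv_le (𝕜 := ℝ) (f := φ) (C := C₂) (s := univ)
      (x := 0) (y := ξ) (fun x _ => φ.differentiableAt) (fun x _ => by
        have := hC₂.2 x
        rw [pow_zero, one_mul, norm_iteratedFDeriv_one] at this
        exact this) convex_univ (mem_univ _) (mem_univ _)
    simpa [h0] using this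
  have hC₂' : 0 ≤ C₂ := hC₂.1.le
  refine ⟨4 * C₂ + 2 * C₁, by positivity, fun ξ => ?_⟩
  have hx := norm_nonneg ξ
  rw [← div_eq_mul_inv, le_div_iff₀ (by positivity)]
  rcases le_total ‖ξ‖ 1 with h | h
  · calc ‖φ ξ‖ * (1 + ‖ξ‖) ^ 2 ≤ (C₂ * ‖ξ‖) * 2 ^ 2 := by
          gcongr
          · exact hlip ξ
          · linarith
      _ ≤ _ := by nlinarith [mul_nonneg hC₁ hx]
  · calc ‖φ ξ‖ * (1 + ‖ξ‖) ^ 2 ≤ (C₁ * ((1 + ‖ξ‖) ^ 3)⁻¹) * (1 + ‖ξ‖) ^ 2 := by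
          gcongr; exact h₁ ξ
      _ = C₁ / (1 + ‖ξ‖) := by field_simp
      _ ≤ C₁ / 1 := by gcongr; linarith
      _ ≤ _ := by nlinarith [mul_nonneg hC₂' hx]

theorem memLp_sobWeight_three_half (φ : 𝓢(Plane, ℂ)) (h0 : φ 0 = 0) :
    MemLp (sobWeight (3 / 2) φ) 2 := by
  obtain ⟨C, hC, h⟩ := schwartz_norm_le_mul_norm φ h0
  refine memLp_two_of_norm_le (measurable_sobWeight _ φ).aestronglyMeasurable
    (C := (C * (2 * Real.pi) ^ (-(3 / 2) : ℝ)) ^ 2) fun ξ => ?_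
  rw [sobWeight, norm_mul, norm_rpow_freq]
  rcases (norm_nonneg ξ).eq_or_lt with hξ | hξ
  · rw [← hξ]; norm_num
  have e : ‖ξ‖ ^ 2 * (‖ξ‖ ^ (-(3 / 2) : ℝ)) ^ 2 = ‖ξ‖⁻¹ := by
    rw [← Real.rpow_natCast, ← Real.rpow_natCast, ← Real.rpow_mul hξ.le, ← Real.rpow_add hξ,
      ← Real.rpow_neg_one]
    norm_num
  calc _ ≤ (C * ‖ξ‖ * ((1 + ‖ξ‖) ^ 2)⁻¹ *
        ((2 * Real.pi) ^ (-(3 / 2) : ℝ) * ‖ξ‖ ^ (-(3 / 2) : ℝ))) ^ 2 := by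
        gcongr; exact h ξ
    _ = (C * (2 * Real.pi) ^ (-(3 / 2) : ℝ)) ^ 2 *
        ((‖ξ‖ ^ 2 * (‖ξ‖ ^ (-(3 / 2) : ℝ)) ^ 2) * (((1 + ‖ξ‖) ^ 2)⁻¹) ^ 2) := by ring
    _ ≤ _ := by
        rw [e]
        gcongr
        rw [Real.rpow_neg (by positivity)]
        have h1 : (1 : ℝ) ≤ (1 + ‖ξ‖) ^ 2 := one_le_pow₀ (by linarith)
        have : ((1 + ‖ξ‖) ^ 2)⁻¹ ≤ 1 := inv_le_one_of_one_le₀ h1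
        rw [show ((2 : ℝ)) = ((2 : ℕ) : ℝ) by norm_num, Real.rpow_natCast]
        nlinarith [inv_nonneg.2 (zero_le_one.trans h1)]

end Weights

/-! ### The null form as a bounded bilinear map on L² -/

section NullForm

theorem norm_cross_le (a b : C3) :
    ‖(WithLp.toLp 2 (a.ofLp ⨯₃ b.ofLp) : C3)‖ ≤ 2 * ‖a‖ * ‖b‖ := by
  refine abs_le_of_sq_le_sq' ?_ (by positivity) |>.2
  rw [EuclideanSpace.norm_sq_eq, mul_pow, mul_pow, EuclideanSpace.norm_sq_eq a,
    EuclideanSpace.norm_sq_eq b]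
  simp only [Fin.sum_univ_three, cross_apply, Matrix.cons_val_zero, Matrix.cons_val_one,
    Matrix.cons_val]
  have key : ∀ u v x y : ℂ, ‖u * v - x * y‖ ^ 2 ≤
      2 * (‖u‖ ^ 2 * ‖v‖ ^ 2 + ‖x‖ ^ 2 * ‖y‖ ^ 2) := by
    intro u v x y
    have h := norm_sub_le (u * v) (x * y)
    rw [norm_mul, norm_mul] at h
    have h0 := norm_nonneg (u * v - x * y)
    calc _ ≤ (‖u‖ * ‖v‖ + ‖x‖ * ‖y‖) ^ 2 := by gcongr
      _ ≤ _ := by nlinarith [sq_nonneg (‖u‖ * ‖v‖ - ‖x‖ * ‖y‖)]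
  have h1 := key (a 1) (b 2) (a 2) (b 1)
  have h2 := key (a 2) (b 0) (a 0) (b 2)
  have h3 := key (a 0) (b 1) (a 1) (b 0)
  have hp : ∀ i j, 0 ≤ ‖a i‖ ^ 2 * ‖b j‖ ^ 2 := fun i j => by positivity
  nlinarith [hp 0 0, hp 0 1, hp 0 2, hp 1 0, hp 1 1, hp 1 2, hp 2 0, hp 2 1, hp 2 2]

/-- The cross product of `ℂ³` as a bounded bilinear map. -/
def crossL : C3 →L[ℂ] C3 →L[ℂ] C3 :=
  LinearMap.mkContinuous₂ (LinearMap.mk₂ ℂ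
    (fun a b : C3 => (WithLp.toLp 2 (a.ofLp ⨯₃ b.ofLp) : C3))
    (fun _ _ _ => by simp) (fun _ _ _ => by simp) (fun _ _ _ => by simp)
    (fun _ _ _ => by simp)) 2 norm_cross_le

theorem crossL_apply (a b : C3) : crossL a b = WithLp.toLp 2 (a.ofLp ⨯₃ b.ofLp) := rfl

theorem norm_crossL_le (a b : C3) : ‖crossL a b‖ ≤ 2 * ‖a‖ * ‖b‖ := norm_cross_le a b

attribute [irreducible] crossL

theorem stronglyMeasurable_crossL {X : Type*} [MeasurableSpace X] {f g : X → C3}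
    (hf : StronglyMeasurable f) (hg : StronglyMeasurable g) :
    StronglyMeasurable fun x => crossL (f x) (g x) := by
  have h3 : Continuous fun q : C3 × C3 => crossL q.1 q.2 := crossL.continuous₂
  have h := h3.comp_stronglyMeasurable (hf.prodMk hg)
  exact h

theorem crossL_swap (a b : C3) : crossL b a = -crossL a b := by
  rw [crossL_apply, crossL_apply, ← cross_anticomm]; rfl

/-- The determinant `η₁ζ₂ - η₂ζ₁` with the weight `(|η||ζ|)^{-3/2}`. -/
def nullSymbol (η ζ : Plane) : ℝ := (η 0 * ζ 1 - η 1 * ζ 0) / √(‖η‖ * ‖ζ‖) ^ 3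

theorem nullSymbol_swap (η ζ : Plane) : nullSymbol ζ η = -nullSymbol η ζ := by
  rw [nullSymbol, nullSymbol, mul_comm ‖ζ‖, ← neg_div]; ring

theorem measurable_coord (i : Fin 2) : Measurable fun η : Plane => η i :=
  (EuclideanSpace.proj (𝕜 := ℝ) i).continuous.measurable

theorem measurable_nullSymbol : Measurable fun p : Plane × Plane => nullSymbol p.1 p.2 := by
  have h := measurable_coord
  unfold nullSymbol
  exact (((h 0).comp measurable_fst |>.mul ((h 1).comp measurable_snd)).sub
    (((h 1).comp measurable_fst).mul ((h 0).comp measurable_snd))).div (by fun_prop)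

theorem abs_det_le (η ζ : Plane) : |η 0 * ζ 1 - η 1 * ζ 0| ≤ ‖η‖ * ‖ζ‖ := by
  refine abs_le_of_sq_le_sq ?_ (by positivity)
  rw [mul_pow, EuclideanSpace.norm_sq_eq, EuclideanSpace.norm_sq_eq]
  simp only [Fin.sum_univ_two, Real.norm_eq_abs, sq_abs]
  nlinarith [sq_nonneg (η 0 * ζ 0 + η 1 * ζ 1)]

/-- The determinant is at most |η||ζ| by Lagrange's identity, which uses up two of the three square
roots in the denominator. -/
theorem abs_nullSymbol_le (η ζ : Plane) : |nullSymbol η ζ| ≤ (√(‖η‖ * ‖ζ‖))⁻¹ := by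
  rw [nullSymbol, abs_div, abs_of_nonneg (a := √(‖η‖ * ‖ζ‖) ^ 3) (by positivity)]
  rcases (mul_nonneg (norm_nonneg η) (norm_nonneg ζ)).eq_or_lt with h | h
  · rw [← h]; simp
  · have hs : 0 < √(‖η‖ * ‖ζ‖) := Real.sqrt_pos.2 h
    rw [div_le_iff₀ (by positivity)]
    refine (abs_det_le η ζ).trans (le_of_eq ?_)
    nth_rewrite 1 [← Real.sq_sqrt h.le]
    field_simp

/-- Measurable kernels of size `(|η||ζ|)^{-1/2}`. -/
structure IsFormKernel (m : Plane × Plane → ℂ) : Prop where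
  measurable : Measurable m
  bound : ∀ p, ‖m p‖ ≤ 1 / 2 * (√(‖p.1‖ * ‖p.2‖))⁻¹

/-- The integrand of a bilinear form with kernel `m`, tested against `φ`. -/
def formIntegrand (m : Plane × Plane → ℂ) (φ : 𝓢(Plane, ℂ)) (a b : Plane → C3)
    (p : Plane × Plane) : C3 :=
  (φ (p.1 + p.2) * m p) • crossL (a p.1) (b p.2)

variable {m : Plane × Plane → ℂ}

theorem IsFormKernel.aestronglyMeasurable_formIntegrand (hm : IsFormKernel m) (φ : 𝓢(Plane, ℂ))
    {a b : Plane → C3} (ha : AEStronglyMeasurable a) (hb : AEStronglyMeasurable b) :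
    AEStronglyMeasurable (formIntegrand m φ a b) (volume.prod volume) := by
  have h1 : Measurable fun p : Plane × Plane => φ (p.1 + p.2) * m p :=
    (φ.continuous.measurable.comp (measurable_fst.add measurable_snd)).mul hm.measurable
  exact h1.aestronglyMeasurable.smul (crossL.aestronglyMeasurable_comp₂ ha.comp_fst hb.comp_snd)

/-- Uniformity in the shift ζ comes from splitting at |η| = 1: inside, φ is bounded and |η|^{-1} is
integrable; outside, |η|^{-1} ≤ 1 and the integral of |φ| is translation invariant. -/
theorem schwartz_inv_norm_bound (φ : 𝓢(Plane, ℂ)) : ∃ A : ℝ, 0 ≤ A ∧ ∀ ζ : Plane,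
    ∫⁻ η : Plane, ENNReal.ofReal (‖φ (η + ζ)‖ * ‖η‖⁻¹) ≤ ENNReal.ofReal A := by
  obtain ⟨C, hC, h⟩ := schwartz_decay φ 0
  have hpt : ∀ ζ η : Plane, ‖φ (η + ζ)‖ * ‖η‖⁻¹ ≤
      4 * C * (‖η‖⁻¹ * (1 + ‖η‖) ^ (-(2 : ℝ))) + ‖φ (η + ζ)‖ := by
    intro ζ η
    have h0 : 0 ≤ 4 * C * (‖η‖⁻¹ * (1 + ‖η‖) ^ (-(2 : ℝ))) := by positivity
    have hφ : ‖φ (η + ζ)‖ ≤ C := by simpa using h (η + ζ)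
    rcases le_total ‖η‖ 1 with hη | hη
    · have h2 : (1 : ℝ) ≤ 4 * (1 + ‖η‖) ^ (-(2 : ℝ)) := by
        rw [Real.rpow_neg (by positivity), show ((2 : ℝ)) = ((2 : ℕ) : ℝ) by norm_num,
          Real.rpow_natCast, ← div_eq_mul_inv, le_div_iff₀ (by positivity)]
        nlinarith [norm_nonneg η]
      calc ‖φ (η + ζ)‖ * ‖η‖⁻¹ ≤ C * ‖η‖⁻¹ * 1 := by rw [mul_one]; gcongr
        _ ≤ C * ‖η‖⁻¹ * (4 * (1 + ‖η‖) ^ (-(2 : ℝ))) := by gcongr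
        _ = 4 * C * (‖η‖⁻¹ * (1 + ‖η‖) ^ (-(2 : ℝ))) := by ring
        _ ≤ _ := by linarith [norm_nonneg (φ (η + ζ))]
    · have : ‖η‖⁻¹ ≤ 1 := inv_le_one_of_one_le₀ hη
      nlinarith [norm_nonneg (φ (η + ζ))]
  have hi1 : Integrable fun η : Plane => 4 * C * (‖η‖⁻¹ * (1 + ‖η‖) ^ (-(2 : ℝ))) :=
    integrable_inv_norm_mul.const_mul _
  refine ⟨(∫ η : Plane, 4 * C * (‖η‖⁻¹ * (1 + ‖η‖) ^ (-(2 : ℝ)))) + ∫ η, ‖φ η‖, ?_, fun ζ => ?_⟩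
  · exact add_nonneg (integral_nonneg fun η => by positivity) (integral_nonneg fun η => by positivity)
  have hi2 : Integrable fun η : Plane => ‖φ (η + ζ)‖ := (φ.integrable.comp_add_right ζ).norm
  calc _ ≤ ∫⁻ η : Plane, ENNReal.ofReal
        (4 * C * (‖η‖⁻¹ * (1 + ‖η‖) ^ (-(2 : ℝ))) + ‖φ (η + ζ)‖) :=
        lintegral_mono fun η => ENNReal.ofReal_le_ofReal (hpt ζ η)
    _ = _ := by
        rw [← ofReal_integral_eq_lintegral_ofReal (f := fun η : Plane =>
          4 * C * (‖η‖⁻¹ * (1 + ‖η‖) ^ (-(2 : ℝ))) + ‖φ (η + ζ)‖) (hi1.add hi2)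
          (Filter.Eventually.of_forall fun η => by positivity), integral_add hi1 hi2,
          integral_add_right_eq_self (fun η => ‖φ η‖) ζ]
    _ ≤ _ := le_rfl

/-- A Schur test. The factor |φ(η+ζ)|(|η||ζ|)^{-1/2} is split into (|φ|/|η|)^{1/2}, attached to
b(ζ), and (|φ|/|ζ|)^{1/2}, attached to a(η). After Cauchy-Schwarz each singular variable is
integrated with the other one fixed. The 1/2 in the kernel bound cancels the 2 in the bound for the
cross product. -/
theorem IsFormKernel.lintegral_formIntegrand_sq_le (hm : IsFormKernel m) (φ : 𝓢(Plane, ℂ)) : ∃ A : ℝ, 0 ≤ A ∧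
    ∀ a b : Plane → C3, AEStronglyMeasurable a → AEStronglyMeasurable b →
    (∫⁻ p, ‖formIntegrand m φ a b p‖ₑ ∂(volume.prod volume)) ^ 2 ≤
      ENNReal.ofReal A ^ 2 * ((∫⁻ ξ, ‖a ξ‖ₑ ^ 2) * ∫⁻ ξ, ‖b ξ‖ₑ ^ 2) := by
  obtain ⟨A, hA, h⟩ := schwartz_inv_norm_bound φ
  refine ⟨A, hA, fun a b ha hb => ?_⟩
  set F : Plane × Plane → ℝ≥0∞ := fun p =>
    ENNReal.ofReal (√(‖φ (p.1 + p.2)‖ * ‖p.1‖⁻¹)) * ‖b p.2‖ₑ with hF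
  set G : Plane × Plane → ℝ≥0∞ := fun p =>
    ENNReal.ofReal (√(‖φ (p.1 + p.2)‖ * ‖p.2‖⁻¹)) * ‖a p.1‖ₑ with hG
  have hφm : Measurable fun p : Plane × Plane => ‖φ (p.1 + p.2)‖ :=
    (φ.continuous.measurable.comp (measurable_fst.add measurable_snd)).norm
  have hFm : AEMeasurable F (volume.prod volume) :=
    (Measurable.aemeasurable (by fun_prop)).mul hb.comp_snd.enorm
  have hGm : AEMeasurable G (volume.prod volume) :=
    (Measurable.aemeasurable (by fun_prop)).mul ha.comp_fst.enorm
  have hpt : ∀ p, ‖formIntegrand m φ a b p‖ₑ ≤ F p * G p := by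
    intro p
    rw [formIntegrand, hF, hG]
    simp only [← ofReal_norm]
    rw [← ENNReal.ofReal_mul (by positivity), ← ENNReal.ofReal_mul (by positivity),
      ← ENNReal.ofReal_mul (by positivity)]
    refine ENNReal.ofReal_le_ofReal ?_
    rw [norm_smul, norm_mul]
    have h1 := norm_crossL_le (a p.1) (b p.2)
    have h2 := hm.bound p
    have h4 : √(‖φ (p.1 + p.2)‖ * ‖p.1‖⁻¹) * √(‖φ (p.1 + p.2)‖ * ‖p.2‖⁻¹)
        = ‖φ (p.1 + p.2)‖ * (√(‖p.1‖ * ‖p.2‖))⁻¹ := by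
      rw [← Real.sqrt_mul (by positivity),
        show ‖φ (p.1 + p.2)‖ * ‖p.1‖⁻¹ * (‖φ (p.1 + p.2)‖ * ‖p.2‖⁻¹)
          = ‖φ (p.1 + p.2)‖ ^ 2 * (‖p.1‖ * ‖p.2‖)⁻¹ by rw [mul_inv]; ring,
        Real.sqrt_mul (by positivity), Real.sqrt_sq (norm_nonneg _), Real.sqrt_inv]
    calc _ ≤ ‖φ (p.1 + p.2)‖ * (1 / 2 * (√(‖p.1‖ * ‖p.2‖))⁻¹) * (2 * ‖a p.1‖ * ‖b p.2‖) := by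
          gcongr
      _ = (‖φ (p.1 + p.2)‖ * (√(‖p.1‖ * ‖p.2‖))⁻¹) * ‖a p.1‖ * ‖b p.2‖ := by ring
      _ = _ := by rw [← h4]; ring
  have hF2 : ∫⁻ p, F p ^ 2 ∂(volume.prod volume) ≤ ENNReal.ofReal A * ∫⁻ ξ, ‖b ξ‖ₑ ^ 2 := by
    rw [lintegral_prod_symm _ (hFm.pow_const 2), ← lintegral_const_mul'' _ (hb.enorm.pow_const 2)]
    refine lintegral_mono fun ζ => ?_
    simp only [hF, mul_pow]
    rw [lintegral_mul_const' _ _ (by simp)]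
    gcongr
    refine (lintegral_congr fun η => ?_).trans_le (h ζ)
    rw [← ENNReal.ofReal_pow (by positivity), Real.sq_sqrt (by positivity)]
  have hG2 : ∫⁻ p, G p ^ 2 ∂(volume.prod volume) ≤ ENNReal.ofReal A * ∫⁻ ξ, ‖a ξ‖ₑ ^ 2 := by
    rw [lintegral_prod _ (hGm.pow_const 2), ← lintegral_const_mul'' _ (ha.enorm.pow_const 2)]
    refine lintegral_mono fun η => ?_
    simp only [hG, mul_pow]
    rw [lintegral_mul_const' _ _ (by simp)]
    gcongr
    refine (lintegral_congr fun ζ => ?_).trans_le (h η)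
    rw [← ENNReal.ofReal_pow (by positivity), Real.sq_sqrt (by positivity), add_comm]
  calc _ ≤ (∫⁻ p, F p * G p ∂(volume.prod volume)) ^ 2 := by gcongr; exact hpt _
    _ ≤ _ := lintegral_mul_sq_le _ hFm hGm
    _ ≤ _ := mul_le_mul' hF2 hG2
    _ = _ := by ring

theorem IsFormKernel.integrable_formIntegrand (hm : IsFormKernel m) (φ : 𝓢(Plane, ℂ)) (a b : L2) :
    Integrable (formIntegrand m φ a b) (volume.prod volume) := by
  obtain ⟨A, hA, h⟩ := hm.lintegral_formIntegrand_sq_le φ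
  refine ⟨hm.aestronglyMeasurable_formIntegrand φ (Lp.aestronglyMeasurable a)
    (Lp.aestronglyMeasurable b), ?_⟩
  have h1 := h a b (Lp.aestronglyMeasurable a) (Lp.aestronglyMeasurable b)
  rw [← L2_enorm_sq, ← L2_enorm_sq] at h1
  have h2 : (∫⁻ p, ‖formIntegrand m φ a b p‖ₑ ∂(volume.prod volume)) ^ 2 < ∞ :=
    h1.trans_lt (by
      rw [← mul_pow, ← mul_pow]
      exact ENNReal.pow_lt_top (ENNReal.mul_lt_top ENNReal.ofReal_lt_top
        (ENNReal.mul_lt_top enorm_lt_top enorm_lt_top)))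
  exact (ENNReal.pow_lt_top_iff.1 h2).resolve_right (by norm_num)

theorem IsFormKernel.exists_norm_integral_formIntegrand_le (hm : IsFormKernel m) (φ : 𝓢(Plane, ℂ)) : ∃ A : ℝ, ∀ a b : L2,
    ‖∫ p, formIntegrand m φ a b p ∂(volume.prod volume)‖ ≤ A * ‖a‖ * ‖b‖ := by
  obtain ⟨A, hA, h⟩ := hm.lintegral_formIntegrand_sq_le φ
  refine ⟨A, fun a b => ?_⟩
  have h1 := h a b (Lp.aestronglyMeasurable a) (Lp.aestronglyMeasurable b)
  rw [← L2_enorm_sq, ← L2_enorm_sq, ← mul_pow, ← mul_pow, ENNReal.pow_le_pow_left_iff (by norm_num)]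
    at h1
  have h2 := (enorm_integral_le_lintegral_enorm _).trans h1
  rw [← ofReal_norm, ← ofReal_norm, ← ofReal_norm, ← ENNReal.ofReal_mul (norm_nonneg _),
    ← ENNReal.ofReal_mul hA, ENNReal.ofReal_le_ofReal_iff (by positivity), ← mul_assoc] at h2
  exact h2

theorem formIntegrand_congr (m : Plane × Plane → ℂ) (φ : 𝓢(Plane, ℂ)) {a a' b b' : Plane → C3} (ha : a =ᵐ[volume] a')
    (hb : b =ᵐ[volume] b') :
    formIntegrand m φ a b =ᵐ[volume.prod volume] formIntegrand m φ a' b' := by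
  filter_upwards [Measure.quasiMeasurePreserving_fst.ae_eq_comp ha,
    Measure.quasiMeasurePreserving_snd.ae_eq_comp hb] with p h1 h2
  simp only [Function.comp] at h1 h2
  rw [formIntegrand, formIntegrand, h1, h2]

/-- The bilinear form with kernel `m`. -/
def IsFormKernel.form (hm : IsFormKernel m) (φ : 𝓢(Plane, ℂ)) : L2 →L[ℂ] L2 →L[ℂ] C3 :=
  LinearMap.mkContinuous₂ (LinearMap.mk₂ ℂ
    (fun a b : L2 => ∫ p, formIntegrand m φ a b p ∂(volume.prod volume))
    (fun a a' b => by
      rw [← integral_add (hm.integrable_formIntegrand φ a b) (hm.integrable_formIntegrand φ a' b)]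
      refine integral_congr_ae ((formIntegrand_congr m φ (Lp.coeFn_add a a')
        Filter.EventuallyEq.rfl).trans (Filter.Eventually.of_forall fun p => ?_))
      simp [formIntegrand])
    (fun c a b => by
      rw [← integral_smul]
      refine integral_congr_ae ((formIntegrand_congr m φ (Lp.coeFn_smul c a)
        Filter.EventuallyEq.rfl).trans (Filter.Eventually.of_forall fun p => ?_))
      simp only [formIntegrand, Pi.smul_apply, map_smul, smul_apply]
      rw [smul_comm])
    (fun a b b' => by
      rw [← integral_add (hm.integrable_formIntegrand φ a b) (hm.integrable_formIntegrand φ a b')]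
      refine integral_congr_ae ((formIntegrand_congr m φ
        Filter.EventuallyEq.rfl (Lp.coeFn_add b b')).trans (Filter.Eventually.of_forall fun p => ?_))
      simp [formIntegrand])
    (fun c a b => by
      rw [← integral_smul]
      refine integral_congr_ae ((formIntegrand_congr m φ
        Filter.EventuallyEq.rfl (Lp.coeFn_smul c b)).trans (Filter.Eventually.of_forall fun p => ?_))
      simp only [formIntegrand, Pi.smul_apply, map_smul]
      rw [smul_comm])) (hm.exists_norm_integral_formIntegrand_le φ).choose
    (hm.exists_norm_integral_formIntegrand_le φ).choose_spec

theorem IsFormKernel.form_apply (hm : IsFormKernel m) (φ : 𝓢(Plane, ℂ)) (a b : L2) :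
    hm.form φ a b = ∫ p, formIntegrand m φ a b p ∂(volume.prod volume) := rfl

attribute [irreducible] IsFormKernel.form

/-- The constant -1/(4π) is half of (2πi)²(2π)^{-3}, the numerical factor in the product of the two
gradient symbols; the half comes from antisymmetrisation. -/
theorem isFormKernel_null :
    IsFormKernel fun p => ((-(1 / (4 * Real.pi)) * nullSymbol p.1 p.2 : ℝ) : ℂ) := by
  refine ⟨Complex.measurable_ofReal.comp (measurable_nullSymbol.const_mul _), fun p => ?_⟩
  rw [Complex.norm_real, Real.norm_eq_abs, abs_mul]
  refine mul_le_mul ?_ (abs_nullSymbol_le p.1 p.2) (abs_nonneg _) (by norm_num)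
  rw [abs_neg, abs_of_pos (by positivity)]
  gcongr
  nlinarith [Real.pi_gt_three]

/-- The null form `½ (u_x ∧ v_y + v_x ∧ u_y)` on the Fourier side, tested against `φ`, in terms of
`a = (-Δ)^{3/4} u` and `b = (-Δ)^{3/4} v`. -/
def nullForm (φ : 𝓢(Plane, ℂ)) : L2 →L[ℂ] L2 →L[ℂ] C3 := isFormKernel_null.form φ

theorem nullForm_apply (φ : 𝓢(Plane, ℂ)) (a b : L2) : nullForm φ a b = ∫ p, formIntegrand
    (fun p => ((-(1 / (4 * Real.pi)) * nullSymbol p.1 p.2 : ℝ) : ℂ)) φ a b p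
      ∂(volume.prod volume) := isFormKernel_null.form_apply φ a b

/-- The determinant and the cross product are both antisymmetric, and the two signs cancel. -/
theorem nullForm_swap (φ : 𝓢(Plane, ℂ)) (a b : L2) : nullForm φ a b = nullForm φ b a := by
  rw [nullForm_apply, nullForm_apply, ← integral_prod_swap]
  refine integral_congr_ae (Filter.Eventually.of_forall fun p => ?_)
  simp only [formIntegrand, Prod.fst_swap, Prod.snd_swap]
  rw [nullSymbol_swap, crossL_swap, add_comm]
  simp

end NullForm

/-! ### Injectivity of the weighted pairings -/

section Uniqueness

theorem tsupport_subset_compl_zero {φ : 𝓢(Plane, ℂ)} (h : tsupport φ ⊆ {0}ᶜ) : φ 0 = 0 := by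
  by_contra h0
  exact h (subset_tsupport _ h0) rfl

/-- Test functions supported away from the origin suffice: there the weight is continuous and
nonzero, and a point has measure zero. -/
theorem eq_zero_of_forall_pairing {s : ℝ} (a : L2)
    (h : ∀ φ : 𝓢(Plane, ℂ), φ 0 = 0 → ∫ ξ, sobWeight s φ ξ • a ξ = 0) : a = 0 := by
  have hloc : LocallyIntegrableOn (fun ξ : Plane => (2 * Real.pi * ‖ξ‖) ^ (-s) • a ξ) {0}ᶜ := by
    refine LocallyIntegrableOn.continuousOn_smul isOpen_compl_singleton.isLocallyClosed
      (((Lp.memLp a).locallyIntegrable (by norm_num)).locallyIntegrableOn _) ?_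
    refine ContinuousOn.rpow_const (by fun_prop) fun ξ hξ => Or.inl ?_
    have : ‖ξ‖ ≠ 0 := norm_ne_zero_iff.2 hξ
    positivity
  have h0 := ae_eq_zero_on_of_forall_schwartz isOpen_compl_singleton hloc fun φ hφ => by
    rw [← h φ (tsupport_subset_compl_zero hφ)]
    refine integral_congr_ae (Filter.Eventually.of_forall fun ξ => ?_)
    simp only [sobWeight]
    rw [mul_smul]
    rfl
  refine Lp.ext ?_
  filter_upwards [h0, compl_mem_ae_iff.2 (measure_singleton (0 : Plane)),
    Lp.coeFn_zero C3 2 (volume : Measure Plane)] with ξ h1 h2 h3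
  rw [h3]
  have : ‖ξ‖ ≠ 0 := norm_ne_zero_iff.2 h2
  exact (smul_eq_zero.1 (h1 h2)).resolve_left (by positivity)

end Uniqueness

/-! ### The bilinear operator of two free waves, frequency by frequency -/

section FreeEstimate

/-- The kernel of the null form with the weight of `Ḣ^{1/2}`. -/
def nullKernel (ξ η : Plane) : ℝ := √‖ξ‖ * nullSymbol η (ξ - η)

theorem measurable_nullKernel : Measurable fun p : Plane × Plane => nullKernel p.1 p.2 := by
  unfold nullKernel
  exact (by fun_prop : Measurable fun p : Plane × Plane => √‖p.1‖).mul
    (measurable_nullSymbol.comp (measurable_snd.prodMk (measurable_fst.sub measurable_snd)))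

/-- The plane is identified isometrically with ℂ. The four sign patterns reduce to a sum and a
difference by replacing h(x) with h(-x), which has the same integral. -/
theorem lintegral_nullKernel_le (ξ : Plane) {σ τ : ℝ} (hσ : σ = 1 ∨ σ = -1) (hτ : τ = 1 ∨ τ = -1)
    {h : ℝ → ℝ≥0∞} (hh : Measurable h) :
    ∫⁻ η, ‖nullKernel ξ η‖ₑ ^ 2 * h (σ * ‖η‖ + τ * ‖ξ - η‖)
      ≤ ENNReal.ofReal (32 * Real.pi ^ 2) * ∫⁻ x, h x := by
  set J := Complex.orthonormalBasisOneI.repr with hJ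
  obtain ⟨z, rfl⟩ := J.surjective ξ
  have hk : ∀ w : ℂ, nullKernel (J z) (J w) = nullKernelC z w := fun w => by
    rw [nullKernel, nullKernelC, nullSymbol, ← map_sub, J.norm_map, J.norm_map, J.norm_map,
      mul_div_assoc]
    congr 2
    simp [hJ, Complex.orthonormalBasisOneI_repr_apply]
    ring
  rw [← J.measurePreserving.lintegral_comp_emb J.toMeasurableEquiv.measurableEmbedding]
  simp_rw [hk, ← map_sub, J.norm_map]
  have hn : ∫⁻ x, h (-x) = ∫⁻ x, h x := lintegral_neg_eq_self h
  rcases hσ with rfl | rfl <;> rcases hτ with rfl | rfl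
  · simpa using lintegral_nullKernelC_le z true hh
  · simpa [sub_eq_add_neg] using lintegral_nullKernelC_le z false hh
  · rw [← hn]
    simpa [sub_eq_add_neg, add_comm] using lintegral_nullKernelC_le z false (hh.comp measurable_neg)
  · rw [← hn]
    simpa [add_comm] using lintegral_nullKernelC_le z true (hh.comp measurable_neg)

/-- Bounded functions supported in the annulus `δ ≤ |ξ| ≤ R`. -/
structure IsAnnular (δ R B : ℝ) (f : Plane → C3) : Prop where
  pos : 0 < δ
  radius_nonneg : 0 ≤ R
  bound_nonneg : 0 ≤ B
  meas : StronglyMeasurable f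
  bound : ∀ ξ, ‖f ξ‖ ≤ B
  support_le : ∀ ξ, f ξ ≠ 0 → δ ≤ ‖ξ‖ ∧ ‖ξ‖ ≤ R

variable {δ R B : ℝ} {f g : Plane → C3}

/-- The integrand of the bilinear operator for two free waves. -/
def freeIntegrand (σ τ : ℝ) (f g : Plane → C3) (t : ℝ) (ξ η : Plane) : C3 :=
  Complex.exp (2 * Real.pi * t * ((σ * ‖η‖ + τ * ‖ξ - η‖ : ℝ) : ℂ) * Complex.I) •
    (nullKernel ξ η • crossL (f η) (g (ξ - η)))

/-- The bilinear operator for two free waves. -/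
def freeForm (σ τ : ℝ) (f g : Plane → C3) (t : ℝ) (ξ : Plane) : C3 :=
  ∫ η, freeIntegrand σ τ f g t ξ η

theorem IsAnnular.stronglyMeasurable_cross (hf : IsAnnular δ R B f) (hg : IsAnnular δ R B g) :
    StronglyMeasurable fun p : Plane × Plane => crossL (f p.2) (g (p.1 - p.2)) := by
  have h0 : Measurable fun p : Plane × Plane => p.1 - p.2 := measurable_fst.sub measurable_snd
  have h1 : StronglyMeasurable fun p : Plane × Plane => f p.2 :=
    hf.meas.comp_measurable measurable_snd
  have h2 : StronglyMeasurable fun p : Plane × Plane => g (p.1 - p.2) := hg.meas.comp_measurable h0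
  exact stronglyMeasurable_crossL h1 h2

theorem IsAnnular.stronglyMeasurable_kernel_cross (hf : IsAnnular δ R B f)
    (hg : IsAnnular δ R B g) : StronglyMeasurable fun p : Plane × Plane =>
      nullKernel p.1 p.2 • crossL (f p.2) (g (p.1 - p.2)) :=
  measurable_nullKernel.stronglyMeasurable.smul (hf.stronglyMeasurable_cross hg)

theorem IsAnnular.stronglyMeasurable_freeIntegrand (hf : IsAnnular δ R B f)
    (hg : IsAnnular δ R B g) (σ τ : ℝ) : StronglyMeasurable fun p : (ℝ × Plane) × Plane =>
      freeIntegrand σ τ f g p.1.1 p.1.2 p.2 := by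
  have h1 : Continuous fun p : (ℝ × Plane) × Plane => Complex.exp (2 * Real.pi * p.1.1 *
    ((σ * ‖p.2‖ + τ * ‖p.1.2 - p.2‖ : ℝ) : ℂ) * Complex.I) := by fun_prop
  have h2 : Measurable fun p : (ℝ × Plane) × Plane => (p.1.2, p.2) :=
    (measurable_snd.comp measurable_fst).prodMk measurable_snd
  have h3 := (hf.stronglyMeasurable_kernel_cross hg).comp_measurable h2
  have h4 := h1.stronglyMeasurable.smul h3
  exact h4

/-- The bound for the amplitude of `freeIntegrand`. -/
def annularBound (δ R B : ℝ) (ξ η : Plane) : ℝ :=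
  (Metric.closedBall (0 : Plane) (2 * R)).indicator 1 ξ *
    (Metric.closedBall (0 : Plane) R).indicator (fun _ => √(2 * R) * δ⁻¹ * (2 * B * B)) η

/-- The annulus bounds the kernel by keeping η and ξ-η away from zero, and bounds the phase by
keeping them below R. The second inequality is the one that controls the derivative in time. -/
theorem IsAnnular.norm_kernel_cross_le (hf : IsAnnular δ R B f) (hg : IsAnnular δ R B g)
    (ξ η : Plane) : ‖nullKernel ξ η • crossL (f η) (g (ξ - η))‖ ≤ annularBound δ R B ξ η ∧
      (‖η‖ + ‖ξ - η‖) * ‖nullKernel ξ η • crossL (f η) (g (ξ - η))‖ ≤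
        2 * R * annularBound δ R B ξ η := by
  have hδ := hf.pos
  have hR := hf.radius_nonneg
  have hB := hf.bound_nonneg
  have hnn : 0 ≤ annularBound δ R B ξ η := by
    unfold annularBound
    refine mul_nonneg (indicator_nonneg (fun _ _ => zero_le_one) _)
      (indicator_nonneg (fun _ _ => by positivity) _)
  by_cases h1 : f η = 0
  · simp only [h1, map_zero, smul_zero, norm_zero, zero_apply, mul_zero]
    exact ⟨hnn, by positivity⟩
  by_cases h2 : g (ξ - η) = 0
  · simp only [h2, map_zero, smul_zero, norm_zero, mul_zero]
    exact ⟨hnn, by positivity⟩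
  obtain ⟨a1, a2⟩ := hf.support_le _ h1
  obtain ⟨b1, b2⟩ := hg.support_le _ h2
  have hξ : ‖ξ‖ ≤ 2 * R := by
    calc ‖ξ‖ = ‖η + (ξ - η)‖ := by rw [add_sub_cancel]
      _ ≤ _ := norm_add_le _ _
      _ ≤ _ := by linarith
  have hb : annularBound δ R B ξ η = √(2 * R) * δ⁻¹ * (2 * B * B) := by
    rw [annularBound, indicator_of_mem (by simpa using hξ), indicator_of_mem (by simpa using a2)]
    simp
  have hk : |nullKernel ξ η| ≤ √(2 * R) * δ⁻¹ := by
    rw [nullKernel, abs_mul, abs_of_nonneg (Real.sqrt_nonneg _)]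
    refine mul_le_mul (Real.sqrt_le_sqrt hξ) ((abs_nullSymbol_le _ _).trans ?_) (abs_nonneg _)
      (by positivity)
    refine inv_anti₀ hδ (Real.le_sqrt_of_sq_le ?_)
    rw [sq]; exact mul_le_mul a1 b1 hδ.le (by positivity)
  have h3 : ‖nullKernel ξ η • crossL (f η) (g (ξ - η))‖ ≤ annularBound δ R B ξ η := by
    rw [norm_smul, hb]
    refine mul_le_mul hk ((norm_crossL_le _ _).trans ?_) (norm_nonneg _) (by positivity)
    have := hf.bound η
    have := hg.bound (ξ - η)
    gcongr
  exact ⟨h3, mul_le_mul (by linarith) h3 (norm_nonneg _) (by positivity)⟩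

theorem integrable_annularBound (δ R B : ℝ) (ξ : Plane) : Integrable (annularBound δ R B ξ) :=
  ((integrable_indicator_iff measurableSet_closedBall).2
    (integrableOn_const (isCompact_closedBall _ _).measure_ne_top)).const_mul _

theorem norm_freeIntegrand (σ τ : ℝ) (t : ℝ) (ξ η : Plane) :
    ‖freeIntegrand σ τ f g t ξ η‖ = ‖nullKernel ξ η • crossL (f η) (g (ξ - η))‖ := by
  rw [freeIntegrand, norm_smul, show (2 * Real.pi * t * ((σ * ‖η‖ + τ * ‖ξ - η‖ : ℝ) : ℂ) *
    Complex.I : ℂ) = ((2 * Real.pi * t * (σ * ‖η‖ + τ * ‖ξ - η‖) : ℝ) : ℂ) * Complex.I by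
    push_cast; ring, Complex.norm_exp_ofReal_mul_I, one_mul]

theorem IsAnnular.integrable_freeIntegrand (hf : IsAnnular δ R B f) (hg : IsAnnular δ R B g)
    (σ τ t : ℝ) (ξ : Plane) : Integrable (freeIntegrand σ τ f g t ξ) :=
  (integrable_annularBound δ R B ξ).mono'
    ((hf.stronglyMeasurable_freeIntegrand hg σ τ).comp_measurable
      (measurable_prodMk_left (x := (t, ξ)))).aestronglyMeasurable
    (Filter.Eventually.of_forall fun η => by
      rw [norm_freeIntegrand]; exact (hf.norm_kernel_cross_le hg ξ η).1)

theorem IsAnnular.stronglyMeasurable_freeForm (hf : IsAnnular δ R B f) (hg : IsAnnular δ R B g)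
    (σ τ : ℝ) : StronglyMeasurable fun p : ℝ × Plane => freeForm σ τ f g p.1 p.2 :=
  (hf.stronglyMeasurable_freeIntegrand hg σ τ).integral_prod_right'

/-- The Lipschitz bound in t makes the form a continuous curve in L², hence strongly measurable. The
constants depend on the annulus and do not enter the final estimate. -/
theorem IsAnnular.exists_freeForm_bound (hf : IsAnnular δ R B f) (hg : IsAnnular δ R B g)
    {σ τ : ℝ} (hσ : |σ| ≤ 1) (hτ : |τ| ≤ 1) : ∃ C : ℝ, 0 ≤ C ∧
      (∀ t ξ, ‖freeForm σ τ f g t ξ‖ ≤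
        C * (Metric.closedBall (0 : Plane) (2 * R)).indicator 1 ξ) ∧
      ∀ t t' ξ, ‖freeForm σ τ f g t ξ - freeForm σ τ f g t' ξ‖ ≤
        C * (Metric.closedBall (0 : Plane) (2 * R)).indicator 1 ξ * |t - t'| := by
  have hR := hf.radius_nonneg
  have hB := hf.bound_nonneg
  have hδ := hf.pos
  set D : ℝ := ∫ η, (Metric.closedBall (0 : Plane) R).indicator
    (fun _ => √(2 * R) * δ⁻¹ * (2 * B * B)) η with hD
  have hD0 : 0 ≤ D := integral_nonneg (indicator_nonneg fun _ _ => by positivity)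
  have hint : ∀ ξ, ∫ η, annularBound δ R B ξ η =
      (Metric.closedBall (0 : Plane) (2 * R)).indicator 1 ξ * D := fun ξ => by
    simp only [annularBound]
    rw [integral_const_mul]
  have hi0 : ∀ ξ : Plane, (0 : ℝ) ≤ (Metric.closedBall (0 : Plane) (2 * R)).indicator 1 ξ :=
    fun ξ => indicator_nonneg (fun _ _ => zero_le_one) _
  refine ⟨D + 2 * Real.pi * (2 * R) * D, by positivity, fun t ξ => ?_, fun t t' ξ => ?_⟩
  · calc _ ≤ ∫ η, annularBound δ R B ξ η := norm_integral_le_of_norm_le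
          (integrable_annularBound δ R B ξ) (Filter.Eventually.of_forall fun η => by
            rw [norm_freeIntegrand]; exact (hf.norm_kernel_cross_le hg ξ η).1)
      _ = D * (Metric.closedBall (0 : Plane) (2 * R)).indicator 1 ξ := by rw [hint, mul_comm]
      _ ≤ _ := mul_le_mul_of_nonneg_right (by linarith [show 0 ≤ 2 * Real.pi * (2 * R) * D by positivity]) (hi0 ξ)
  · rw [freeForm, freeForm, ← integral_sub (hf.integrable_freeIntegrand hg σ τ t ξ)
      (hf.integrable_freeIntegrand hg σ τ t' ξ)]
    calc _ ≤ ∫ η, (2 * Real.pi * (2 * R) * |t - t'|) * annularBound δ R B ξ η := by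
          refine norm_integral_le_of_norm_le ((integrable_annularBound δ R B ξ).const_mul _)
            (Filter.Eventually.of_forall fun η => ?_)
          rw [freeIntegrand, freeIntegrand, ← sub_smul, norm_smul]
          have e : ∀ s : ℝ, (2 * Real.pi * s * ((σ * ‖η‖ + τ * ‖ξ - η‖ : ℝ) : ℂ) * Complex.I : ℂ)
            = Complex.I * ((2 * Real.pi * s * (σ * ‖η‖ + τ * ‖ξ - η‖) : ℝ) : ℂ) := fun s => by
            push_cast; ring
          have hph : |σ * ‖η‖ + τ * ‖ξ - η‖| ≤ ‖η‖ + ‖ξ - η‖ := by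
            refine (abs_add_le _ _).trans ?_
            rw [abs_mul, abs_mul, abs_norm, abs_norm]
            nlinarith [norm_nonneg η, norm_nonneg (ξ - η)]
          have h1 : ‖Complex.exp (2 * Real.pi * t * ((σ * ‖η‖ + τ * ‖ξ - η‖ : ℝ) : ℂ) * Complex.I)
              - Complex.exp (2 * Real.pi * t' * ((σ * ‖η‖ + τ * ‖ξ - η‖ : ℝ) : ℂ) * Complex.I)‖
              ≤ 2 * Real.pi * |t - t'| * (‖η‖ + ‖ξ - η‖) := by
            set X : ℝ := 2 * Real.pi * t * (σ * ‖η‖ + τ * ‖ξ - η‖) with hX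
            set X' : ℝ := 2 * Real.pi * t' * (σ * ‖η‖ + τ * ‖ξ - η‖) with hX'
            rw [e, e, ← hX, ← hX', show Complex.I * (X : ℂ) = Complex.I * (X' : ℂ) +
              Complex.I * ((X - X' : ℝ) : ℂ) by push_cast; ring, Complex.exp_add, ← mul_sub_one,
              norm_mul, mul_comm Complex.I (X' : ℂ), Complex.norm_exp_ofReal_mul_I, one_mul]
            refine (Real.norm_exp_I_mul_ofReal_sub_one_le).trans ?_
            rw [hX, hX', ← sub_mul, ← mul_sub, norm_mul, norm_mul, Real.norm_eq_abs,
              Real.norm_eq_abs, Real.norm_eq_abs, abs_of_pos (by positivity : (0 : ℝ) < 2 * Real.pi)]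
            gcongr
          have h2 := (hf.norm_kernel_cross_le hg ξ η).2
          calc _ ≤ 2 * Real.pi * |t - t'| * (‖η‖ + ‖ξ - η‖) *
                ‖nullKernel ξ η • crossL (f η) (g (ξ - η))‖ := by gcongr
            _ = 2 * Real.pi * |t - t'| * ((‖η‖ + ‖ξ - η‖) *
                ‖nullKernel ξ η • crossL (f η) (g (ξ - η))‖) := by ring
            _ ≤ 2 * Real.pi * |t - t'| * (2 * R * annularBound δ R B ξ η) := by gcongr
            _ = _ := by ring
      _ = (2 * Real.pi * (2 * R) * D) * (Metric.closedBall (0 : Plane) (2 * R)).indicator 1 ξ *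
          |t - t'| := by rw [integral_const_mul, hint]; ring
      _ ≤ _ := by
          have := hi0 ξ
          gcongr
          linarith

/-- For each ξ the dual restriction estimate bounds the time integral by ∫|f(η)|²|g(ξ-η)|² dη up to
a constant. Integrating this convolution in ξ gives the product of the L² norms. The constant is
32π² times 4, the square of the constant for the cross product. -/
theorem IsAnnular.lintegral_freeForm_sq_le (hf : IsAnnular δ R B f) (hg : IsAnnular δ R B g)
    {σ τ : ℝ} (hσ : σ = 1 ∨ σ = -1) (hτ : τ = 1 ∨ τ = -1) {s : Set ℝ} (hs : MeasurableSet s)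
    (hs' : volume s ≠ ∞) :
    ∫⁻ t in s, ∫⁻ ξ, ‖freeForm σ τ f g t ξ‖ₑ ^ 2 ≤
      ENNReal.ofReal (128 * Real.pi ^ 2) * ((∫⁻ η, ‖f η‖ₑ ^ 2) * ∫⁻ η, ‖g η‖ₑ ^ 2) := by
  have hm : Measurable fun p : ℝ × Plane => ‖freeForm σ τ f g p.1 p.2‖ₑ ^ 2 :=
    (hf.stronglyMeasurable_freeForm hg σ τ).enorm.pow_const 2
  rw [lintegral_lintegral_swap hm.aemeasurable]
  have hc : ∀ ξ, StronglyMeasurable fun η => crossL (f η) (g (ξ - η)) := fun ξ => by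
    have := (hf.stronglyMeasurable_cross hg).comp_measurable (measurable_prodMk_left (x := ξ))
    exact this
  have hkc : ∀ ξ, StronglyMeasurable fun η => nullKernel ξ η • crossL (f η) (g (ξ - η)) :=
    fun ξ => by
      have := (hf.stronglyMeasurable_kernel_cross hg).comp_measurable
        (measurable_prodMk_left (x := ξ))
      exact this
  have hk : ∀ ξ, Measurable (nullKernel ξ) := fun ξ => by
    have := measurable_nullKernel.comp (measurable_prodMk_left (x := ξ))
    exact this
  have h1 : ∀ ξ, ∫⁻ t in s, ‖freeForm σ τ f g t ξ‖ₑ ^ 2 ≤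
      ENNReal.ofReal (32 * Real.pi ^ 2) * ∫⁻ η, ‖crossL (f η) (g (ξ - η))‖ₑ ^ 2 := by
    intro ξ
    refine lintegral_oscillatory_sq_le (a := fun η => σ * ‖η‖ + τ * ‖ξ - η‖)
      (k := nullKernel ξ) (H := fun η => crossL (f η) (g (ξ - η))) (by fun_prop)
      (hk ξ)
      (fun h hh => lintegral_nullKernel_le ξ hσ hτ hh)
      (hc ξ).aestronglyMeasurable ?_ hs hs'
    exact (integrable_annularBound δ R B ξ).mono'
      (hkc ξ).aestronglyMeasurable
      (Filter.Eventually.of_forall fun η => (hf.norm_kernel_cross_le hg ξ η).1)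
  have hmf : Measurable fun η => ‖f η‖ₑ ^ 2 := hf.meas.enorm.pow_const 2
  have hmg : Measurable fun η => ‖g η‖ₑ ^ 2 := hg.meas.enorm.pow_const 2
  calc _ ≤ ∫⁻ ξ, ENNReal.ofReal (32 * Real.pi ^ 2) *
        ∫⁻ η, 4 * (‖f η‖ₑ ^ 2 * ‖g (ξ - η)‖ₑ ^ 2) := by
        refine lintegral_mono fun ξ => (h1 ξ).trans ?_
        gcongr with η
        have := norm_crossL_le (f η) (g (ξ - η))
        rw [← ofReal_norm, ← ofReal_norm, ← ofReal_norm, ← ENNReal.ofReal_pow (norm_nonneg _),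
          ← ENNReal.ofReal_pow (norm_nonneg _), ← ENNReal.ofReal_pow (norm_nonneg _),
          ← ENNReal.ofReal_mul (by positivity), show (4 : ℝ≥0∞) = ENNReal.ofReal 4 by simp,
          ← ENNReal.ofReal_mul (by positivity)]
        refine ENNReal.ofReal_le_ofReal ?_
        calc _ ≤ (2 * ‖f η‖ * ‖g (ξ - η)‖) ^ 2 := by gcongr
          _ = _ := by ring
    _ = ENNReal.ofReal (32 * Real.pi ^ 2) * (4 *
        ∫⁻ ξ, ∫⁻ η, ‖f η‖ₑ ^ 2 * ‖g (ξ - η)‖ₑ ^ 2) := by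
        rw [lintegral_const_mul' _ _ ENNReal.ofReal_ne_top,
          ← lintegral_const_mul' (4 : ℝ≥0∞) _ (by simp)]
        congr 1
        refine lintegral_congr fun ξ => ?_
        rw [lintegral_const_mul' _ _ (by simp)]
    _ = ENNReal.ofReal (32 * Real.pi ^ 2) * (4 *
        ((∫⁻ η, ‖f η‖ₑ ^ 2) * ∫⁻ η, ‖g η‖ₑ ^ 2)) := by
        have h0 : Measurable fun p : Plane × Plane => p.1 - p.2 :=
          measurable_fst.sub measurable_snd
        have h2 : Measurable fun p : Plane × Plane => ‖f p.2‖ₑ ^ 2 := hmf.comp measurable_snd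
        have h3 : Measurable fun p : Plane × Plane => ‖g (p.1 - p.2)‖ₑ ^ 2 := hmg.comp h0
        have h4 : Measurable fun p : Plane × Plane => ‖f p.2‖ₑ ^ 2 * ‖g (p.1 - p.2)‖ₑ ^ 2 :=
          h2.mul h3
        rw [lintegral_lintegral_swap h4.aemeasurable, ← lintegral_mul_const _ hmf]
        congr 2
        refine lintegral_congr fun η => ?_
        have h5 : Measurable fun ξ : Plane => ‖g (ξ - η)‖ₑ ^ 2 :=
          hmg.comp (measurable_id.sub_const η)
        rw [lintegral_const_mul _ h5, lintegral_sub_right_eq_self (fun ζ => ‖g ζ‖ₑ ^ 2) η]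
    _ = _ := by
        rw [← mul_assoc, show (4 : ℝ≥0∞) = ENNReal.ofReal 4 by simp,
          ← ENNReal.ofReal_mul (by positivity)]
        congr 2; ring

end FreeEstimate

/-! ### The space-time estimate for annular data -/

section FreeEstimate

variable {δ R B : ℝ} {f g : Plane → C3}

/-- Square integrable curves in `L²`, on the time interval `[0,T]`. -/
abbrev Curve (T : ℝ) : Type := Lp L2 2 (volume.restrict (Icc (0 : ℝ) T))

theorem IsAnnular.memLp (hf : IsAnnular δ R B f) : MemLp f 2 := by
  refine MemLp.mono (memLp_indicator_const 2 (measurableSet_closedBall (x := (0 : Plane)) (ε := R))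
    B (Or.inr (isCompact_closedBall _ _).measure_ne_top)) hf.meas.aestronglyMeasurable
    (Filter.Eventually.of_forall fun ξ => ?_)
  by_cases h : f ξ = 0
  · rw [h, norm_zero]; exact norm_nonneg _
  · rw [indicator_of_mem (by simpa using (hf.support_le _ h).2)]
    exact (hf.bound ξ).trans (le_abs_self _)

theorem memLp_ballIndicator (C r : ℝ) :
    MemLp (fun ξ => C * (Metric.closedBall (0 : Plane) r).indicator (1 : Plane → ℝ) ξ) 2 :=
  (memLp_indicator_const 2 (measurableSet_closedBall (x := (0 : Plane)) (ε := r))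
    (1 : ℝ) (Or.inr (isCompact_closedBall _ _).measure_ne_top)).const_mul C

theorem IsAnnular.memLp_freeForm (hf : IsAnnular δ R B f) (hg : IsAnnular δ R B g)
    {σ τ : ℝ} (hσ : |σ| ≤ 1) (hτ : |τ| ≤ 1) (t : ℝ) : MemLp (freeForm σ τ f g t) 2 := by
  obtain ⟨C, hC, h, -⟩ := hf.exists_freeForm_bound hg hσ hτ
  have hm : StronglyMeasurable (freeForm σ τ f g t) := by
    have := (hf.stronglyMeasurable_freeForm hg σ τ).comp_measurable
      (measurable_prodMk_left (x := t))
    exact this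
  exact (memLp_ballIndicator C (2 * R)).mono hm.aestronglyMeasurable
    (Filter.Eventually.of_forall fun ξ => (h t ξ).trans (le_abs_self _))

theorem IsAnnular.continuous_toLp_freeForm (hf : IsAnnular δ R B f) (hg : IsAnnular δ R B g)
    {σ τ : ℝ} (hσ : |σ| ≤ 1) (hτ : |τ| ≤ 1) :
    Continuous fun t => (hf.memLp_freeForm hg hσ hτ t).toLp (freeForm σ τ f g t) := by
  obtain ⟨C, hC, -, h⟩ := hf.exists_freeForm_bound hg hσ hτ
  refine (LipschitzWith.of_dist_le_mul (K := ⟨‖(memLp_ballIndicator C (2 * R)).toLp‖,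
    norm_nonneg _⟩) fun t t' => ?_).continuous
  rw [dist_eq_norm, ← MemLp.toLp_sub, mul_comm]
  refine Lp.norm_le_mul_norm_of_ae_le_mul ?_
  filter_upwards [MemLp.coeFn_toLp ((hf.memLp_freeForm hg hσ hτ t).sub
    (hf.memLp_freeForm hg hσ hτ t')), (memLp_ballIndicator C (2 * R)).coeFn_toLp] with ξ h1 h2
  rw [h1, h2, Pi.sub_apply, Real.dist_eq, mul_comm]
  exact (h t t' ξ).trans (mul_le_mul_of_nonneg_right (le_abs_self _) (abs_nonneg _))

theorem integral_prod_eq_integral_convolution {F : Plane × Plane → C3}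
    (hF : Integrable F (volume.prod volume)) :
    ∫ p, F p ∂(volume.prod volume) = ∫ ξ, ∫ η, F (η, ξ - η) := by
  rw [integral_prod _ hF]
  have h : Integrable (fun p : Plane × Plane => F (p.1, p.2 - p.1)) (volume.prod volume) :=
    (measurePreserving_prod_sub volume volume).integrable_comp_of_integrable hF
  have h1 := integral_integral_swap (f := fun η ξ : Plane => F (η, ξ - η)) h
  rw [← h1]
  congr 1
  ext1 η
  exact (integral_sub_right_eq_self (fun ζ => F (η, ζ)) η).symm

/-- After the substitution ζ = ξ - η, a factor √|ξ| is inserted into the kernel and taken out again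
through the weight (2π|ξ|)^{-1/2}. The leftover constant is -√(2π)/(4π). -/
theorem IsAnnular.nullForm_waveOp (hf : IsAnnular δ R B f) (hg : IsAnnular δ R B g)
    {σ τ : ℝ} (hσ : |σ| ≤ 1) (hτ : |τ| ≤ 1) (t : ℝ) (φ : 𝓢(Plane, ℂ)) :
    nullForm φ (waveOp (σ * t) (hf.memLp.toLp f)) (waveOp (τ * t) (hg.memLp.toLp g)) =
      pairing (sobWeight (1 / 2) φ) (((-√(2 * Real.pi) / (4 * Real.pi) : ℝ) : ℂ) •
        (hf.memLp_freeForm hg hσ hτ t).toLp (freeForm σ τ f g t)) := by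
  set wf : Plane → C3 := fun ξ =>
    Complex.exp (((σ * t * (2 * Real.pi * ‖ξ‖) : ℝ) : ℂ) * Complex.I) • f ξ with hwf
  set wg : Plane → C3 := fun ξ =>
    Complex.exp (((τ * t * (2 * Real.pi * ‖ξ‖) : ℝ) : ℂ) * Complex.I) • g ξ with hwg
  have e1 : (waveOp (σ * t) (hf.memLp.toLp f) : Plane → C3) =ᵐ[volume] wf := by
    filter_upwards [waveOp_coe (σ * t) (hf.memLp.toLp f), hf.memLp.coeFn_toLp] with ξ h1 h2
    rw [h1, h2]
  have e2 : (waveOp (τ * t) (hg.memLp.toLp g) : Plane → C3) =ᵐ[volume] wg := by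
    filter_upwards [waveOp_coe (τ * t) (hg.memLp.toLp g), hg.memLp.coeFn_toLp] with ξ h1 h2
    rw [h1, h2]
  have e3 := formIntegrand_congr (fun p => ((-(1 / (4 * Real.pi)) * nullSymbol p.1 p.2 : ℝ) : ℂ)) φ e1 e2
  rw [nullForm_apply, integral_congr_ae e3,
    integral_prod_eq_integral_convolution ((isFormKernel_null.integrable_formIntegrand φ _ _).congr e3), map_smul,
    pairing_apply (memLp_sobWeight_half φ), ← integral_smul]
  refine integral_congr_ae ?_
  filter_upwards [(hf.memLp_freeForm hg hσ hτ t).coeFn_toLp,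
    compl_mem_ae_iff.2 (measure_singleton (0 : Plane))] with ξ h1 h2
  have hξ : 0 < ‖ξ‖ := norm_pos_iff.2 h2
  rw [h1, freeForm, ← integral_smul, ← integral_smul]
  congr 1
  ext1 η
  have hc : crossL (wf η) (wg (ξ - η)) = Complex.exp (2 * Real.pi * t *
      ((σ * ‖η‖ + τ * ‖ξ - η‖ : ℝ) : ℂ) * Complex.I) • crossL (f η) (g (ξ - η)) := by
    simp only [hwf, hwg, map_smul, smul_apply]
    rw [smul_smul, ← Complex.exp_add]
    congr 2
    push_cast; ring
  have hw : (2 * Real.pi * ‖ξ‖) ^ (-(1 / 2) : ℝ) = (√(2 * Real.pi))⁻¹ * (√‖ξ‖)⁻¹ := by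
    rw [Real.rpow_neg (by positivity), ← Real.sqrt_eq_rpow, Real.sqrt_mul (by positivity), mul_inv]
  have hs1 : √(2 * Real.pi) ≠ 0 := by positivity
  have hs2 : √‖ξ‖ ≠ 0 := by positivity
  simp only [formIntegrand, sobWeight, freeIntegrand]
  rw [hc, add_sub_cancel, hw, nullKernel, ← Complex.coe_smul (√‖ξ‖ * nullSymbol η (ξ - η)),
    smul_smul, smul_smul, smul_smul, smul_smul]
  congr 1
  have : (-(1 / (4 * Real.pi)) * nullSymbol η (ξ - η)) = (-√(2 * Real.pi) / (4 * Real.pi)) *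
      ((√(2 * Real.pi))⁻¹ * (√‖ξ‖)⁻¹) * (√‖ξ‖ * nullSymbol η (ξ - η)) := by
    field_simp
  rw [this]
  push_cast
  ring

/-- The bilinear space-time estimate for two free waves with annular data. -/
theorem IsAnnular.exists_curve (hf : IsAnnular δ R B f) (hg : IsAnnular δ R B g)
    {σ τ : ℝ} (hσ : σ = 1 ∨ σ = -1) (hτ : τ = 1 ∨ τ = -1) (T : ℝ) :
    ∃ M : Curve T, (∀ᵐ t ∂(volume.restrict (Icc 0 T)), ∀ φ : 𝓢(Plane, ℂ),
      nullForm φ (waveOp (σ * t) (hf.memLp.toLp f)) (waveOp (τ * t) (hg.memLp.toLp g)) =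
        pairing (sobWeight (1 / 2) φ) (M t)) ∧
      ‖M‖ ≤ 8 * ‖hf.memLp.toLp f‖ * ‖hg.memLp.toLp g‖ := by
  have hσ' : |σ| ≤ 1 := by rcases hσ with rfl | rfl <;> simp
  have hτ' : |τ| ≤ 1 := by rcases hτ with rfl | rfl <;> simp
  set c : ℝ := -√(2 * Real.pi) / (4 * Real.pi) with hc
  set N : ℝ → L2 := fun t => (c : ℂ) • (hf.memLp_freeForm hg hσ' hτ' t).toLp (freeForm σ τ f g t)
    with hN
  have hNc : Continuous N :=
    (continuous_const_smul (c : ℂ)).comp (hf.continuous_toLp_freeForm hg hσ' hτ')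
  have hNsq : ∀ t, ‖N t‖ₑ ^ 2 =
      ENNReal.ofReal (1 / (8 * Real.pi)) * ∫⁻ ξ, ‖freeForm σ τ f g t ξ‖ₑ ^ 2 := by
    intro t
    have h0 : ‖(c : ℂ)‖ₑ ^ 2 = ENNReal.ofReal (1 / (8 * Real.pi)) := by
      rw [← ofReal_norm, ← ENNReal.ofReal_pow (norm_nonneg _), Complex.norm_real,
        Real.norm_eq_abs, sq_abs, hc, div_pow, neg_sq, Real.sq_sqrt (by positivity)]
      congr 1
      field_simp
      norm_num
    simp only [hN]
    rw [enorm_smul, mul_pow, h0, L2_enorm_sq]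
    congr 1
    refine lintegral_congr_ae ?_
    filter_upwards [(hf.memLp_freeForm hg hσ' hτ' t).coeFn_toLp] with ξ h
    rw [h]
  have hbd : ∫⁻ t in Icc 0 T, ‖N t‖ₑ ^ 2 ≤
      (ENNReal.ofReal 8 * (‖hf.memLp.toLp f‖ₑ * ‖hg.memLp.toLp g‖ₑ)) ^ 2 := by
    have e1 : ‖hf.memLp.toLp f‖ₑ ^ 2 = ∫⁻ η, ‖f η‖ₑ ^ 2 := by
      rw [L2_enorm_sq]
      exact lintegral_congr_ae (hf.memLp.coeFn_toLp.mono fun ξ h => by simp only [h])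
    have e2 : ‖hg.memLp.toLp g‖ₑ ^ 2 = ∫⁻ η, ‖g η‖ₑ ^ 2 := by
      rw [L2_enorm_sq]
      exact lintegral_congr_ae (hg.memLp.coeFn_toLp.mono fun ξ h => by simp only [h])
    simp_rw [hNsq]
    rw [lintegral_const_mul' _ _ ENNReal.ofReal_ne_top, mul_pow, mul_pow, e1, e2]
    refine (mul_le_mul_right (hf.lintegral_freeForm_sq_le hg hσ hτ measurableSet_Icc
      (by simp)) _).trans ?_
    rw [← mul_assoc, ← ENNReal.ofReal_mul (by positivity), ← ENNReal.ofReal_pow (by norm_num)]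
    gcongr
    -- Here 128π²/(8π) = 16π ≤ 8², by π < 4.
    rw [one_div, inv_mul_eq_div, div_le_iff₀ (by positivity)]
    nlinarith [Real.pi_pos, Real.pi_lt_four]
  have hmem : MemLp N 2 (volume.restrict (Icc 0 T)) := by
    refine ⟨hNc.aestronglyMeasurable, ?_⟩
    rw [eLpNorm_lt_top_iff_lintegral_rpow_enorm_lt_top (by norm_num) (by norm_num)]
    simp only [ENNReal.toReal_ofNat, ENNReal.rpow_ofNat]
    exact hbd.trans_lt (ENNReal.pow_lt_top (ENNReal.mul_lt_top ENNReal.ofReal_lt_top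
      (ENNReal.mul_lt_top enorm_lt_top enorm_lt_top)))
  refine ⟨hmem.toLp N, ?_, ?_⟩
  · filter_upwards [hmem.coeFn_toLp] with t ht φ
    rw [ht]
    exact hf.nullForm_waveOp hg hσ' hτ' t φ
  · have h1 : ‖hmem.toLp N‖ₑ ^ 2 ≤
        (ENNReal.ofReal 8 * (‖hf.memLp.toLp f‖ₑ * ‖hg.memLp.toLp g‖ₑ)) ^ 2 := by
      rw [L2_enorm_sq, lintegral_congr_ae (g := fun t => ‖N t‖ₑ ^ 2)
        (hmem.coeFn_toLp.mono fun ξ h => by simp only [h])]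
      exact hbd
    rw [ENNReal.pow_le_pow_left_iff (by norm_num), ← ofReal_norm, ← ofReal_norm, ← ofReal_norm,
      ← ENNReal.ofReal_mul (by positivity), ← ENNReal.ofReal_mul (by positivity),
      ENNReal.ofReal_le_ofReal_iff (by positivity), ← mul_assoc] at h1
    exact h1

end FreeEstimate

/-! ### Extension of the bilinear estimate to arbitrary data -/

section Extension

variable {T : ℝ}

/-- The null form of the curves `a` and `b` is `(-Δ)^{-1/4}` of the curve `M`. -/
def IsNullFormCurve (T : ℝ) (a b : ℝ → L2) (M : Curve T) : Prop :=
  ∀ᵐ t ∂(volume.restrict (Icc 0 T)), ∀ φ : 𝓢(Plane, ℂ),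
    nullForm φ (a t) (b t) = pairing (sobWeight (1 / 2) φ) (M t)

theorem eq_of_forall_pairing_half {a b : L2}
    (h : ∀ φ : 𝓢(Plane, ℂ), pairing (sobWeight (1 / 2) φ) a = pairing (sobWeight (1 / 2) φ) b) :
    a = b := by
  rw [← sub_eq_zero]
  refine eq_zero_of_forall_pairing (s := 1 / 2) _ fun φ _ => ?_
  rw [← pairing_apply (memLp_sobWeight_half φ), map_sub, h φ, sub_self]

namespace IsNullFormCurve

variable {a a' b b' : ℝ → L2} {M M' : Curve T}

theorem unique (h : IsNullFormCurve T a b M) (h' : IsNullFormCurve T a b M') : M = M' := by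
  refine Lp.ext ?_
  filter_upwards [h, h'] with t h1 h2
  exact eq_of_forall_pairing_half fun φ => by rw [← h1, ← h2]

theorem congr (h : IsNullFormCurve T a b M) (ha : ∀ t ∈ Icc 0 T, a t = a' t)
    (hb : ∀ t ∈ Icc 0 T, b t = b' t) : IsNullFormCurve T a' b' M := by
  filter_upwards [h, ae_restrict_mem measurableSet_Icc] with t h1 ht φ
  rw [← ha t ht, ← hb t ht, h1]

theorem symm (h : IsNullFormCurve T a b M) : IsNullFormCurve T b a M := by
  filter_upwards [h] with t h1 φ
  rw [nullForm_swap, h1]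

theorem add_left (h : IsNullFormCurve T a b M) (h' : IsNullFormCurve T a' b M') :
    IsNullFormCurve T (a + a') b (M + M') := by
  filter_upwards [h, h', Lp.coeFn_add M M'] with t h1 h2 h3 φ
  rw [h3, Pi.add_apply, Pi.add_apply, map_add, map_add, add_apply, h1, h2]

theorem add_right (h : IsNullFormCurve T a b M) (h' : IsNullFormCurve T a b' M') :
    IsNullFormCurve T a (b + b') (M + M') :=
  (h.symm.add_left h'.symm).symm

theorem sub_left (h : IsNullFormCurve T a b M) (h' : IsNullFormCurve T a' b M') :
    IsNullFormCurve T (a - a') b (M - M') := by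
  filter_upwards [h, h', Lp.coeFn_sub M M'] with t h1 h2 h3 φ
  rw [h3, Pi.sub_apply, Pi.sub_apply, map_sub, map_sub, sub_apply, h1, h2]

/-- Convergence in L²([0,T];L²) gives convergence for almost every t only along a subsequence, which
is enough to identify the limit. -/
theorem of_tendsto {a : ℕ → ℝ → L2} {a₀ : ℝ → L2} {M : ℕ → Curve T} {M₀ : Curve T}
    (h : ∀ n, IsNullFormCurve T (a n) b (M n))
    (ha : ∀ t, Filter.Tendsto (fun n => a n t) Filter.atTop (nhds (a₀ t)))
    (hM : Filter.Tendsto M Filter.atTop (nhds M₀)) : IsNullFormCurve T a₀ b M₀ := by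
  obtain ⟨k, hk, hlim⟩ := (tendstoInMeasure_of_tendsto_Lp hM).exists_seq_tendsto_ae
  filter_upwards [hlim, ae_all_iff.2 h] with t h1 h2 φ
  have l1 := (((nullForm φ).flip (b t)).continuous.tendsto (a₀ t)).comp
    ((ha t).comp hk.tendsto_atTop)
  have l2 := ((pairing (sobWeight (1 / 2) φ)).continuous.tendsto (M₀ t)).comp h1
  refine tendsto_nhds_unique l1 (l2.congr fun n => ?_)
  simp only [Function.comp, ContinuousLinearMap.flip_apply]
  exact (h2 (k n) φ).symm

end IsNullFormCurve

/-- Extension of a bilinear estimate from a dense subgroup. -/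
theorem exists_nullFormCurve_of_dense {V : Type*} [NormedAddCommGroup V] (D : AddSubgroup V)
    (hD : Dense (D : Set V)) (L : ℝ → V →+ L2) {c C : ℝ} (hL : ∀ t v, ‖L t v‖ ≤ c * ‖v‖)
    {b : ℝ → L2}
    (h : ∀ v ∈ D, ∃ M, IsNullFormCurve T (fun t => L t v) b M ∧ ‖M‖ ≤ C * ‖v‖) (v : V) :
    ∃ M, IsNullFormCurve T (fun t => L t v) b M ∧ ‖M‖ ≤ C * ‖v‖ := by
  obtain ⟨w, hwD, hw⟩ := mem_closure_iff_seq_limit.1 (hD v)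
  choose M hM hMC using fun n => h (w n) (hwD n)
  have hd : ∀ n m, dist (M n) (M m) ≤ C * dist (w n) (w m) := fun n m => by
    -- The estimate is applied to the difference of the data. By uniqueness the curve obtained is M
    -- n - M m, so the curves form a Cauchy sequence.
    obtain ⟨N, hN, hNC⟩ := h (w n - w m) (D.sub_mem (hwD n) (hwD m))
    have := (hM n).sub_left (hM m)
    have e : (fun t => L t (w n)) - (fun t => L t (w m)) = fun t => L t (w n - w m) := by
      ext1 t; simp
    rw [e] at this
    rw [dist_eq_norm, dist_eq_norm, this.unique hN]
    exact hNC
  have hC : CauchySeq M := by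
    have hcw := hw.cauchySeq
    rw [cauchySeq_iff_tendsto_dist_atTop_0] at hcw ⊢
    have := hcw.const_mul C
    rw [mul_zero] at this
    exact squeeze_zero (fun _ => dist_nonneg) (fun p => hd p.1 p.2) this
  obtain ⟨M₀, hM₀⟩ := cauchySeq_tendsto_of_complete hC
  refine ⟨M₀, IsNullFormCurve.of_tendsto hM (fun t => ?_) hM₀,
    le_of_tendsto_of_tendsto hM₀.norm (hw.norm.const_mul C) (Filter.Eventually.of_forall hMC)⟩
  have hc : Continuous (L t) := AddMonoidHomClass.continuous_of_bound (L t) c (hL t)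
  exact (hc.tendsto v).comp hw

theorem IsAnnular.mono {δ R B δ' R' B' : ℝ} {f : Plane → C3} (hf : IsAnnular δ R B f)
    (hδ : 0 < δ') (h1 : δ' ≤ δ) (h2 : R ≤ R') (h3 : B ≤ B') : IsAnnular δ' R' B' f :=
  ⟨hδ, hf.radius_nonneg.trans h2, hf.bound_nonneg.trans h3, hf.meas,
    fun ξ => (hf.bound ξ).trans h3, fun ξ h => ⟨h1.trans (hf.support_le ξ h).1,
      (hf.support_le ξ h).2.trans h2⟩⟩

/-- The classes of bounded functions supported in an annulus. -/
def annularSubgroup : AddSubgroup L2 where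
  carrier := {a | ∃ δ R B f, IsAnnular δ R B f ∧ a =ᵐ[volume] f}
  zero_mem' := ⟨1, 1, 1, 0, ⟨one_pos, zero_le_one, zero_le_one, stronglyMeasurable_zero,
    fun ξ => by simp, fun ξ h => absurd rfl h⟩, Lp.coeFn_zero _ _ _⟩
  add_mem' := by
    rintro a b ⟨δ, R, B, f, hf, ha⟩ ⟨δ', R', B', g, hg, hb⟩
    have hδ : 0 < min δ δ' := lt_min hf.pos hg.pos
    have hf' := hf.mono (R' := max R R') (B' := B) hδ (min_le_left _ _) (le_max_left _ _) le_rfl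
    have hg' := hg.mono (R' := max R R') (B' := B') hδ (min_le_right _ _) (le_max_right _ _) le_rfl
    refine ⟨min δ δ', max R R', B + B', f + g, ⟨hδ, hf'.radius_nonneg,
      add_nonneg hf.bound_nonneg hg.bound_nonneg, hf.meas.add hg.meas,
      fun ξ => (norm_add_le _ _).trans (add_le_add (hf.bound ξ) (hg.bound ξ)), fun ξ h => ?_⟩, ?_⟩
    · by_cases h1 : f ξ = 0
      · exact hg'.support_le ξ fun h2 => h (by rw [Pi.add_apply, h1, h2, add_zero])
      · exact hf'.support_le ξ h1
    · exact (Lp.coeFn_add a b).trans (ha.add hb)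
  neg_mem' := by
    rintro a ⟨δ, R, B, f, hf, ha⟩
    refine ⟨δ, R, B, -f, ⟨hf.pos, hf.radius_nonneg, hf.bound_nonneg, hf.meas.neg,
      fun ξ => by rw [Pi.neg_apply, norm_neg]; exact hf.bound ξ, fun ξ h => hf.support_le ξ ?_⟩,
      (Lp.coeFn_neg a).trans ha.neg⟩
    exact fun h0 => h (by rw [Pi.neg_apply, h0, neg_zero])

/-- Truncation to 1/(n+1) ≤ |ξ| ≤ n and |a| ≤ n. The symbols converge to the indicator of the
punctured plane, which acts as the identity because a point is null. -/
theorem dense_annularSubgroup : Dense (annularSubgroup : Set L2) := by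
  intro a
  rw [mem_closure_iff_seq_limit]
  have ham := Lp.stronglyMeasurable a
  set S : ℕ → Set Plane := fun n => {ξ | ((n : ℝ) + 1)⁻¹ ≤ ‖ξ‖ ∧ ‖ξ‖ ≤ n ∧ ‖a ξ‖ ≤ n} with hS
  have hSm : ∀ n, MeasurableSet (S n) := fun n =>
    (measurableSet_le measurable_const measurable_norm).inter
      ((measurableSet_le measurable_norm measurable_const).inter
        (measurableSet_le ham.norm.measurable measurable_const))
  set m : ℕ → Plane → ℂ := fun n => (S n).indicator 1 with hm
  have hmb : ∀ n ξ, ‖m n ξ‖ ≤ 1 := fun n ξ => by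
    simp only [hm, indicator_apply]; split_ifs <;> simp
  have hmm : ∀ n, MemLp (m n) ∞ (volume : Measure Plane) := fun n =>
    memLp_top_of_bound ((measurable_const.indicator (hSm n)).aestronglyMeasurable) 1
      (Filter.Eventually.of_forall (hmb n))
  set m₀ : Plane → ℂ := ({0}ᶜ : Set Plane).indicator 1 with hm₀
  have hmb₀ : ∀ ξ, ‖m₀ ξ‖ ≤ 1 := fun ξ => by
    simp only [hm₀, indicator_apply]; split_ifs <;> simp
  have hmm₀ : MemLp m₀ ∞ (volume : Measure Plane) :=
    memLp_top_of_bound ((measurable_const.indicator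
      (measurableSet_singleton _).compl).aestronglyMeasurable) 1 (Filter.Eventually.of_forall hmb₀)
  have h0 : mulOp m₀ a = a := by
    refine Lp.ext ?_
    filter_upwards [mulOp_coe hmm₀ a, compl_mem_ae_iff.2 (measure_singleton (0 : Plane))]
      with ξ h1 h2
    rw [h1, hm₀, indicator_of_mem h2, Pi.one_apply, one_smul]
  refine ⟨fun n => mulOp (m n) a, fun n => ⟨((n : ℝ) + 1)⁻¹, n, n, fun ξ => m n ξ • a ξ,
    ⟨by positivity, by positivity, by positivity, ?_, fun ξ => ?_, fun ξ h => ?_⟩,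
    mulOp_coe (hmm n) a⟩, ?_⟩
  · have h1 : StronglyMeasurable (m n) :=
      (stronglyMeasurable_const (b := (1 : ℂ))).indicator (hSm n)
    exact h1.smul ham
  · by_cases h : ξ ∈ S n
    · simp only [hm, indicator_of_mem h, Pi.one_apply, one_smul]; exact h.2.2
    · simp [hm, indicator_of_notMem h]
  · have : ξ ∈ S n := by
      by_contra hn
      exact h (by simp [hm, indicator_of_notMem hn])
    exact ⟨this.1, this.2.1⟩
  · have := tendsto_mulOp (l := Filter.atTop) hmm hmm₀ (Filter.Eventually.of_forall hmb) hmb₀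
      (fun ξ => ?_) a
    · rwa [h0] at this
    by_cases hξ : ξ = 0
    · have : ∀ n, m n ξ = m₀ ξ := fun n => by
        rw [hm₀, indicator_of_notMem (by simp [hξ])]
        refine indicator_of_notMem (fun h => ?_) _
        have h2 := h.1
        rw [hξ, norm_zero] at h2
        exact absurd h2 (not_le.2 (by positivity))
      simp only [this]
      exact tendsto_const_nhds
    · have hp : 0 < ‖ξ‖ := norm_pos_iff.2 hξ
      obtain ⟨N, hN⟩ := exists_nat_ge (‖ξ‖⁻¹ + ‖ξ‖ + ‖a ξ‖)
      have h1 := norm_nonneg (a ξ)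
      have h2 := inv_pos.2 hp
      refine tendsto_const_nhds.congr' ?_
      filter_upwards [Filter.eventually_ge_atTop N] with n hn
      have hn' : (N : ℝ) ≤ n := by exact_mod_cast hn
      rw [hm₀, indicator_of_mem (by simpa using hξ)]
      have hmem : ξ ∈ S n := ⟨inv_le_of_inv_le₀ hp (by linarith), by linarith, by linarith⟩
      exact (indicator_of_mem hmem (1 : Plane → ℂ)).symm

/-- The density argument is run in one factor at a time; the symmetry of the null form lets the same
lemma serve both. -/
theorem exists_nullFormCurve_free {σ τ : ℝ} (hσ : σ = 1 ∨ σ = -1) (hτ : τ = 1 ∨ τ = -1)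
    (a b : L2) : ∃ M : Curve T,
      IsNullFormCurve T (fun t => waveOp (σ * t) a) (fun t => waveOp (τ * t) b) M ∧
      ‖M‖ ≤ 8 * ‖b‖ * ‖a‖ := by
  have hL : ∀ (ρ t : ℝ) (v : L2), ‖(waveOp (ρ * t)).toLinearMap.toAddMonoidHom v‖ ≤ 1 * ‖v‖ :=
    fun ρ t v => (norm_waveOp_le _ v).trans_eq (one_mul _).symm
  refine exists_nullFormCurve_of_dense annularSubgroup dense_annularSubgroup
    (fun t => (waveOp (σ * t)).toLinearMap.toAddMonoidHom) (hL σ) (fun a ha => ?_) a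
  suffices h : ∃ M : Curve T,
      IsNullFormCurve T (fun t => waveOp (τ * t) b) (fun t => waveOp (σ * t) a) M ∧
      ‖M‖ ≤ 8 * ‖a‖ * ‖b‖ by
    obtain ⟨M, h1, h2⟩ := h
    exact ⟨M, h1.symm, h2.trans_eq (by ring)⟩
  refine exists_nullFormCurve_of_dense annularSubgroup dense_annularSubgroup
    (fun t => (waveOp (τ * t)).toLinearMap.toAddMonoidHom) (hL τ) (fun b hb => ?_) b
  obtain ⟨δ, R, B, f, hf, haf⟩ := ha
  obtain ⟨δ', R', B', g, hg, hbg⟩ := hb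
  have hδ : 0 < min δ δ' := lt_min hf.pos hg.pos
  have hf' := hf.mono (R' := max R R') (B' := max B B') hδ (min_le_left _ _) (le_max_left _ _)
    (le_max_left _ _)
  have hg' := hg.mono (R' := max R R') (B' := max B B') hδ (min_le_right _ _) (le_max_right _ _)
    (le_max_right _ _)
  obtain ⟨M, h1, h2⟩ := hf'.exists_curve hg' hσ hτ T
  have ea : hf'.memLp.toLp f = a := Lp.ext (hf'.memLp.coeFn_toLp.trans haf.symm)
  have eb : hg'.memLp.toLp g = b := Lp.ext (hg'.memLp.coeFn_toLp.trans hbg.symm)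
  rw [ea, eb] at h1 h2
  exact ⟨M, IsNullFormCurve.symm h1, h2⟩

end Extension

/-! ### Transfer of the estimate to forced waves -/

section Duhamel

variable {T : ℝ}

theorem integrable_curve (h : Curve T) : Integrable h (volume.restrict (Icc 0 T)) :=
  (Lp.memLp h).integrable (by norm_num)

/-- Cauchy-Schwarz in time; the factor √T makes the forcing a small perturbation. -/
theorem integral_norm_curve_le (hT : 0 ≤ T) (h : Curve T) :
    ∫ s in Icc 0 T, ‖h s‖ ≤ √T * ‖h‖ := by
  have h1 := lintegral_mul_sq_le (volume.restrict (Icc 0 T)) (f := fun s => ‖h s‖ₑ) (g := fun _ => 1)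
    (Lp.aestronglyMeasurable h).enorm aemeasurable_const
  simp only [mul_one, one_pow, lintegral_const, one_mul, ← L2_enorm_sq] at h1
  rw [Measure.restrict_apply_univ, Real.volume_Icc, sub_zero, ← ofReal_norm,
    ← ofReal_integral_norm_eq_lintegral_enorm (integrable_curve h),
    ← ENNReal.ofReal_pow (integral_nonneg fun _ => norm_nonneg _),
    ← ENNReal.ofReal_pow (norm_nonneg _), ← ENNReal.ofReal_mul (by positivity),
    ENNReal.ofReal_le_ofReal_iff (by positivity)] at h1
  refine abs_le_of_sq_le_sq' (h1.trans_eq ?_) (by positivity) |>.2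
  rw [mul_pow, Real.sq_sqrt hT, mul_comm]

/-- The primitive `t ↦ ∫₀ᵗ h`. -/
def primitive (t : ℝ) : Curve T →+ L2 where
  toFun h := ∫ s in Iic t, h s ∂(volume.restrict (Icc 0 T))
  map_zero' := by
    rw [integral_congr_ae (ae_restrict_of_ae (Lp.coeFn_zero L2 2 (volume.restrict (Icc 0 T))))]
    simp
  map_add' h h' := by
    rw [integral_congr_ae (ae_restrict_of_ae (Lp.coeFn_add h h'))]
    exact integral_add (integrable_curve h).integrableOn (integrable_curve h').integrableOn

theorem primitive_apply (t : ℝ) (h : Curve T) :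
    primitive t h = ∫ s in Iic t, h s ∂(volume.restrict (Icc 0 T)) := rfl

theorem primitive_eq_intervalIntegral {t : ℝ} (ht : t ∈ Icc 0 T) (h : Curve T) :
    primitive t h = ∫ s in (0 : ℝ)..t, h s := by
  rw [primitive_apply, Measure.restrict_restrict measurableSet_Iic, intervalIntegral.integral_of_le
    ht.1, ← integral_Icc_eq_integral_Ioc]
  congr 2
  ext s
  simp only [mem_inter_iff, mem_Iic, mem_Icc]
  exact ⟨fun h => ⟨h.2.1, h.1⟩, fun h => ⟨h.2, h.1, h.2.trans ht.2⟩⟩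

theorem norm_primitive_le (t : ℝ) (h : Curve T) : ‖primitive t h‖ ≤ ∫ s in Icc 0 T, ‖h s‖ := by
  rw [primitive_apply]
  exact (norm_integral_le_integral_norm _).trans (setIntegral_le_integral (integrable_curve h).norm
    (Filter.Eventually.of_forall fun _ => norm_nonneg _))

theorem intervalIntegrable_curve (h : Curve T) {t : ℝ} (ht : t ∈ Icc 0 T) :
    IntervalIntegrable h volume 0 t := by
  rw [intervalIntegrable_iff_integrableOn_Icc_of_le ht.1]
  exact IntegrableOn.mono_set (integrable_curve h) (Icc_subset_Icc_right ht.2)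

theorem continuousOn_primitive (h : Curve T) :
    ContinuousOn (fun t => primitive t h) (Icc 0 T) := by
  rcases le_or_gt 0 T with hT | hT
  · have h1 : ContinuousOn (fun t => ∫ s in (0 : ℝ)..t, h s) (Icc 0 T) := by
      have := intervalIntegral.continuousOn_primitive_interval (a := 0) (b := T) (f := h)
        (μ := volume) (by rw [uIcc_of_le hT]; exact integrable_curve h)
      rwa [uIcc_of_le hT] at this
    exact h1.congr fun t ht => primitive_eq_intervalIntegral ht h
  · exact fun t ht => absurd (ht.1.trans ht.2) (not_le.2 hT)

/-- The curve `s ↦ e^{iρsr} h(s)`. -/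
theorem memLp_twist (ρ : ℝ) (h : Curve T) :
    MemLp (fun s => waveOp (ρ * s) (h s)) 2 (volume.restrict (Icc 0 T)) := by
  have h1 : AEStronglyMeasurable (fun s : ℝ => ρ * s) (volume.restrict (Icc 0 T)) :=
    (continuous_const_mul ρ).aestronglyMeasurable
  have h2 := continuous_waveOp.comp_aestronglyMeasurable (h1.prodMk (Lp.aestronglyMeasurable h))
  have h3 : ∀ s, ‖waveOp (ρ * s) (h s)‖ ≤ ‖h s‖ := fun s => norm_waveOp_le _ _
  exact (Lp.memLp h).of_le h2 (Filter.Eventually.of_forall h3)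

/-- The curve `s ↦ e^{iρsr} h(s)`. -/
def twist (ρ : ℝ) (h : Curve T) : Curve T := (memLp_twist ρ h).toLp

theorem twist_coe (ρ : ℝ) (h : Curve T) :
    twist ρ h =ᵐ[volume.restrict (Icc 0 T)] fun s => waveOp (ρ * s) (h s) :=
  (memLp_twist ρ h).coeFn_toLp

theorem norm_twist_le (ρ : ℝ) (h : Curve T) : ‖twist ρ h‖ ≤ ‖h‖ := by
  refine Lp.norm_le_norm_of_ae_le ?_
  filter_upwards [twist_coe ρ h] with s hs
  rw [hs]; exact norm_waveOp_le _ _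

theorem twist_add (ρ : ℝ) (h h' : Curve T) : twist ρ (h + h') = twist ρ h + twist ρ h' := by
  refine Lp.ext ?_
  filter_upwards [twist_coe ρ (h + h'), twist_coe ρ h, twist_coe ρ h', Lp.coeFn_add h h',
    Lp.coeFn_add (twist ρ h) (twist ρ h')] with s h1 h2 h3 h4 h5
  rw [h5, Pi.add_apply, h1, h2, h3, h4, Pi.add_apply, map_add]

theorem real_smul_L2 (r : ℝ) (c : L2) : r • c = (r : ℂ) • c := (algebraMap_smul ℂ r c).symm

theorem exists_smul_curve {θ : ℝ → ℝ} (hθ : Measurable θ) {B : ℝ} (h0 : ∀ t, 0 ≤ θ t)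
    (hB : ∀ t, θ t ≤ B) (M : Curve T) : ∃ N : Curve T,
      (∀ᵐ t ∂(volume.restrict (Icc 0 T)), N t = (θ t : ℂ) • M t) ∧ ‖N‖ ≤ B * ‖M‖ := by
  have hb : ∀ t, ‖(θ t : ℂ) • M t‖ ≤ B * ‖M t‖ := fun t => by
    rw [norm_smul, Complex.norm_real, Real.norm_of_nonneg (h0 t)]
    gcongr; exact hB t
  have hm : Measurable fun t => (θ t : ℂ) := Complex.measurable_ofReal.comp hθ
  have hm' : AEStronglyMeasurable (fun t => (θ t : ℂ) • M t) (volume.restrict (Icc 0 T)) :=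
    hm.aestronglyMeasurable.smul (Lp.aestronglyMeasurable M)
  have hmem : MemLp (fun t => (θ t : ℂ) • M t) 2 (volume.restrict (Icc 0 T)) :=
    (Lp.memLp M).of_le_mul hm' (Filter.Eventually.of_forall hb)
  refine ⟨hmem.toLp, hmem.coeFn_toLp, Lp.norm_le_mul_norm_of_ae_le_mul ?_⟩
  filter_upwards [hmem.coeFn_toLp] with t ht
  rw [ht]; exact hb t

/-- The primitive of 1_A c is θ(t)c with the scalar θ(t) = |A ∩ [0,t]| ≤ |A|. It factors out of the
null form at each time, so the cost is |A|‖c‖, the L¹ norm in time of the forcing. -/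
theorem exists_nullFormCurve_indicator {σ C : ℝ} {b : ℝ → L2} {c : L2} {M : Curve T}
    (hM : IsNullFormCurve T (fun t => waveOp (σ * t) c) b M) (hMC : ‖M‖ ≤ C * ‖c‖)
    {A : Set ℝ} (hA : MeasurableSet A) (hμ : (volume.restrict (Icc (0 : ℝ) T)) A ≠ ∞) :
    ∃ N : Curve T,
      IsNullFormCurve T (fun t => waveOp (σ * t) (primitive t (indicatorConstLp 2 hA hμ c))) b N ∧
      ‖N‖ ≤ C * ∫ s in Icc 0 T, ‖indicatorConstLp 2 hA hμ c s‖ := by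
  have hθmono : Monotone fun t => ((volume.restrict (Icc (0 : ℝ) T)).restrict (Iic t)).real A :=
    fun t t' htt' => ENNReal.toReal_mono (measure_ne_top _ _)
      (Measure.restrict_mono (Iic_subset_Iic.2 htt') le_rfl A)
  obtain ⟨N, hN, hNM⟩ := exists_smul_curve hθmono.measurable (fun t => measureReal_nonneg)
    (fun t => ENNReal.toReal_mono (measure_ne_top _ _) (Measure.restrict_le_self A)) M
  have hcoe : ∀ t, primitive t (indicatorConstLp 2 hA hμ c) =
      ((((volume.restrict (Icc (0 : ℝ) T)).restrict (Iic t)).real A : ℝ) : ℂ) • c := fun t => by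
    rw [primitive_apply, integral_congr_ae (ae_restrict_of_ae indicatorConstLp_coeFn),
      integral_indicator_const c hA, real_smul_L2]
  refine ⟨N, ?_, ?_⟩
  · filter_upwards [hM, hN] with t h1 h2 φ
    rw [h2, hcoe, map_smul, map_smul, map_smul, smul_apply, h1]
  · have h1 : ∀ᵐ s ∂(volume.restrict (Icc (0 : ℝ) T)),
        ‖indicatorConstLp 2 hA hμ c s‖ = A.indicator (fun _ => ‖c‖) s := by
      filter_upwards [indicatorConstLp_coeFn (p := 2) (hs := hA) (hμs := hμ) (c := c)] with s hs
      rw [hs, norm_indicator_eq_indicator_norm]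
    rw [integral_congr_ae h1, integral_indicator_const _ hA, smul_eq_mul]
    calc _ ≤ _ := hNM
      _ ≤ (volume.restrict (Icc (0 : ℝ) T)).real A * (C * ‖c‖) := by
        exact mul_le_mul_of_nonneg_left hMC measureReal_nonneg
      _ = _ := by ring

/-- The bound is in the L¹ norm in time because that norm is additive over disjoint supports, as the
induction on simple functions requires. -/
theorem exists_nullFormCurve_primitive_simple {σ C : ℝ} {b : ℝ → L2}
    (hb : ∀ c : L2, ∃ M : Curve T, IsNullFormCurve T (fun t => waveOp (σ * t) c) b M ∧
      ‖M‖ ≤ C * ‖c‖) (h : Lp.simpleFunc L2 2 (volume.restrict (Icc (0 : ℝ) T))) :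
    ∃ M : Curve T, IsNullFormCurve T (fun t => waveOp (σ * t) (primitive t (h : Curve T))) b M ∧
      ‖M‖ ≤ C * ∫ s in Icc 0 T, ‖(h : Curve T) s‖ := by
  refine Lp.simpleFunc.induction (P := fun h => ∃ M : Curve T,
    IsNullFormCurve T (fun t => waveOp (σ * t) (primitive t (h : Curve T))) b M ∧
      ‖M‖ ≤ C * ∫ s in Icc 0 T, ‖(h : Curve T) s‖) (by norm_num) (by norm_num) ?_ ?_ h
  · intro c A hA hμ
    obtain ⟨M, hM, hMC⟩ := hb c
    exact exists_nullFormCurve_indicator hM hMC hA hμ.ne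
  · rintro f g hf hg hd ⟨M, hM, hMC⟩ ⟨N, hN, hNC⟩
    have ec : ((SimpleFunc.toLp f hf + SimpleFunc.toLp g hg :
        Lp.simpleFunc L2 2 (volume.restrict (Icc (0 : ℝ) T))) : Curve T) =
        (SimpleFunc.toLp f hf : Curve T) + (SimpleFunc.toLp g hg : Curve T) := rfl
    refine ⟨M + N, ?_, ?_⟩
    · refine (hM.add_left hN).congr (fun t _ => ?_) fun _ _ => rfl
      rw [Pi.add_apply, ec, map_add, map_add]
    · have e : ∫ s in Icc 0 T, ‖((SimpleFunc.toLp f hf + SimpleFunc.toLp g hg :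
          Lp.simpleFunc L2 2 (volume.restrict (Icc (0 : ℝ) T))) : Curve T) s‖ =
          (∫ s in Icc 0 T, ‖(SimpleFunc.toLp f hf : Curve T) s‖) +
            ∫ s in Icc 0 T, ‖(SimpleFunc.toLp g hg : Curve T) s‖ := by
        rw [← integral_add (integrable_curve _).norm (integrable_curve _).norm]
        refine integral_congr_ae ?_
        have hf' : (SimpleFunc.toLp f hf : Curve T) =ᵐ[volume.restrict (Icc (0 : ℝ) T)] f :=
          hf.coeFn_toLp
        have hg' : (SimpleFunc.toLp g hg : Curve T) =ᵐ[volume.restrict (Icc (0 : ℝ) T)] g :=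
          hg.coeFn_toLp
        rw [ec]
        filter_upwards [Lp.coeFn_add (SimpleFunc.toLp f hf : Curve T)
          (SimpleFunc.toLp g hg : Curve T), hf', hg'] with s h1 h2 h3
        rw [h1, Pi.add_apply, h2, h3]
        by_cases hs : f s = 0
        · simp [hs]
        · have : g s = 0 := by
            by_contra h0
            exact Set.disjoint_left.1 hd hs h0
          simp [this]
      rw [e, mul_add]
      exact (norm_add_le _ _).trans (add_le_add hMC hNC)

/-- Only an estimate for free waves in the first slot is assumed, for a fixed curve b in the second.
Simple forcings are dense in L², and √T‖h‖ dominates their L¹ norm. -/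
theorem exists_nullFormCurve_primitive (hT : 0 ≤ T) {σ C : ℝ} (hC : 0 ≤ C) {b : ℝ → L2}
    (hb : ∀ c : L2, ∃ M : Curve T, IsNullFormCurve T (fun t => waveOp (σ * t) c) b M ∧
      ‖M‖ ≤ C * ‖c‖) (c : L2) (h : Curve T) :
    ∃ M : Curve T, IsNullFormCurve T (fun t => waveOp (σ * t) (c + primitive t h)) b M ∧
      ‖M‖ ≤ C * (‖c‖ + √T * ‖h‖) := by
  obtain ⟨M, hM, hMC⟩ := hb c
  obtain ⟨N, hN, hNC⟩ : ∃ N : Curve T,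
      IsNullFormCurve T (fun t => waveOp (σ * t) (primitive t h)) b N ∧ ‖N‖ ≤ C * √T * ‖h‖ := by
    refine exists_nullFormCurve_of_dense (Lp.simpleFunc L2 2 (volume.restrict (Icc (0 : ℝ) T)))
      (Lp.simpleFunc.dense (by norm_num))
      (fun t => ((waveOp (σ * t)).toLinearMap.toAddMonoidHom).comp (primitive t)) (c := √T)
      (fun t v => (norm_waveOp_le _ _).trans ((norm_primitive_le t v).trans
        (integral_norm_curve_le hT v))) (fun v hv => ?_) h
    obtain ⟨N, h1, h2⟩ := exists_nullFormCurve_primitive_simple hb ⟨v, hv⟩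
    refine ⟨N, h1, h2.trans ?_⟩
    rw [mul_assoc]
    gcongr
    exact integral_norm_curve_le hT v
  refine ⟨M + N, (hM.add_left hN).congr (fun t _ => ?_) fun _ _ => rfl, ?_⟩
  · simp only [Pi.add_apply, map_add]
  · calc _ ≤ ‖M‖ + ‖N‖ := norm_add_le _ _
      _ ≤ C * ‖c‖ + C * √T * ‖h‖ := add_le_add hMC hNC
      _ = _ := by ring

/-- The transfer is applied twice: first against a free wave in the other slot, then, after
swapping, against the forced wave just treated. -/
theorem exists_nullFormCurve_two_primitives (hT : 0 ≤ T) {σ τ : ℝ} (hσ : σ = 1 ∨ σ = -1)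
    (hτ : τ = 1 ∨ τ = -1) (c c' : L2) (h h' : Curve T) :
    ∃ M : Curve T, IsNullFormCurve T (fun t => waveOp (σ * t) (c + primitive t h))
      (fun t => waveOp (τ * t) (c' + primitive t h')) M ∧
      ‖M‖ ≤ 8 * (‖c‖ + √T * ‖h‖) * (‖c'‖ + √T * ‖h'‖) := by
  have hb : ∀ c' : L2, ∃ M : Curve T, IsNullFormCurve T (fun t => waveOp (τ * t) c')
      (fun t => waveOp (σ * t) (c + primitive t h)) M ∧
      ‖M‖ ≤ 8 * (‖c‖ + √T * ‖h‖) * ‖c'‖ := fun c' => by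
    obtain ⟨N, h1, h2⟩ := exists_nullFormCurve_primitive hT (σ := σ) (C := 8 * ‖c'‖)
      (b := fun t => waveOp (τ * t) c') (by positivity)
      (fun c => exists_nullFormCurve_free hσ hτ c c') c h
    exact ⟨N, h1.symm, h2.trans_eq (by ring)⟩
  obtain ⟨M, h1, h2⟩ := exists_nullFormCurve_primitive hT (by positivity) hb c' h'
  exact ⟨M, h1.symm, h2⟩

end Duhamel

/-! ### State and velocity of a forced wave -/

section State

variable {T : ℝ}

/-- The coefficient of `e^{itr}` in the solution of the wave equation. -/
def halfWavePos (g₀ g₁ : L2) (G : Curve T) (t : ℝ) : L2 :=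
  ((1 / 2 : ℂ) • g₀ - (Complex.I / 2) • g₁) + primitive t (Complex.I • twist (-1) G)

/-- The coefficient of `e^{-itr}` in the solution of the wave equation. -/
def halfWaveNeg (g₀ g₁ : L2) (G : Curve T) (t : ℝ) : L2 :=
  ((1 / 2 : ℂ) • g₀ + (Complex.I / 2) • g₁) + primitive t (-Complex.I • twist 1 G)

/-- `cos(tr) g₀ + sin(tr) g₁ - 2 ∫₀ᵗ sin((t-s)r) G(s) ds`. -/
def stateCurve (g₀ g₁ : L2) (G : Curve T) (t : ℝ) : L2 :=
  waveOp (1 * t) (halfWavePos g₀ g₁ G t) + waveOp (-1 * t) (halfWaveNeg g₀ g₁ G t)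

/-- `-sin(tr) g₀ + cos(tr) g₁ - 2 ∫₀ᵗ cos((t-s)r) G(s) ds`. -/
def velocityCurve (g₀ g₁ : L2) (G : Curve T) (t : ℝ) : L2 :=
  Complex.I • (waveOp (1 * t) (halfWavePos g₀ g₁ G t) - waveOp (-1 * t) (halfWaveNeg g₀ g₁ G t))

/-- The size of the data and the forcing. -/
def stateSize (g₀ g₁ : L2) (G : Curve T) : ℝ := ‖g₀‖ + ‖g₁‖ + 2 * √T * ‖G‖

theorem norm_data_comb_le (g₀ g₁ : L2) :
    ‖(1 / 2 : ℂ) • g₀ - (Complex.I / 2) • g₁‖ ≤ (‖g₀‖ + ‖g₁‖) / 2 ∧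
    ‖(1 / 2 : ℂ) • g₀ + (Complex.I / 2) • g₁‖ ≤ (‖g₀‖ + ‖g₁‖) / 2 := by
  have h1 : ‖(1 / 2 : ℂ) • g₀‖ = ‖g₀‖ / 2 := by rw [norm_smul]; norm_num; ring
  have h2 : ‖(Complex.I / 2) • g₁‖ = ‖g₁‖ / 2 := by rw [norm_smul]; norm_num; ring
  constructor
  · exact (norm_sub_le _ _).trans (by rw [h1, h2]; linarith)
  · exact (norm_add_le _ _).trans (by rw [h1, h2]; linarith)

theorem norm_force_le (G : Curve T) :
    ‖Complex.I • twist (-1) G‖ ≤ ‖G‖ ∧ ‖-Complex.I • twist 1 G‖ ≤ ‖G‖ := by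
  rw [norm_smul, norm_smul, norm_neg, Complex.norm_I, one_mul, one_mul]
  exact ⟨norm_twist_le _ _, norm_twist_le _ _⟩

theorem norm_halfWave_le (hT : 0 ≤ T) (g₀ g₁ : L2) (G : Curve T) (t : ℝ) :
    ‖halfWavePos g₀ g₁ G t‖ ≤ stateSize g₀ g₁ G / 2 ∧
    ‖halfWaveNeg g₀ g₁ G t‖ ≤ stateSize g₀ g₁ G / 2 := by
  obtain ⟨d1, d2⟩ := norm_data_comb_le g₀ g₁
  obtain ⟨f1, f2⟩ := norm_force_le G
  have hp : ∀ h : Curve T, ‖h‖ ≤ ‖G‖ → ‖primitive t h‖ ≤ √T * ‖G‖ := fun h hh =>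
    (norm_primitive_le t h).trans ((integral_norm_curve_le hT h).trans (by gcongr))
  constructor
  · refine (norm_add_le _ _).trans ((add_le_add d1 (hp _ f1)).trans_eq ?_)
    rw [stateSize]; ring
  · refine (norm_add_le _ _).trans ((add_le_add d2 (hp _ f2)).trans_eq ?_)
    rw [stateSize]; ring

theorem norm_stateCurve_le (hT : 0 ≤ T) (g₀ g₁ : L2) (G : Curve T) (t : ℝ) :
    ‖stateCurve g₀ g₁ G t‖ ≤ stateSize g₀ g₁ G := by
  obtain ⟨h1, h2⟩ := norm_halfWave_le hT g₀ g₁ G t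
  refine (norm_add_le _ _).trans ?_
  rw [norm_waveOp, norm_waveOp]; linarith

theorem norm_velocityCurve_le (hT : 0 ≤ T) (g₀ g₁ : L2) (G : Curve T) (t : ℝ) :
    ‖velocityCurve g₀ g₁ G t‖ ≤ stateSize g₀ g₁ G := by
  obtain ⟨h1, h2⟩ := norm_halfWave_le hT g₀ g₁ G t
  rw [velocityCurve, norm_smul, Complex.norm_I, one_mul]
  refine (norm_sub_le _ _).trans ?_
  rw [norm_waveOp, norm_waveOp]; linarith

theorem continuousOn_halfWaves (g₀ g₁ : L2) (G : Curve T) :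
    ContinuousOn (fun t => waveOp (1 * t) (halfWavePos g₀ g₁ G t)) (Icc 0 T) ∧
    ContinuousOn (fun t => waveOp (-1 * t) (halfWaveNeg g₀ g₁ G t)) (Icc 0 T) := by
  have h : ∀ (ρ : ℝ) (f : ℝ → L2), ContinuousOn f (Icc 0 T) →
      ContinuousOn (fun t => waveOp (ρ * t) (f t)) (Icc 0 T) := fun ρ f hf => by
    have h1 : ContinuousOn (fun t : ℝ => ρ * t) (Icc 0 T) := (continuous_const_mul ρ).continuousOn
    have h2 := continuous_waveOp.comp_continuousOn (h1.prodMk hf)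
    exact h2
  have h1 : ContinuousOn (halfWavePos g₀ g₁ G) (Icc 0 T) :=
    ContinuousOn.add continuousOn_const (continuousOn_primitive _)
  have h2 : ContinuousOn (halfWaveNeg g₀ g₁ G) (Icc 0 T) :=
    ContinuousOn.add continuousOn_const (continuousOn_primitive _)
  exact ⟨h 1 _ h1, h (-1) _ h2⟩

theorem continuousOn_stateCurve (g₀ g₁ : L2) (G : Curve T) :
    ContinuousOn (stateCurve g₀ g₁ G) (Icc 0 T) :=
  (continuousOn_halfWaves g₀ g₁ G).1.add (continuousOn_halfWaves g₀ g₁ G).2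

theorem continuousOn_velocityCurve (g₀ g₁ : L2) (G : Curve T) :
    ContinuousOn (velocityCurve g₀ g₁ G) (Icc 0 T) :=
  (continuous_const_smul Complex.I).comp_continuousOn
    ((continuousOn_halfWaves g₀ g₁ G).1.sub (continuousOn_halfWaves g₀ g₁ G).2)

theorem halfWavePos_sub (g₀ g₁ g₀' g₁' : L2) (G G' : Curve T) (t : ℝ) :
    halfWavePos (g₀ - g₀') (g₁ - g₁') (G - G') t =
      halfWavePos g₀ g₁ G t - halfWavePos g₀' g₁' G' t := by
  have h := twist_add (-1) (G - G') G'
  rw [sub_add_cancel] at h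
  rw [halfWavePos, halfWavePos, halfWavePos, h, smul_add, map_add]
  module

theorem halfWaveNeg_sub (g₀ g₁ g₀' g₁' : L2) (G G' : Curve T) (t : ℝ) :
    halfWaveNeg (g₀ - g₀') (g₁ - g₁') (G - G') t =
      halfWaveNeg g₀ g₁ G t - halfWaveNeg g₀' g₁' G' t := by
  have h := twist_add 1 (G - G') G'
  rw [sub_add_cancel] at h
  rw [halfWaveNeg, halfWaveNeg, halfWaveNeg, h, smul_add, map_add]
  module

theorem stateCurve_sub (g₀ g₁ g₀' g₁' : L2) (G G' : Curve T) (t : ℝ) :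
    stateCurve (g₀ - g₀') (g₁ - g₁') (G - G') t =
      stateCurve g₀ g₁ G t - stateCurve g₀' g₁' G' t := by
  rw [stateCurve, halfWavePos_sub, halfWaveNeg_sub, map_sub, map_sub, stateCurve, stateCurve]
  abel

theorem velocityCurve_sub (g₀ g₁ g₀' g₁' : L2) (G G' : Curve T) (t : ℝ) :
    velocityCurve (g₀ - g₀') (g₁ - g₁') (G - G') t =
      velocityCurve g₀ g₁ G t - velocityCurve g₀' g₁' G' t := by
  rw [velocityCurve, halfWavePos_sub, halfWaveNeg_sub, map_sub, map_sub, velocityCurve,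
    velocityCurve]
  module

theorem norm_halfWave_parts_le (g₀ g₁ : L2) (G : Curve T) :
    ‖(1 / 2 : ℂ) • g₀ - (Complex.I / 2) • g₁‖ + √T * ‖Complex.I • twist (-1) G‖ ≤
      stateSize g₀ g₁ G / 2 ∧
    ‖(1 / 2 : ℂ) • g₀ + (Complex.I / 2) • g₁‖ + √T * ‖-Complex.I • twist 1 G‖ ≤
      stateSize g₀ g₁ G / 2 := by
  obtain ⟨d1, d2⟩ := norm_data_comb_le g₀ g₁
  obtain ⟨f1, f2⟩ := norm_force_le G
  have e : stateSize g₀ g₁ G / 2 = (‖g₀‖ + ‖g₁‖) / 2 + √T * ‖G‖ := by rw [stateSize]; ring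
  rw [e]
  exact ⟨add_le_add d1 (mul_le_mul_of_nonneg_left f1 (Real.sqrt_nonneg _)),
    add_le_add d2 (mul_le_mul_of_nonneg_left f2 (Real.sqrt_nonneg _))⟩

theorem exists_nullFormCurve_halfWaves (hT : 0 ≤ T) {σ τ : ℝ} (hσ : σ = 1 ∨ σ = -1)
    (hτ : τ = 1 ∨ τ = -1) {c c' : L2} {h h' : Curve T} {n n' : ℝ}
    (hn : ‖c‖ + √T * ‖h‖ ≤ n / 2) (hn' : ‖c'‖ + √T * ‖h'‖ ≤ n' / 2) :
    ∃ M : Curve T, IsNullFormCurve T (fun t => waveOp (σ * t) (c + primitive t h))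
      (fun t => waveOp (τ * t) (c' + primitive t h')) M ∧ ‖M‖ ≤ 2 * n * n' := by
  obtain ⟨M, h1, h2⟩ := exists_nullFormCurve_two_primitives hT hσ hτ c c' h h'
  refine ⟨M, h1, h2.trans ?_⟩
  have h0 : 0 ≤ ‖c‖ + √T * ‖h‖ := by positivity
  have h0' : 0 ≤ ‖c'‖ + √T * ‖h'‖ := by positivity
  nlinarith [mul_le_mul hn hn' h0' (h0.trans hn)]

/-- Each state is a sum of two half waves of size at most half of `stateSize`. The four sign
patterns contribute 2nn' each. -/
theorem exists_nullFormCurve_stateCurve (hT : 0 ≤ T) (g₀ g₁ g₀' g₁' : L2) (G G' : Curve T) :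
    ∃ M : Curve T, IsNullFormCurve T (stateCurve g₀ g₁ G) (stateCurve g₀' g₁' G') M ∧
      ‖M‖ ≤ 8 * stateSize g₀ g₁ G * stateSize g₀' g₁' G' := by
  obtain ⟨p, q⟩ := norm_halfWave_parts_le g₀ g₁ G
  obtain ⟨p', q'⟩ := norm_halfWave_parts_le g₀' g₁' G'
  have pos : (1 : ℝ) = 1 ∨ (1 : ℝ) = -1 := Or.inl rfl
  have neg : (-1 : ℝ) = 1 ∨ (-1 : ℝ) = -1 := Or.inr rfl
  obtain ⟨M₁, a1, b1⟩ := exists_nullFormCurve_halfWaves hT pos pos p p'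
  obtain ⟨M₂, a2, b2⟩ := exists_nullFormCurve_halfWaves hT pos neg p q'
  obtain ⟨M₃, a3, b3⟩ := exists_nullFormCurve_halfWaves hT neg pos q p'
  obtain ⟨M₄, a4, b4⟩ := exists_nullFormCurve_halfWaves hT neg neg q q'
  have c1 := a1.add_right a2
  have c2 := a3.add_right a4
  have c3 := c1.add_left c2
  refine ⟨(M₁ + M₂) + (M₃ + M₄), c3.congr (fun _ _ => rfl) (fun _ _ => rfl), ?_⟩
  have n1 := norm_add_le (M₁ + M₂) (M₃ + M₄)
  have n2 := norm_add_le M₁ M₂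
  have n3 := norm_add_le M₃ M₄
  linarith

/-- The group law e^{iρtr} e^{-iρsr} = e^{iρ(t-s)r} turns the moving coefficient back into a Duhamel
integral. -/
theorem waveOp_primitive {t : ℝ} (ht : t ∈ Icc 0 T) (ρ : ℝ) (c : ℂ) (G : Curve T) :
    waveOp (ρ * t) (primitive t (c • twist (-ρ) G)) =
      ∫ s in (0 : ℝ)..t, c • waveOp (ρ * (t - s)) (G s) := by
  rw [primitive_eq_intervalIntegral ht,
    ← ContinuousLinearMap.intervalIntegral_comp_comm _ (intervalIntegrable_curve _ ht)]
  refine intervalIntegral.integral_congr_ae_restrict ?_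
  rw [uIoc_of_le ht.1]
  have hsub : Ioc 0 t ⊆ Icc 0 T := fun s hs => ⟨hs.1.le, hs.2.trans ht.2⟩
  filter_upwards [ae_restrict_of_ae_restrict_of_subset hsub (twist_coe (-ρ) G),
    ae_restrict_of_ae_restrict_of_subset hsub (Lp.coeFn_smul c (twist (-ρ) G))] with s h1 h2
  rw [h2, Pi.smul_apply, h1, map_smul, ← waveOp_add]
  congr 3
  ring

end State

/-! ### The inverse Fourier transform under the integral -/

section Inverse

variable {V F : Type*} [NormedAddCommGroup V] [InnerProductSpace ℝ V] [FiniteDimensional ℝ V]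
  [MeasurableSpace V] [BorelSpace V] [NormedAddCommGroup F] [InnerProductSpace ℂ F]

theorem continuous_fourierInv_of_integrable {h : V → F} (h1 : Integrable h) :
    Continuous (𝓕⁻ h) := by
  rw [Real.fourierInv_eq_fourier_comp_neg]
  exact continuous_fourier_of_integrable h1.comp_neg

theorem norm_fourierInv_le_integral (h : V → F) (x : V) : ‖𝓕⁻ h x‖ ≤ ∫ v, ‖h v‖ := by
  rw [Real.fourierInv_eq_fourier_neg]
  exact norm_fourier_le_integral h _

variable [CompleteSpace F]

theorem integral_smul_fourierInv {g : V → F} (hg : Integrable g) (ψ : 𝓢(V, ℂ)) :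
    ∫ x, ψ x • 𝓕⁻ g x = ∫ ξ, (𝓕⁻ ψ) ξ • g ξ := by
  have h := integral_fourier_smul_eq_of_integrable (f := fun x => ψ (-x)) ψ.integrable.comp_neg hg
  rw [← Real.fourierInv_eq_fourier_comp_neg] at h
  rw [SchwartzMap.fourierInv_coe, h, ← integral_neg_eq_self]
  simp only [Real.fourierInv_eq_fourier_neg, neg_neg]

theorem integral_smul_fourierInv_L2 (b : Lp F 2 (volume : Measure V)) (ψ : 𝓢(V, ℂ)) :
    ∫ x, ψ x • (𝓕⁻ b : Lp F 2 (volume : Measure V)) x = ∫ ξ, (𝓕⁻ ψ) ξ • b ξ := by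
  have e := congrArg (fun S => S ψ) (Lp.fourierInv_toTemperedDistribution_eq b)
  simp only [TemperedDistribution.fourierInv_apply, Lp.toTemperedDistribution_apply] at e
  exact e.symm

end Inverse

/-! ### The gradient of an element of Ḣ^{3/2} as a function -/

section Gradient

/-- The symbol of `∂_j (-Δ)^{-3/4}`. -/
def gradSymbol (j : Fin 2) (ξ : Plane) : ℂ :=
  2 * Real.pi * Complex.I * ((ξ j * (2 * Real.pi * ‖ξ‖) ^ (-(3 / 2) : ℝ) : ℝ) : ℂ)

theorem measurable_gradSymbol (j : Fin 2) : Measurable (gradSymbol j) := by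
  have := measurable_coord j
  unfold gradSymbol
  fun_prop

theorem norm_gradSymbol_le (j : Fin 2) (ξ : Plane) :
    ‖gradSymbol j ξ‖ ≤ (√(2 * Real.pi))⁻¹ * (√‖ξ‖)⁻¹ := by
  rcases eq_or_ne ξ 0 with rfl | hξ
  · simp [gradSymbol]
  have h0 : 0 < ‖ξ‖ := norm_pos_iff.2 hξ
  have hr : 0 < 2 * Real.pi * ‖ξ‖ := by positivity
  have hc : |ξ j| ≤ ‖ξ‖ := by simpa using PiLp.norm_apply_le (p := 2) ξ j
  have e : ‖gradSymbol j ξ‖ = 2 * Real.pi * (|ξ j| * (2 * Real.pi * ‖ξ‖) ^ (-(3 / 2) : ℝ)) := by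
    rw [gradSymbol, norm_mul, Complex.norm_real, Real.norm_eq_abs, abs_mul,
      abs_of_nonneg (by positivity : 0 ≤ (2 * Real.pi * ‖ξ‖) ^ (-(3 / 2) : ℝ))]
    congr 1
    simp [abs_of_pos Real.pi_pos]
  rw [e, ← mul_inv, ← Real.sqrt_mul (by positivity), Real.sqrt_eq_rpow, ← Real.rpow_neg hr.le]
  calc _ ≤ 2 * Real.pi * (‖ξ‖ * (2 * Real.pi * ‖ξ‖) ^ (-(3 / 2) : ℝ)) := by gcongr
    _ = (2 * Real.pi * ‖ξ‖) ^ (1 : ℝ) * (2 * Real.pi * ‖ξ‖) ^ (-(3 / 2) : ℝ) := by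
        rw [Real.rpow_one]; ring
    _ = _ := by rw [← Real.rpow_add hr]; norm_num

/-- A symbol of size |ξ|^{-1/2} is square integrable near the origin of the plane, and by
`norm_highFreq_le` bounded away from it. So the low frequencies produce an L¹ transform and a
bounded function, the high frequencies an L² function. The weight (1+|x|²)^{-1} places both in L².
-/
theorem memLp_two_lowFreq {m : Plane → ℂ} (hm : Measurable m)
    (hb : ∀ ξ, ‖m ξ‖ ≤ (√(2 * Real.pi))⁻¹ * (√‖ξ‖)⁻¹) :
    MemLp ((Metric.closedBall 0 1).indicator m) 2 := by
  refine memLp_two_of_norm_le (C := 4) (hm.indicator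
    measurableSet_closedBall).aestronglyMeasurable fun ξ => ?_
  by_cases h : ξ ∈ Metric.closedBall (0 : Plane) 1
  · rw [indicator_of_mem h]
    have h1 : ‖ξ‖ ≤ 1 := by simpa using h
    have h2 : (1 : ℝ) ≤ 4 * (1 + ‖ξ‖) ^ (-(2 : ℝ)) := by
      rw [Real.rpow_neg (by positivity), show ((2 : ℝ)) = ((2 : ℕ) : ℝ) by norm_num,
        Real.rpow_natCast, ← div_eq_mul_inv, le_div_iff₀ (by positivity)]
      nlinarith [norm_nonneg ξ]
    have h3 : (2 * Real.pi)⁻¹ ≤ 1 := inv_le_one_of_one_le₀ (by nlinarith [Real.pi_gt_three])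
    calc _ ≤ ((√(2 * Real.pi))⁻¹ * (√‖ξ‖)⁻¹) ^ 2 := by gcongr; exact hb ξ
      _ = (2 * Real.pi)⁻¹ * ‖ξ‖⁻¹ * 1 := by
          rw [mul_pow, inv_pow, inv_pow, Real.sq_sqrt (by positivity), Real.sq_sqrt (by positivity),
            mul_one]
      _ ≤ 1 * ‖ξ‖⁻¹ * (4 * (1 + ‖ξ‖) ^ (-(2 : ℝ))) := by gcongr
      _ = _ := by ring
  · rw [indicator_of_notMem h, norm_zero, zero_pow two_ne_zero]; positivity

theorem norm_highFreq_le {m : Plane → ℂ} (hb : ∀ ξ, ‖m ξ‖ ≤ (√(2 * Real.pi))⁻¹ * (√‖ξ‖)⁻¹)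
    (ξ : Plane) : ‖((Metric.closedBall 0 1)ᶜ : Set Plane).indicator m ξ‖ ≤ 1 := by
  by_cases h : ξ ∈ Metric.closedBall (0 : Plane) 1
  · rw [indicator_of_notMem (by simpa using h), norm_zero]; exact zero_le_one
  · rw [indicator_of_mem h]
    have h1 : 1 ≤ ‖ξ‖ := by
      rw [Metric.mem_closedBall, dist_zero_right, not_le] at h; exact h.le
    refine (hb ξ).trans (mul_le_one₀ ?_ (by positivity) ?_)
    · exact inv_le_one_of_one_le₀ (Real.one_le_sqrt.2 (by nlinarith [Real.pi_gt_three]))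
    · exact inv_le_one_of_one_le₀ (Real.one_le_sqrt.2 h1)

/-- The low frequency part of `gradSymbol`. -/
def gradLow (j : Fin 2) : Plane → ℂ := (Metric.closedBall 0 1).indicator (gradSymbol j)

/-- The high frequency part of `gradSymbol`. -/
def gradHigh (j : Fin 2) : Plane → ℂ := (Metric.closedBall 0 1)ᶜ.indicator (gradSymbol j)

theorem gradLow_add_gradHigh (j : Fin 2) (ξ : Plane) :
    gradLow j ξ + gradHigh j ξ = gradSymbol j ξ := by
  rw [gradLow, gradHigh]
  exact Set.indicator_self_add_compl_apply _ _ ξ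

theorem memLp_gradLow (j : Fin 2) : MemLp (gradLow j) 2 :=
  memLp_two_lowFreq (measurable_gradSymbol j) (norm_gradSymbol_le j)

theorem norm_gradHigh_le (j : Fin 2) (ξ : Plane) : ‖gradHigh j ξ‖ ≤ 1 :=
  norm_highFreq_le (norm_gradSymbol_le j) ξ

theorem memLp_gradHigh (j : Fin 2) : MemLp (gradHigh j) ∞ (volume : Measure Plane) :=
  memLp_top_of_bound ((measurable_gradSymbol j).indicator
    measurableSet_closedBall.compl).aestronglyMeasurable 1
    (Filter.Eventually.of_forall (norm_gradHigh_le j))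

/-- The weight `(1+|x|²)^{-1}`. -/
def decayWeight (x : Plane) : ℂ := (((1 + ‖x‖ ^ 2)⁻¹ : ℝ) : ℂ)

theorem decayWeight_ne_zero (x : Plane) : decayWeight x ≠ 0 := by
  have : (1 + ‖x‖ ^ 2) ≠ 0 := by positivity
  simp only [decayWeight]
  exact_mod_cast inv_ne_zero this

theorem continuous_decayWeight : Continuous decayWeight := by
  have : ∀ x : Plane, 1 + ‖x‖ ^ 2 ≠ 0 := fun x => by positivity
  unfold decayWeight
  exact Complex.continuous_ofReal.comp ((by fun_prop : Continuous fun x : Plane =>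
    1 + ‖x‖ ^ 2).inv₀ this)

theorem norm_decayWeight (x : Plane) : ‖decayWeight x‖ = (1 + ‖x‖ ^ 2)⁻¹ := by
  rw [decayWeight, Complex.norm_real, Real.norm_of_nonneg (by positivity)]

theorem norm_decayWeight_le (x : Plane) : ‖decayWeight x‖ ≤ 1 := by
  rw [norm_decayWeight]
  exact inv_le_one_of_one_le₀ (by nlinarith [sq_nonneg ‖x‖])

theorem memLp_decayWeight : MemLp decayWeight 2 := by
  rw [memLp_two_iff_integrable_sq_norm continuous_decayWeight.aestronglyMeasurable]
  have h := integrable_rpow_neg_one_add_norm_sq (E := Plane) (μ := volume) (r := 4)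
    (by rw [finrank_euclideanSpace]; norm_num)
  refine h.congr (Filter.Eventually.of_forall fun x => ?_)
  simp only [norm_decayWeight]
  rw [show (-4 / 2 : ℝ) = -(2 : ℕ) by norm_num, Real.rpow_neg (by positivity), Real.rpow_natCast,
    inv_pow]

theorem memLp_top_decayWeight : MemLp decayWeight ∞ (volume : Measure Plane) :=
  memLp_top_of_continuous continuous_decayWeight norm_decayWeight_le

theorem integrable_gradLow_smul (j : Fin 2) (a : L2) : Integrable fun ξ => gradLow j ξ • a ξ :=
  integrable_smul_of_memLp_two (memLp_gradLow j) (Lp.memLp a)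

theorem integral_norm_gradLow_smul_le (j : Fin 2) (a : L2) :
    ∫ ξ, ‖gradLow j ξ • a ξ‖ ≤ ‖(memLp_gradLow j).toLp‖ * ‖a‖ := by
  have h1 := lintegral_mul_sq_le volume (memLp_gradLow j).1.enorm (Lp.aestronglyMeasurable a).enorm
  have e : ∫⁻ x, ‖gradLow j x‖ₑ ^ 2 = ‖(memLp_gradLow j).toLp‖ₑ ^ 2 := by
    rw [L2_enorm_sq]
    exact lintegral_congr_ae ((memLp_gradLow j).coeFn_toLp.mono fun ξ h => by simp only [h])
  rw [e, ← L2_enorm_sq, ← mul_pow, ENNReal.pow_le_pow_left_iff (by norm_num)] at h1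
  simp_rw [← enorm_smul] at h1
  rw [← ofReal_norm, ← ofReal_norm, ← ENNReal.ofReal_mul (norm_nonneg _),
    ← ofReal_integral_norm_eq_lintegral_enorm (integrable_gradLow_smul j a),
    ENNReal.ofReal_le_ofReal_iff (by positivity)] at h1
  exact h1

theorem memLp_weighted_low (j : Fin 2) (a : L2) :
    MemLp (fun x => decayWeight x • 𝓕⁻ (fun ξ => gradLow j ξ • a ξ) x) 2 := by
  have hc := continuous_fourierInv_of_integrable (integrable_gradLow_smul j a)
  refine memLp_decayWeight.of_le_mul (c := ∫ ξ, ‖gradLow j ξ • a ξ‖)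
    (continuous_decayWeight.smul hc).aestronglyMeasurable (Filter.Eventually.of_forall fun x => ?_)
  rw [norm_smul, mul_comm]
  gcongr
  exact norm_fourierInv_le_integral _ x

theorem fourierInv_gradLow_add (j : Fin 2) (a b : L2) (x : Plane) :
    𝓕⁻ (fun ξ => gradLow j ξ • (a + b : L2) ξ) x =
      𝓕⁻ (fun ξ => gradLow j ξ • a ξ) x + 𝓕⁻ (fun ξ => gradLow j ξ • b ξ) x := by
  rw [Real.fourierInv_eq, Real.fourierInv_eq, Real.fourierInv_eq, ← integral_add]
  · refine integral_congr_ae ?_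
    filter_upwards [Lp.coeFn_add a b] with ξ h
    rw [h, Pi.add_apply, smul_add, smul_add]
  · have := (Real.fourierIntegral_convergent_iff (-x)).2 (integrable_gradLow_smul j a)
    simpa using this
  · have := (Real.fourierIntegral_convergent_iff (-x)).2 (integrable_gradLow_smul j b)
    simpa using this

theorem fourierInv_gradLow_smul (j : Fin 2) (c : ℂ) (a : L2) (x : Plane) :
    𝓕⁻ (fun ξ => gradLow j ξ • (c • a : L2) ξ) x = c • 𝓕⁻ (fun ξ => gradLow j ξ • a ξ) x := by
  rw [Real.fourierInv_eq, Real.fourierInv_eq, ← integral_smul]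
  refine integral_congr_ae ?_
  filter_upwards [Lp.coeFn_smul c a] with ξ h
  rw [h, Pi.smul_apply, smul_comm (gradLow j ξ) c, smul_comm]

/-- The low frequency part of the weighted gradient. -/
def weightedGradLow (j : Fin 2) : L2 →L[ℂ] L2 :=
  LinearMap.mkContinuous
    { toFun := fun a => (memLp_weighted_low j a).toLp
      map_add' := fun a b => by
        rw [← MemLp.toLp_add, MemLp.toLp_eq_toLp_iff]
        refine Filter.Eventually.of_forall fun x => ?_
        simp only [Pi.add_apply]
        rw [fourierInv_gradLow_add, smul_add]
      map_smul' := fun c a => by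
        rw [RingHom.id_apply, ← MemLp.toLp_const_smul, MemLp.toLp_eq_toLp_iff]
        refine Filter.Eventually.of_forall fun x => ?_
        simp only [Pi.smul_apply]
        rw [fourierInv_gradLow_smul, smul_comm] }
    (‖(memLp_gradLow j).toLp‖ * ‖memLp_decayWeight.toLp‖) fun a => by
      refine (Lp.norm_le_mul_norm_of_ae_le_mul (c := ‖(memLp_gradLow j).toLp‖ * ‖a‖)
        (g := memLp_decayWeight.toLp) ?_).trans_eq (by ring)
      filter_upwards [(memLp_weighted_low j a).coeFn_toLp, memLp_decayWeight.coeFn_toLp]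
        with x h1 h2
      change ‖(memLp_weighted_low j a).toLp _ x‖ ≤ _
      rw [h1, h2, norm_smul, mul_comm]
      gcongr
      exact (norm_fourierInv_le_integral _ x).trans (integral_norm_gradLow_smul_le j a)

theorem weightedGradLow_coe (j : Fin 2) (a : L2) : weightedGradLow j a =ᵐ[volume]
    fun x => decayWeight x • 𝓕⁻ (fun ξ => gradLow j ξ • a ξ) x :=
  (memLp_weighted_low j a).coeFn_toLp

/-- The operator `(1+|x|²)^{-1} ∂_j (-Δ)^{-3/4} 𝓕⁻`. -/
def weightedGrad (j : Fin 2) : L2 →L[ℂ] L2 :=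
  weightedGradLow j + (mulOp decayWeight).comp
    (((Lp.fourierTransformₗᵢ Plane C3).symm.toContinuousLinearEquiv : L2 →L[ℂ] L2).comp
      (mulOp (gradHigh j)))

theorem weightedGrad_coe (j : Fin 2) (a : L2) : weightedGrad j a =ᵐ[volume]
    fun x => decayWeight x • (𝓕⁻ (fun ξ => gradLow j ξ • a ξ) x +
      (𝓕⁻ (mulOp (gradHigh j) a) : L2) x) := by
  filter_upwards [Lp.coeFn_add (weightedGradLow j a) (mulOp decayWeight (𝓕⁻ (mulOp (gradHigh j) a))),
    weightedGradLow_coe j a, mulOp_coe memLp_top_decayWeight (𝓕⁻ (mulOp (gradHigh j) a))]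
    with x h1 h2 h3
  rw [smul_add, ← h2, ← h3]
  exact h1

/-- The function `∂_j (-Δ)^{-3/4} 𝓕⁻ a`. -/
def gradFn (j : Fin 2) (a : L2) (x : Plane) : C3 := (decayWeight x)⁻¹ • weightedGrad j a x

theorem gradFn_ae_eq (j : Fin 2) (a : L2) : gradFn j a =ᵐ[volume]
    fun x => 𝓕⁻ (fun ξ => gradLow j ξ • a ξ) x + (𝓕⁻ (mulOp (gradHigh j) a) : L2) x := by
  filter_upwards [weightedGrad_coe j a] with x h
  rw [gradFn, h, inv_smul_smul₀ (decayWeight_ne_zero x)]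

theorem gradFn_spec (j : Fin 2) (a : L2) (ψ : 𝓢(Plane, ℂ)) :
    Integrable (fun x => ψ x • gradFn j a x) ∧
      ∫ x, ψ x • gradFn j a x = ∫ ξ, ((𝓕⁻ ψ) ξ * gradSymbol j ξ) • a ξ := by
  have hlow := integrable_gradLow_smul j a
  have hc := continuous_fourierInv_of_integrable hlow
  have i1 : Integrable fun x => ψ x • 𝓕⁻ (fun ξ => gradLow j ξ • a ξ) x :=
    (ψ.integrable.norm.mul_const _).mono' (ψ.continuous.smul hc).aestronglyMeasurable
      (Filter.Eventually.of_forall fun x => by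
        rw [norm_smul]; gcongr; exact norm_fourierInv_le_integral _ x)
  have i2 : Integrable fun x => ψ x • (𝓕⁻ (mulOp (gradHigh j) a) : L2) x :=
    integrable_smul_of_memLp_two (ψ.memLp 2 volume) (Lp.memLp _)
  have e : (fun x => ψ x • gradFn j a x) =ᵐ[volume] fun x =>
      ψ x • 𝓕⁻ (fun ξ => gradLow j ξ • a ξ) x + ψ x • (𝓕⁻ (mulOp (gradHigh j) a) : L2) x := by
    filter_upwards [gradFn_ae_eq j a] with x h
    rw [h, smul_add]
  refine ⟨(i1.add i2).congr e.symm, ?_⟩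
  have j1 : Integrable fun ξ => (𝓕⁻ ψ) ξ • gradLow j ξ • a ξ := by
    refine hlow.bdd_smul (∫ x, ‖ψ x‖) (𝓕⁻ ψ).continuous.aestronglyMeasurable
      (Filter.Eventually.of_forall fun ξ => ?_)
    rw [SchwartzMap.fourierInv_coe]
    exact norm_fourierInv_le_integral _ ξ
  have j2 : Integrable fun ξ => (𝓕⁻ ψ) ξ • mulOp (gradHigh j) a ξ :=
    integrable_smul_of_memLp_two ((𝓕⁻ ψ).memLp 2 volume) (Lp.memLp _)
  rw [integral_congr_ae e, integral_add i1 i2, integral_smul_fourierInv hlow,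
    integral_smul_fourierInv_L2, ← integral_add j1 j2]
  refine integral_congr_ae ?_
  filter_upwards [mulOp_coe (memLp_gradHigh j) a] with ξ h
  rw [h, ← smul_add, ← add_smul, gradLow_add_gradHigh, smul_smul]

/-- The derivative contributes a factor ξ_j, so the test function on the Fourier side vanishes at
the origin. This makes the identity of order 3/2 applicable, although it says nothing about additive
constants. -/
theorem isGivenBy_lineDeriv {f : Dist} {w : L2} (hf : IsFracLaplacian (3 / 2) f w) (j : Fin 2) :
    IsGivenBy (∂_{(EuclideanSpace.single j 1 : Plane)} f) (gradFn j (𝓕 w)) := by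
  intro ψ
  obtain ⟨h1, h2⟩ := gradFn_spec j (𝓕 w) ψ
  refine ⟨h1, ?_⟩
  have hT : (fun ξ : Plane => ((inner ℝ ξ (EuclideanSpace.single j 1 : Plane) : ℝ) : ℂ)).HasTemperateGrowth := by
    exact Function.Complex.hasTemperateGrowth_ofReal.comp
      (Function.hasTemperateGrowth_inner_left _)
  set χ := SchwartzMap.smulLeftCLM ℂ
    (fun ξ : Plane => ((inner ℝ ξ (EuclideanSpace.single j 1 : Plane) : ℝ) : ℂ)) (𝓕⁻ ψ) with hχ
  have hχ' : ∀ ξ, χ ξ = ((ξ j : ℝ) : ℂ) * (𝓕⁻ ψ) ξ := fun ξ => by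
    rw [hχ, SchwartzMap.smulLeftCLM_apply_apply hT, smul_eq_mul]
    simp [EuclideanSpace.inner_single_right]
  have e1 : (∂_{(EuclideanSpace.single j 1 : Plane)} f) ψ =
      (2 * Real.pi * Complex.I) • (𝓕 f) χ := by
    have := congrArg (fun S : Dist => S (𝓕⁻ ψ))
      (TemperedDistribution.fourier_lineDerivOp_eq f (EuclideanSpace.single j 1 : Plane))
    simp only [TemperedDistribution.fourier_apply, FourierTransform.fourier_fourierInv_eq] at this
    rw [this]
    rfl
  rw [e1, hf χ (fun _ => by rw [hχ']; simp), h2, ← integral_smul]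
  refine integral_congr_ae (Filter.Eventually.of_forall fun ξ => ?_)
  simp only [smul_smul, hχ', gradSymbol]
  congr 1
  push_cast
  ring

end Gradient

/-! ### The Fourier transform of u_x ∧ u_y -/

section ProductRule

theorem locallyIntegrable_of_forall_schwartz {p : Plane → C3}
    (h : ∀ ψ : 𝓢(Plane, ℂ), Integrable fun x => ψ x • p x) : LocallyIntegrable p := by
  rw [locallyIntegrable_iff]
  intro K hK
  obtain ⟨R, hR⟩ := hK.isBounded.subset_closedBall (0 : Plane)
  let b : ContDiffBump (0 : Plane) := ⟨max R 1, max R 1 + 1, by positivity, by linarith⟩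
  have h1 : HasCompactSupport (Complex.ofRealCLM ∘ b) := b.hasCompactSupport.comp_left rfl
  have h2 : ContDiff ℝ (⊤ : ℕ∞) (Complex.ofRealCLM ∘ b) := Complex.ofRealCLM.contDiff.comp b.contDiff
  refine ((h (h1.toSchwartzMap h2)).integrableOn (s := K)).congr_fun (fun x hx => ?_)
    hK.measurableSet
  have : b x = 1 := b.one_of_mem_closedBall
    (Metric.closedBall_subset_closedBall (le_max_left _ _) (hR hx))
  simp [this]

theorem locallyIntegrable_gradFn (j : Fin 2) (a : L2) : LocallyIntegrable (gradFn j a) :=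
  locallyIntegrable_of_forall_schwartz fun ψ => (gradFn_spec j a ψ).1

/-- The function representing a distribution is unique almost everywhere, so the wedge does not
depend on the representatives chosen in `IsWedge`. -/
theorem eq_gradFn_of_isGivenBy {f : Dist} {w : L2} (hf : IsFracLaplacian (3 / 2) f w) (j : Fin 2)
    {p : Plane → C3} (hp : IsGivenBy (∂_{(EuclideanSpace.single j 1 : Plane)} f) p) :
    p =ᵐ[volume] gradFn j (𝓕 w) := by
  have h := isGivenBy_lineDeriv hf j
  exact ae_eq_of_forall_schwartz (locallyIntegrable_of_forall_schwartz fun ψ => (hp ψ).1)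
    (locallyIntegrable_gradFn j _) (fun ψ => (hp ψ).1) (fun ψ => (h ψ).1)
    fun ψ => (hp ψ).2.symm.trans (h ψ).2

theorem IsAnnular.integrable {δ R B : ℝ} {f : Plane → C3} (hf : IsAnnular δ R B f) :
    Integrable f := by
  have h : Integrable ((Metric.closedBall (0 : Plane) R).indicator fun _ => B) :=
    (integrable_indicator_iff measurableSet_closedBall).2
      (integrableOn_const (isCompact_closedBall _ _).measure_ne_top)
  refine h.mono' hf.meas.aestronglyMeasurable (Filter.Eventually.of_forall fun ξ => ?_)
  by_cases h : f ξ = 0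
  · rw [h, norm_zero]; exact indicator_nonneg (fun _ _ => hf.bound_nonneg) _
  · rw [indicator_of_mem (by simpa using (hf.support_le _ h).2)]
    exact hf.bound ξ

theorem IsAnnular.gradSymbol_smul {δ R B : ℝ} {f : Plane → C3} (hf : IsAnnular δ R B f)
    (j : Fin 2) : IsAnnular δ R ((√δ)⁻¹ * B) fun ξ => gradSymbol j ξ • f ξ := by
  have hδ := hf.pos
  have hB := hf.bound_nonneg
  refine ⟨hf.pos, hf.radius_nonneg, by positivity,
    (measurable_gradSymbol j).stronglyMeasurable.smul hf.meas, fun ξ => ?_,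
    fun ξ h => hf.support_le ξ fun h0 => h (by simp only [h0, smul_zero])⟩
  by_cases h : f ξ = 0
  · rw [h, smul_zero, norm_zero]; positivity
  · rw [norm_smul]
    refine mul_le_mul ((norm_gradSymbol_le j ξ).trans ?_) (hf.bound ξ) (norm_nonneg _)
      (by positivity)
    have h1 : (√(2 * Real.pi))⁻¹ ≤ 1 :=
      inv_le_one_of_one_le₀ (Real.one_le_sqrt.2 (by nlinarith [Real.pi_gt_three]))
    have h2 : (√‖ξ‖)⁻¹ ≤ (√δ)⁻¹ :=
      inv_anti₀ (Real.sqrt_pos.2 hδ) (Real.sqrt_le_sqrt (hf.support_le ξ h).1)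
    calc _ ≤ 1 * (√δ)⁻¹ := by gcongr
      _ = _ := one_mul _

theorem IsAnnular.gradFn_ae_eq {δ R B : ℝ} {f : Plane → C3} (hf : IsAnnular δ R B f) {a : L2}
    (ha : a =ᵐ[volume] f) (j : Fin 2) :
    gradFn j a =ᵐ[volume] 𝓕⁻ fun ξ => gradSymbol j ξ • f ξ := by
  have hi := (hf.gradSymbol_smul j).integrable
  have hc := continuous_fourierInv_of_integrable hi
  refine ae_eq_of_forall_schwartz (locallyIntegrable_gradFn j a) hc.locallyIntegrable
    (fun ψ => (gradFn_spec j a ψ).1) (fun ψ => ?_) fun ψ => ?_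
  · exact (ψ.integrable.norm.mul_const _).mono' (ψ.continuous.smul hc).aestronglyMeasurable
      (Filter.Eventually.of_forall fun x => by
        rw [norm_smul]; gcongr; exact norm_fourierInv_le_integral _ x)
  · rw [(gradFn_spec j a ψ).2, integral_smul_fourierInv hi]
    refine integral_congr_ae (ha.mono fun ξ h => ?_)
    simp only [h, smul_smul]

/-- The kernel of `u_x ∧ v_y`. -/
def gradKernel (p : Plane × Plane) : ℂ := gradSymbol 0 p.1 * gradSymbol 1 p.2

theorem isFormKernel_grad : IsFormKernel gradKernel := by
  refine ⟨((measurable_gradSymbol 0).comp measurable_fst).mul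
    ((measurable_gradSymbol 1).comp measurable_snd), fun p => ?_⟩
  have h : (√(2 * Real.pi))⁻¹ * (√(2 * Real.pi))⁻¹ ≤ 1 / 2 := by
    rw [← mul_inv, Real.mul_self_sqrt (by positivity), one_div]
    exact inv_anti₀ two_pos (by nlinarith [Real.pi_gt_three])
  rw [gradKernel, norm_mul, Real.sqrt_mul (norm_nonneg _), mul_inv]
  calc _ ≤ ((√(2 * Real.pi))⁻¹ * (√‖p.1‖)⁻¹) * ((√(2 * Real.pi))⁻¹ * (√‖p.2‖)⁻¹) :=
        mul_le_mul (norm_gradSymbol_le 0 p.1) (norm_gradSymbol_le 1 p.2) (norm_nonneg _)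
          (by positivity)
    _ = ((√(2 * Real.pi))⁻¹ * (√(2 * Real.pi))⁻¹) * ((√‖p.1‖)⁻¹ * (√‖p.2‖)⁻¹) := by ring
    _ ≤ _ := by gcongr

theorem rpow_neg_three_half {x : ℝ} (hx : 0 ≤ x) : x ^ (-(3 / 2) : ℝ) = (√x ^ 3)⁻¹ := by
  rw [Real.rpow_neg hx, Real.sqrt_eq_rpow, ← Real.rpow_natCast, ← Real.rpow_mul hx]
  norm_num

theorem gradKernel_antisymm (η ζ : Plane) :
    gradKernel (η, ζ) - gradKernel (ζ, η) =
      2 * ((-(1 / (4 * Real.pi)) * nullSymbol η ζ : ℝ) : ℂ) := by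
  have h1 : ∀ x : Plane, (2 * Real.pi * ‖x‖) ^ (-(3 / 2) : ℝ) =
      (√(2 * Real.pi) ^ 3)⁻¹ * (√‖x‖ ^ 3)⁻¹ := fun x => by
    rw [rpow_neg_three_half (by positivity), Real.sqrt_mul (by positivity), mul_pow, mul_inv]
  have h2 : (√(2 * Real.pi) ^ 3)⁻¹ * (√(2 * Real.pi) ^ 3)⁻¹ = ((2 * Real.pi) ^ 3)⁻¹ := by
    rw [← mul_inv, ← mul_pow, Real.mul_self_sqrt (by positivity)]
  have h3 : nullSymbol η ζ = (η 0 * ζ 1 - η 1 * ζ 0) * ((√‖η‖ ^ 3)⁻¹ * (√‖ζ‖ ^ 3)⁻¹) := by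
    rw [nullSymbol, Real.sqrt_mul (norm_nonneg _), mul_pow, div_eq_mul_inv, mul_inv]
  have h4 : -(2 * Real.pi) ^ 2 * ((2 * Real.pi) ^ 3)⁻¹ = 2 * -(1 / (4 * Real.pi)) := by
    have := Real.pi_ne_zero
    field_simp
    norm_num
  have h5 : gradKernel (η, ζ) - gradKernel (ζ, η) = ((-(2 * Real.pi) ^ 2 *
      ((√(2 * Real.pi) ^ 3)⁻¹ * (√(2 * Real.pi) ^ 3)⁻¹) * nullSymbol η ζ : ℝ) : ℂ) := by
    simp only [gradKernel, gradSymbol]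
    rw [h1 η, h1 ζ, h3]
    push_cast
    linear_combination (4 * (Real.pi : ℂ) ^ 2 * ((η 0 : ℂ) * ζ 1 - η 1 * ζ 0) *
      (((√(2 * Real.pi) : ℝ) : ℂ) ^ 3)⁻¹ * (((√‖η‖ : ℝ) : ℂ) ^ 3)⁻¹ *
      ((((√(2 * Real.pi) : ℝ) : ℂ) ^ 3)⁻¹ * (((√‖ζ‖ : ℝ) : ℂ) ^ 3)⁻¹)) * Complex.I_sq
  rw [h5, h2, h4]
  push_cast
  ring

/-- On the diagonal, exchanging η and ζ changes the sign of the cross product. Averaging the form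
with its exchanged copy leaves only the antisymmetric part of the kernel, which is the null symbol.
-/
theorem gradForm_self (φ : 𝓢(Plane, ℂ)) (a : L2) :
    isFormKernel_grad.form φ a a = nullForm φ a a := by
  have h1 := isFormKernel_grad.integrable_formIntegrand φ a a
  have h2 : isFormKernel_grad.form φ a a =
      ∫ p : Plane × Plane, formIntegrand gradKernel φ a a p.swap ∂(volume.prod volume) := by
    rw [integral_prod_swap, isFormKernel_grad.form_apply]
  have h3 : (2 : ℂ) • isFormKernel_grad.form φ a a = (2 : ℂ) • nullForm φ a a := by
    rw [two_smul]
    nth_rewrite 2 [h2]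
    have h1' : Integrable (fun p : Plane × Plane => formIntegrand gradKernel φ a a p.swap)
        (volume.prod volume) := h1.swap
    rw [isFormKernel_grad.form_apply, ← integral_add h1 h1', nullForm_apply, ← integral_smul]
    refine integral_congr_ae (Filter.Eventually.of_forall fun p => ?_)
    obtain ⟨η, ζ⟩ := p
    simp only [formIntegrand, Prod.swap_prod_mk]
    rw [crossL_swap (a η) (a ζ), add_comm ζ η, smul_neg, ← sub_eq_add_neg, ← sub_smul, ← mul_sub,
      gradKernel_antisymm, smul_smul]
    congr 1
    ring
  exact smul_right_injective _ two_ne_zero h3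

/-- A Schwartz function absorbs both factors 1+|x|², which keeps the product of two weighted
gradients under control. -/
theorem schwartz_div_decayWeight (ψ : 𝓢(Plane, ℂ)) :
    MemLp (fun x => ψ x * ((decayWeight x)⁻¹ * (decayWeight x)⁻¹)) ∞ (volume : Measure Plane) := by
  obtain ⟨C, hC, h⟩ := schwartz_decay ψ 4
  refine memLp_top_of_continuous (C := C) (ψ.continuous.mul
    ((continuous_decayWeight.inv₀ decayWeight_ne_zero).mul
      (continuous_decayWeight.inv₀ decayWeight_ne_zero))) fun x => ?_
  rw [norm_mul, norm_mul, norm_inv, norm_decayWeight, inv_inv]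
  have h1 : 1 + ‖x‖ ^ 2 ≤ (1 + ‖x‖) ^ 2 := by nlinarith [norm_nonneg x]
  calc _ ≤ C * ((1 + ‖x‖) ^ 4)⁻¹ * ((1 + ‖x‖) ^ 2 * (1 + ‖x‖) ^ 2) := by
        gcongr; exact h x
    _ = C := by field_simp

/-- The pairing of `ψ` with `u_x ∧ v_y`. -/
theorem integral_cross_gradFn_eq_lpPairing (ψ : 𝓢(Plane, ℂ)) (a b : L2) :
    Integrable (fun x => ψ x • crossL (gradFn 0 a x) (gradFn 1 b x)) ∧
      ∫ x, ψ x • crossL (gradFn 0 a x) (gradFn 1 b x) = crossL.lpPairing volume 2 2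
        (mulOp (fun x => ψ x * ((decayWeight x)⁻¹ * (decayWeight x)⁻¹)) (weightedGrad 0 a))
        (weightedGrad 1 b) := by
  set A := mulOp (fun x => ψ x * ((decayWeight x)⁻¹ * (decayWeight x)⁻¹)) (weightedGrad 0 a)
    with hA
  have e : (fun x => ψ x • crossL (gradFn 0 a x) (gradFn 1 b x)) =ᵐ[volume]
      fun x => crossL (A x) (weightedGrad 1 b x) := by
    filter_upwards [mulOp_coe (schwartz_div_decayWeight ψ) (weightedGrad 0 a)] with x h
    rw [hA, h]
    simp only [gradFn, map_smul, smul_apply, smul_smul]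
  refine ⟨?_, ?_⟩
  · have h1 : MemLp (fun x => crossL (A x) (weightedGrad 1 b x)) 1 volume := by
      refine MemLp.of_bilin (r := 1) (fun x y => crossL x y) 2 (Lp.memLp A)
        (Lp.memLp (weightedGrad 1 b)) (crossL.aestronglyMeasurable_comp₂ (Lp.aestronglyMeasurable A)
        (Lp.aestronglyMeasurable (weightedGrad 1 b))) (Filter.Eventually.of_forall fun x => ?_)
      exact norm_crossL_le _ _
    exact (memLp_one_iff_integrable.1 h1).congr e.symm
  · rw [integral_congr_ae e, ContinuousLinearMap.lpPairing_eq_integral]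

open scoped Convolution in
-- For annular data the gradients are transforms of integrable functions, and the convolution
-- theorem applies directly.
theorem IsAnnular.integral_cross_gradFn {δ R B δ' R' B' : ℝ} {f g : Plane → C3}
    (hf : IsAnnular δ R B f) (hg : IsAnnular δ' R' B' g) {a b : L2} (ha : a =ᵐ[volume] f)
    (hb : b =ᵐ[volume] g) (φ : 𝓢(Plane, ℂ)) :
    ∫ x, (𝓕 φ) x • crossL (gradFn 0 a x) (gradFn 1 b x) = isFormKernel_grad.form φ a b := by
  set P : Plane → C3 := fun ξ => gradSymbol 0 ξ • f ξ with hP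
  set Q : Plane → C3 := fun ξ => gradSymbol 1 ξ • g ξ with hQ
  have iP : Integrable P := (hf.gradSymbol_smul 0).integrable
  have iQ : Integrable Q := (hg.gradSymbol_smul 1).integrable
  have hconv : ∀ x, crossL (𝓕⁻ P x) (𝓕⁻ Q x) = 𝓕⁻ (P ⋆[crossL] Q) x := fun x => by
    rw [Real.fourierInv_eq_fourier_neg, Real.fourierInv_eq_fourier_neg,
      Real.fourierInv_eq_fourier_neg, Real.fourier_bilin_convolution_eq crossL iP iQ]
  have e1 : ∫ x, (𝓕 φ) x • crossL (gradFn 0 a x) (gradFn 1 b x) =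
      ∫ x, (𝓕 φ) x • 𝓕⁻ (P ⋆[crossL] Q) x := by
    refine integral_congr_ae ?_
    filter_upwards [hf.gradFn_ae_eq ha 0, hg.gradFn_ae_eq hb 1] with x h1 h2
    rw [h1, h2, hconv]
  have e3 := formIntegrand_congr gradKernel φ ha hb
  rw [e1, integral_smul_fourierInv (iP.integrable_convolution crossL iQ),
    FourierTransform.fourierInv_fourier_eq, isFormKernel_grad.form_apply, integral_congr_ae e3,
    integral_prod_eq_integral_convolution
      ((isFormKernel_grad.integrable_formIntegrand φ a b).congr e3)]
  congr 1
  ext1 ξ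
  rw [convolution_def, ← integral_smul]
  congr 1
  ext1 η
  simp only [formIntegrand, gradKernel, hP, hQ, map_smul, smul_apply, smul_smul, add_sub_cancel]
  congr 1
  ring

/-- The product `u_x ∧ v_y` on the Fourier side. -/
theorem integral_cross_gradFn (φ : 𝓢(Plane, ℂ)) (a b : L2) :
    ∫ x, (𝓕 φ) x • crossL (gradFn 0 a x) (gradFn 1 b x) = isFormKernel_grad.form φ a b := by
  set κ : Plane → ℂ := fun x => (𝓕 φ) x * ((decayWeight x)⁻¹ * (decayWeight x)⁻¹) with hκ
  set L := crossL.lpPairing (volume : Measure Plane) 2 2 with hL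
  suffices h : ∀ a b : L2, L (mulOp κ (weightedGrad 0 a)) (weightedGrad 1 b) =
      isFormKernel_grad.form φ a b by
    rw [(integral_cross_gradFn_eq_lpPairing (𝓕 φ) a b).2, ← h]
  -- Both sides are bounded bilinear maps on L² which agree for annular data; density is used first
  -- in a, then in b.
  have hb : ∀ b ∈ annularSubgroup, ∀ a, L (mulOp κ (weightedGrad 0 a)) (weightedGrad 1 b) =
      isFormKernel_grad.form φ a b := by
    intro b hb a
    have c1 : Continuous fun a => L (mulOp κ (weightedGrad 0 a)) (weightedGrad 1 b) :=
      ((L.flip (weightedGrad 1 b)).comp ((mulOp κ).comp (weightedGrad 0))).continuous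
    have c2 : Continuous fun a => isFormKernel_grad.form φ a b :=
      ((isFormKernel_grad.form φ).flip b).continuous
    refine congrFun (Continuous.ext_on dense_annularSubgroup c1 c2 fun a ha => ?_) a
    obtain ⟨δ, R, B, f, hf, haf⟩ := ha
    obtain ⟨δ', R', B', g, hg, hbg⟩ := hb
    rw [← hf.integral_cross_gradFn hg haf hbg φ, (integral_cross_gradFn_eq_lpPairing (𝓕 φ) a b).2]
  intro a b
  have c1 : Continuous fun b => L (mulOp κ (weightedGrad 0 a)) (weightedGrad 1 b) :=
    ((L (mulOp κ (weightedGrad 0 a))).comp (weightedGrad 1)).continuous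
  exact congrFun (Continuous.ext_on dense_annularSubgroup c1
    (isFormKernel_grad.form φ a).continuous fun b h => hb b h a) b

/-- The Fourier transform of `f_x ∧ f_y` is given by the null form. -/
theorem fourier_wedge {f h : Dist} {w : L2} (hf : IsFracLaplacian (3 / 2) f w)
    (hw : IsWedge (dx f) (dy f) h) (φ : 𝓢(Plane, ℂ)) : (𝓕 h) φ = nullForm φ (𝓕 w) (𝓕 w) := by
  obtain ⟨p, q, hp, hq, hh⟩ := hw
  have ep := eq_gradFn_of_isGivenBy hf 0 hp
  have eq := eq_gradFn_of_isGivenBy hf 1 hq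
  rw [← gradForm_self, ← integral_cross_gradFn, TemperedDistribution.fourier_apply, (hh (𝓕 φ)).2]
  refine integral_congr_ae ?_
  filter_upwards [ep, eq] with x h1 h2
  rw [h1, h2, crossL_apply]

/-- Every `f ∈ Ḣ^{3/2}` has a wedge `f_x ∧ f_y`. -/
theorem exists_wedge {f : Dist} {w : L2} (hf : IsFracLaplacian (3 / 2) f w) :
    ∃ h : Dist, IsWedge (dx f) (dy f) h := by
  -- The product of the weighted gradients lies in L¹. Multiplication by the temperate function
  -- (1+|x|²)² removes the weights and leaves a tempered distribution.
  have hi : Integrable fun x => crossL (weightedGrad 0 (𝓕 w) x) (weightedGrad 1 (𝓕 w) x) := by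
    rw [← memLp_one_iff_integrable]
    refine MemLp.of_bilin (r := 1) (fun x y => crossL x y) 2 (Lp.memLp (weightedGrad 0 (𝓕 w)))
      (Lp.memLp (weightedGrad 1 (𝓕 w))) (crossL.aestronglyMeasurable_comp₂
      (Lp.aestronglyMeasurable (weightedGrad 0 (𝓕 w)))
      (Lp.aestronglyMeasurable (weightedGrad 1 (𝓕 w)))) (Filter.Eventually.of_forall fun x => ?_)
    exact norm_crossL_le _ _
  have hT : (fun x : Plane => (((1 + ‖x‖ ^ 2) ^ 2 : ℝ) : ℂ)).HasTemperateGrowth :=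
    Function.Complex.hasTemperateGrowth_ofReal.comp
      (((Function.HasTemperateGrowth.const 1).add (Function.hasTemperateGrowth_norm_sq _)).pow 2)
  set H : Lp C3 1 (volume : Measure Plane) := (memLp_one_iff_integrable.2 hi).toLp with hH
  refine ⟨TemperedDistribution.smulLeftCLM C3 (fun x : Plane => (((1 + ‖x‖ ^ 2) ^ 2 : ℝ) : ℂ))
    (Lp.toTemperedDistribution H), gradFn 0 (𝓕 w), gradFn 1 (𝓕 w), isGivenBy_lineDeriv hf 0,
    isGivenBy_lineDeriv hf 1, fun ψ => ?_⟩
  simp only [← crossL_apply]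
  refine ⟨(integral_cross_gradFn_eq_lpPairing ψ (𝓕 w) (𝓕 w)).1, ?_⟩
  rw [TemperedDistribution.smulLeftCLM_apply_apply, Lp.toTemperedDistribution_apply]
  refine integral_congr_ae ?_
  filter_upwards [(memLp_one_iff_integrable.2 hi).coeFn_toLp] with x h
  rw [hH, h, SchwartzMap.smulLeftCLM_apply_apply hT]
  simp only [gradFn, map_smul, smul_apply, smul_smul, smul_eq_mul, decayWeight]
  congr 1
  push_cast
  rw [inv_inv]
  ring

end ProductRule

/-! ### The time integral of the velocity -/

section VelocityIntegral

variable {T : ℝ}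

/-- The symbol `∫₀ᵗ i e^{iρsr} ds`, with `r = 2π|ξ|`. -/
def primSymbol (ρ t : ℝ) (ξ : Plane) : ℂ :=
  ∫ s in (0 : ℝ)..t, Complex.I * Complex.exp (((ρ * s * (2 * Real.pi * ‖ξ‖) : ℝ) : ℂ) * Complex.I)

theorem primSymbol_sub (ρ t s : ℝ) (ξ : Plane) : primSymbol ρ t ξ - primSymbol ρ s ξ =
    ∫ σ in s..t, Complex.I * Complex.exp (((ρ * σ * (2 * Real.pi * ‖ξ‖) : ℝ) : ℂ) * Complex.I) := by
  have hc : Continuous fun σ : ℝ =>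
      Complex.I * Complex.exp (((ρ * σ * (2 * Real.pi * ‖ξ‖) : ℝ) : ℂ) * Complex.I) := by fun_prop
  exact intervalIntegral.integral_interval_sub_left (hc.intervalIntegrable _ _)
    (hc.intervalIntegrable _ _)

theorem norm_primSymbol_sub_le (ρ t s : ℝ) (ξ : Plane) :
    ‖primSymbol ρ t ξ - primSymbol ρ s ξ‖ ≤ |t - s| := by
  rw [primSymbol_sub]
  refine (intervalIntegral.norm_integral_le_of_norm_le_const (C := 1) fun σ _ => ?_).trans_eq
    (one_mul _)
  rw [norm_mul, Complex.norm_I, Complex.norm_exp_ofReal_mul_I, one_mul]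

theorem norm_primSymbol_le (ρ t : ℝ) (ξ : Plane) : ‖primSymbol ρ t ξ‖ ≤ |t| := by
  have := norm_primSymbol_sub_le ρ t 0 ξ
  simpa [primSymbol] using this

theorem continuous_primSymbol (ρ t : ℝ) : Continuous (primSymbol ρ t) := by
  unfold primSymbol
  exact intervalIntegral.continuous_parametric_intervalIntegral_of_continuous' (by fun_prop) _ _

theorem memLp_primSymbol (ρ t : ℝ) : MemLp (primSymbol ρ t) ∞ (volume : Measure Plane) :=
  memLp_top_of_continuous (continuous_primSymbol ρ t) (norm_primSymbol_le ρ t)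

theorem hasDerivAt_primSymbol (ρ t : ℝ) (ξ : Plane) : HasDerivAt (fun s => primSymbol ρ s ξ)
    (Complex.I * Complex.exp (((ρ * t * (2 * Real.pi * ‖ξ‖) : ℝ) : ℂ) * Complex.I)) t := by
  have hc : Continuous fun σ : ℝ =>
      Complex.I * Complex.exp (((ρ * σ * (2 * Real.pi * ‖ξ‖) : ℝ) : ℂ) * Complex.I) := by fun_prop
  exact (hc.integral_hasStrictDerivAt 0 t).hasDerivAt

theorem continuous_primSymbol_left (ρ : ℝ) (ξ : Plane) : Continuous fun t => primSymbol ρ t ξ :=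
  continuous_iff_continuousAt.2 fun t => (hasDerivAt_primSymbol ρ t ξ).continuousAt

/-- The operator `∫₀ᵗ i e^{iρsr} ds`. -/
def primOp (ρ t : ℝ) : L2 →L[ℂ] L2 := mulOp (primSymbol ρ t)

theorem primOp_coe (ρ t : ℝ) (a : L2) :
    primOp ρ t a =ᵐ[volume] fun ξ => primSymbol ρ t ξ • a ξ := mulOp_coe (memLp_primSymbol ρ t) a

theorem continuous_primOp (ρ : ℝ) : Continuous fun p : ℝ × L2 => primOp ρ p.1 p.2 :=
  continuous_mulOp (B := fun t => |t|) continuous_abs (continuous_primSymbol ρ)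
    (continuous_primSymbol_left ρ) (norm_primSymbol_le ρ)

theorem norm_primOp_le (ρ t : ℝ) (a : L2) : ‖primOp ρ t a‖ ≤ |t| * ‖a‖ :=
  norm_mulOp_le (memLp_primSymbol ρ t) (norm_primSymbol_le ρ t) a

theorem primOp_zero (ρ : ℝ) (a : L2) : primOp ρ 0 a = 0 := by
  have := norm_primOp_le ρ 0 a
  rw [abs_zero, zero_mul] at this
  exact norm_le_zero_iff.1 this

theorem primOp_sub (ρ t σ : ℝ) (a : L2) :
    primOp ρ t a - primOp ρ σ a = primOp ρ (t - σ) (waveOp (ρ * σ) a) := by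
  refine Lp.ext ?_
  filter_upwards [Lp.coeFn_sub (primOp ρ t a) (primOp ρ σ a), primOp_coe ρ t a, primOp_coe ρ σ a,
    primOp_coe ρ (t - σ) (waveOp (ρ * σ) a), waveOp_coe (ρ * σ) a] with ξ h1 h2 h3 h4 h5
  rw [h1, Pi.sub_apply, h2, h3, h4, h5, ← sub_smul, smul_smul, primSymbol_sub, primSymbol,
    ← intervalIntegral.integral_mul_const]
  congr 1
  have h := intervalIntegral.integral_comp_add_right (a := 0) (b := t - σ) (fun s : ℝ =>
    Complex.I * Complex.exp (((ρ * s * (2 * Real.pi * ‖ξ‖) : ℝ) : ℂ) * Complex.I)) σ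
  rw [zero_add, sub_add_cancel] at h
  rw [← h]
  refine intervalIntegral.integral_congr fun s _ => ?_
  rw [mul_assoc Complex.I, ← Complex.exp_add]
  congr 2
  push_cast
  ring

/-- The difference quotients of the symbol are bounded by 1 and converge pointwise, so dominated
convergence gives the derivative on each vector. -/
theorem hasDerivAt_primOp (ρ t : ℝ) (a : L2) :
    HasDerivAt (fun s => primOp ρ s a) (Complex.I • waveOp (ρ * t) a) t := by
  rw [hasDerivAt_iff_tendsto_slope]
  set m : ℝ → Plane → ℂ := fun s ξ => ((s - t : ℝ) : ℂ)⁻¹ * (primSymbol ρ s ξ - primSymbol ρ t ξ)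
    with hm
  set m₀ : Plane → ℂ := fun ξ =>
    Complex.I * Complex.exp (((ρ * t * (2 * Real.pi * ‖ξ‖) : ℝ) : ℂ) * Complex.I) with hm₀
  have hb : ∀ s ξ, ‖m s ξ‖ ≤ 1 := fun s ξ => by
    simp only [hm]
    rw [norm_mul, norm_inv, Complex.norm_real, Real.norm_eq_abs]
    rcases eq_or_ne (s - t) 0 with h | h
    · rw [h]; simp
    · rw [inv_mul_le_iff₀ (abs_pos.2 h), mul_one]
      exact norm_primSymbol_sub_le ρ s t ξ
  have hb₀ : ∀ ξ, ‖m₀ ξ‖ ≤ 1 := fun ξ => by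
    simp only [hm₀]
    rw [norm_mul, Complex.norm_I, Complex.norm_exp_ofReal_mul_I, one_mul]
  have hM : ∀ s, MemLp (m s) ∞ (volume : Measure Plane) := fun s =>
    memLp_top_of_continuous (continuous_const.mul
      ((continuous_primSymbol ρ s).sub (continuous_primSymbol ρ t))) (hb s)
  have hM₀ : MemLp m₀ ∞ (volume : Measure Plane) := memLp_top_of_continuous (by fun_prop) hb₀
  have e₀ : mulOp m₀ a = Complex.I • waveOp (ρ * t) a := by
    refine Lp.ext ?_
    filter_upwards [mulOp_coe hM₀ a, Lp.coeFn_smul Complex.I (waveOp (ρ * t) a),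
      waveOp_coe (ρ * t) a] with ξ h1 h2 h3
    rw [h1, h2, Pi.smul_apply, h3, smul_smul]
  have e : ∀ s, mulOp (m s) a = slope (fun s => primOp ρ s a) t s := fun s => by
    rw [slope_def_module, real_smul_L2]
    refine Lp.ext ?_
    filter_upwards [mulOp_coe (hM s) a, Lp.coeFn_smul (((s - t)⁻¹ : ℝ) : ℂ)
      (primOp ρ s a - primOp ρ t a), Lp.coeFn_sub (primOp ρ s a) (primOp ρ t a),
      primOp_coe ρ s a, primOp_coe ρ t a] with ξ h1 h2 h3 h4 h5
    rw [h1, h2, Pi.smul_apply, h3, Pi.sub_apply, h4, h5, ← sub_smul, smul_smul, hm,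
      Complex.ofReal_inv]
  rw [← e₀]
  refine Filter.Tendsto.congr e ?_
  refine tendsto_mulOp (C := 1) hM hM₀ (Filter.Eventually.of_forall hb) hb₀ (fun ξ => ?_) a
  have h := hasDerivAt_iff_tendsto_slope.1 (hasDerivAt_primSymbol ρ t ξ)
  refine h.congr fun s => ?_
  rw [slope_def_module, hm, Complex.real_smul, Complex.ofReal_inv]

theorem continuous_waveOp_left (ρ : ℝ) (a : L2) :
    Continuous fun s : ℝ => Complex.I • waveOp (ρ * s) a := by
  have h1 : Continuous fun s : ℝ => (ρ * s, a) := by fun_prop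
  have h2 := (continuous_const_smul Complex.I).comp (continuous_waveOp.comp h1)
  exact h2

theorem intervalIntegral_waveOp (ρ σ t : ℝ) (a : L2) :
    ∫ s in σ..t, Complex.I • waveOp (ρ * s) a = primOp ρ t a - primOp ρ σ a :=
  intervalIntegral.integral_eq_sub_of_hasDerivAt (fun s _ => hasDerivAt_primOp ρ s a)
    ((continuous_waveOp_left ρ a).intervalIntegrable _ _)

/-- Fubini on the triangle 0 < σ ≤ s ≤ t: the inner integral over s of the half-wave group is a
difference of values of `primOp`. -/
theorem intervalIntegral_waveOp_primitive {t : ℝ} (ht : t ∈ Icc 0 T) (ρ : ℝ) (h : Curve T) :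
    ∫ s in (0 : ℝ)..t, Complex.I • waveOp (ρ * s) (primitive s h) =
      ∫ σ in (0 : ℝ)..t, (primOp ρ t (h σ) - primOp ρ σ (h σ)) := by
  set μ : Measure ℝ := volume.restrict (Ioc 0 t) with hμ
  have hih : Integrable h μ := (intervalIntegrable_curve h ht).1
  set S : Set (ℝ × ℝ) := {p | p.2 ≤ p.1} with hS
  have hSm : MeasurableSet S := measurableSet_le measurable_snd measurable_fst
  set f : ℝ → ℝ → L2 := fun s σ => S.indicator (fun p => Complex.I • waveOp (ρ * p.1) (h p.2)) (s, σ)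
    with hf
  have hmeas : AEStronglyMeasurable (Function.uncurry f) (μ.prod μ) := by
    have h1 : AEStronglyMeasurable (fun p : ℝ × ℝ => (ρ * p.1, h p.2)) (μ.prod μ) :=
      (by fun_prop : Continuous fun p : ℝ × ℝ => ρ * p.1).aestronglyMeasurable.prodMk
        hih.1.comp_snd
    have h2 := (continuous_waveOp.comp_aestronglyMeasurable h1).const_smul Complex.I
    have h3 := h2.indicator hSm
    exact h3
  have hint : Integrable (Function.uncurry f) (μ.prod μ) := by
    refine (hih.comp_snd μ).mono hmeas (Filter.Eventually.of_forall fun p => ?_)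
    refine (norm_indicator_le_norm_self (s := S)
      (fun p : ℝ × ℝ => Complex.I • waveOp (ρ * p.1) (h p.2)) p).trans ?_
    rw [norm_smul, Complex.norm_I, one_mul]
    exact norm_waveOp_le _ _
  have hswap := integral_integral_swap hint
  have hL : ∫ s in (0 : ℝ)..t, Complex.I • waveOp (ρ * s) (primitive s h) =
      ∫ s, ∫ σ, f s σ ∂μ ∂μ := by
    rw [intervalIntegral.integral_of_le ht.1]
    refine setIntegral_congr_fun measurableSet_Ioc fun s hs => ?_
    have hs' : s ∈ Icc 0 T := ⟨hs.1.le, hs.2.trans ht.2⟩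
    have e : (fun σ => f s σ) = (Iic s).indicator fun σ => Complex.I • waveOp (ρ * s) (h σ) := by
      ext1 σ
      simp only [hf, hS, indicator_apply, mem_ofPred_eq, mem_Iic]
    rw [e, integral_indicator measurableSet_Iic, hμ, Measure.restrict_restrict measurableSet_Iic,
      show Iic s ∩ Ioc 0 t = Ioc 0 s by
        ext σ; simp only [mem_inter_iff, mem_Iic, mem_Ioc]
        exact ⟨fun h => ⟨h.2.1, h.1⟩, fun h => ⟨h.2, h.1, h.2.trans hs.2⟩⟩,
      integral_smul, primitive_eq_intervalIntegral hs', intervalIntegral.integral_of_le hs.1.le]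
    congr 1
    exact ((waveOp (ρ * s)).integral_comp_comm (intervalIntegrable_curve h hs').1).symm
  have hR : ∫ σ in (0 : ℝ)..t, (primOp ρ t (h σ) - primOp ρ σ (h σ)) =
      ∫ σ, ∫ s, f s σ ∂μ ∂μ := by
    rw [intervalIntegral.integral_of_le ht.1]
    refine setIntegral_congr_fun measurableSet_Ioc fun σ hσ => ?_
    have e : (fun s => f s σ) = (Ici σ).indicator fun s => Complex.I • waveOp (ρ * s) (h σ) := by
      ext1 s
      simp only [hf, hS, indicator_apply, mem_ofPred_eq, mem_Ici]
    rw [e, integral_indicator measurableSet_Ici, hμ, Measure.restrict_restrict measurableSet_Ici,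
      show Ici σ ∩ Ioc 0 t = Icc σ t by
        ext s; simp only [mem_inter_iff, mem_Ici, mem_Icc, mem_Ioc]
        exact ⟨fun h => ⟨h.1, h.2.2⟩, fun h => ⟨h.1, hσ.1.trans_le h.1, h.2⟩⟩,
      integral_Icc_eq_integral_Ioc, ← intervalIntegral.integral_of_le hσ.2,
      intervalIntegral_waveOp]
  rw [hL, hR, hswap]

theorem continuousOn_waveOp_primitive (ρ : ℝ) (h : Curve T) :
    ContinuousOn (fun s => Complex.I • waveOp (ρ * s) (primitive s h)) (Icc 0 T) := by
  have h1 : ContinuousOn (fun t : ℝ => ρ * t) (Icc 0 T) := (continuous_const_mul ρ).continuousOn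
  have h2 := (continuous_const_smul Complex.I).comp_continuousOn
    (continuous_waveOp.comp_continuousOn (h1.prodMk (continuousOn_primitive h)))
  exact h2

theorem intervalIntegrable_primOp {t : ℝ} (ht : t ∈ Icc 0 T) (ρ : ℝ) (h : Curve T) :
    IntervalIntegrable (fun σ => primOp ρ (t - σ) (h σ)) volume 0 t := by
  have hih := intervalIntegrable_curve h ht
  rw [intervalIntegrable_iff_integrableOn_Ioc_of_le ht.1] at hih ⊢
  have h1 : AEStronglyMeasurable (fun σ : ℝ => t - σ) (volume.restrict (Ioc 0 t)) :=
    (by fun_prop : Continuous fun σ : ℝ => t - σ).aestronglyMeasurable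
  have h2 := (continuous_primOp ρ).comp_aestronglyMeasurable (h1.prodMk hih.1)
  refine (hih.norm.const_mul t).mono' h2 ?_
  filter_upwards [ae_restrict_mem measurableSet_Ioc] with σ hσ
  refine (norm_primOp_le _ _ _).trans ?_
  gcongr
  rw [abs_of_nonneg (by linarith [hσ.2])]
  linarith [hσ.1]

/-- `∫₀ᵗ i e^{iρsr} (c + ∫₀ˢ h) ds`, for `h(s) = k e^{-iρsr} H(s)`. -/
theorem intervalIntegral_halfWave {t : ℝ} (ht : t ∈ Icc 0 T) (ρ : ℝ) (c : L2) (k : ℂ)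
    (H : Curve T) :
    ∫ s in (0 : ℝ)..t, Complex.I • waveOp (ρ * s) (c + primitive s (k • twist (-ρ) H)) =
      primOp ρ t c + ∫ σ in (0 : ℝ)..t, k • primOp ρ (t - σ) (H σ) := by
  have hsub : uIcc 0 t ⊆ Icc 0 T := by
    rw [uIcc_of_le ht.1]; exact Icc_subset_Icc_right ht.2
  have e1 : ∫ s in (0 : ℝ)..t, Complex.I • waveOp (ρ * s) (c + primitive s (k • twist (-ρ) H)) =
      (∫ s in (0 : ℝ)..t, Complex.I • waveOp (ρ * s) c) +
        ∫ s in (0 : ℝ)..t, Complex.I • waveOp (ρ * s) (primitive s (k • twist (-ρ) H)) := by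
    rw [← intervalIntegral.integral_add ((continuous_waveOp_left ρ c).intervalIntegrable _ _)
      ((continuousOn_waveOp_primitive ρ _).mono hsub).intervalIntegrable]
    refine intervalIntegral.integral_congr fun s _ => ?_
    simp only [map_add, smul_add]
  rw [e1, intervalIntegral_waveOp, primOp_zero, sub_zero, intervalIntegral_waveOp_primitive ht]
  congr 1
  refine intervalIntegral.integral_congr_ae_restrict ?_
  rw [uIoc_of_le ht.1]
  have hsub : Ioc 0 t ⊆ Icc 0 T := fun s hs => ⟨hs.1.le, hs.2.trans ht.2⟩
  filter_upwards [ae_restrict_of_ae_restrict_of_subset hsub (twist_coe (-ρ) H),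
    ae_restrict_of_ae_restrict_of_subset hsub (Lp.coeFn_smul k (twist (-ρ) H))] with σ h1 h2
  rw [primOp_sub, h2, Pi.smul_apply, h1, map_smul, map_smul, ← waveOp_add]
  congr 3
  rw [show ρ * σ + -ρ * σ = 0 by ring, waveOp_zero]

/-- `∫₀ᵗ velocityCurve`. -/
def displacement (g₀ g₁ : L2) (G : Curve T) (t : ℝ) : L2 :=
  ∫ s in (0 : ℝ)..t, velocityCurve g₀ g₁ G s

theorem displacement_eq {t : ℝ} (ht : t ∈ Icc 0 T) (g₀ g₁ : L2) (G : Curve T) :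
    displacement g₀ g₁ G t =
      (primOp 1 t ((1 / 2 : ℂ) • g₀ - (Complex.I / 2) • g₁) -
        primOp (-1) t ((1 / 2 : ℂ) • g₀ + (Complex.I / 2) • g₁)) +
      ∫ σ in (0 : ℝ)..t, Complex.I • (primOp 1 (t - σ) (G σ) + primOp (-1) (t - σ) (G σ)) := by
  have hsub : uIcc 0 t ⊆ Icc 0 T := by
    rw [uIcc_of_le ht.1]; exact Icc_subset_Icc_right ht.2
  have hc := continuousOn_halfWaves g₀ g₁ G
  have c1 : ContinuousOn (fun s => Complex.I • waveOp (1 * s) (halfWavePos g₀ g₁ G s)) (uIcc 0 t) :=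
    ((continuous_const_smul Complex.I).comp_continuousOn hc.1).mono hsub
  have c2 : ContinuousOn (fun s => Complex.I • waveOp (-1 * s) (halfWaveNeg g₀ g₁ G s))
      (uIcc 0 t) := ((continuous_const_smul Complex.I).comp_continuousOn hc.2).mono hsub
  have e1 : displacement g₀ g₁ G t =
      (∫ s in (0 : ℝ)..t, Complex.I • waveOp (1 * s) (halfWavePos g₀ g₁ G s)) -
      ∫ s in (0 : ℝ)..t, Complex.I • waveOp (-1 * s) (halfWaveNeg g₀ g₁ G s) := by
    rw [← intervalIntegral.integral_sub c1.intervalIntegrable c2.intervalIntegrable]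
    refine intervalIntegral.integral_congr fun s _ => ?_
    simp only [velocityCurve, smul_sub]
  have f1 := intervalIntegral_halfWave ht 1 ((1 / 2 : ℂ) • g₀ - (Complex.I / 2) • g₁) Complex.I G
  have f2 := intervalIntegral_halfWave ht (-1) ((1 / 2 : ℂ) • g₀ + (Complex.I / 2) • g₁)
    (-Complex.I) G
  rw [neg_neg] at f2
  have i1 : IntervalIntegrable (fun σ => Complex.I • primOp 1 (t - σ) (G σ)) volume 0 t :=
    (intervalIntegrable_primOp ht 1 G).smul Complex.I
  have i2 : IntervalIntegrable (fun σ => Complex.I • primOp (-1) (t - σ) (G σ)) volume 0 t :=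
    (intervalIntegrable_primOp ht (-1) G).smul Complex.I
  simp only [smul_add]
  rw [e1, intervalIntegral.integral_add i1 i2]
  simp only [halfWavePos, halfWaveNeg]
  rw [f1, f2]
  simp only [neg_smul, intervalIntegral.integral_neg]
  abel

end VelocityIntegral

/-! ### Duhamel's formula on the Fourier side -/

section Duhamel

/-- The fundamental theorem of calculus, stated without division by r so that it also holds at the
origin. -/
theorem freq_mul_primSymbol (ρ t : ℝ) (ξ : Plane) :
    ((ρ * (2 * Real.pi * ‖ξ‖) : ℝ) : ℂ) * primSymbol ρ t ξ =
      Complex.exp (((ρ * t * (2 * Real.pi * ‖ξ‖) : ℝ) : ℂ) * Complex.I) - 1 := by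
  have hd : ∀ s ∈ uIcc 0 t, HasDerivAt (fun s : ℝ =>
      Complex.exp (((ρ * s * (2 * Real.pi * ‖ξ‖) : ℝ) : ℂ) * Complex.I))
      (((ρ * (2 * Real.pi * ‖ξ‖) : ℝ) : ℂ) * (Complex.I *
        Complex.exp (((ρ * s * (2 * Real.pi * ‖ξ‖) : ℝ) : ℂ) * Complex.I))) s := fun s _ => by
    have h1 : HasDerivAt (fun s : ℝ => (ρ * s * (2 * Real.pi * ‖ξ‖) : ℝ))
        (ρ * 1 * (2 * Real.pi * ‖ξ‖)) s := ((hasDerivAt_id s).const_mul ρ).mul_const _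
    have h2 := (h1.ofReal_comp.mul_const Complex.I).cexp
    convert h2 using 1
    push_cast
    ring
  have h := intervalIntegral.integral_eq_sub_of_hasDerivAt hd
    (Continuous.intervalIntegrable (by fun_prop) _ _)
  rw [intervalIntegral.integral_const_mul] at h
  rw [primSymbol, h]
  simp

theorem primSymbol_of_norm_eq_zero (ρ t : ℝ) {ξ : Plane} (h : ‖ξ‖ = 0) :
    primSymbol ρ t ξ = t * Complex.I := by
  simp [primSymbol, h]

theorem primSymbol_sub_eq (t : ℝ) (ξ : Plane) :
    ((2 * Real.pi * ‖ξ‖ : ℝ) : ℂ) * ((1 / 2) * (primSymbol 1 t ξ - primSymbol (-1) t ξ)) =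
      ((Real.cos (t * (2 * Real.pi * ‖ξ‖)) : ℝ) : ℂ) - 1 := by
  have h1 := freq_mul_primSymbol 1 t ξ
  have h2 := freq_mul_primSymbol (-1) t ξ
  rw [show ((-1 * t * (2 * Real.pi * ‖ξ‖) : ℝ) : ℂ) * Complex.I =
    -((t * (2 * Real.pi * ‖ξ‖) : ℝ) : ℂ) * Complex.I by push_cast; ring] at h2
  rw [one_mul, one_mul] at h1
  push_cast at h1 h2 ⊢
  rw [Complex.cos]
  linear_combination (1 / 2) * h1 + (1 / 2) * h2

theorem primSymbol_add_eq (t : ℝ) (ξ : Plane) :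
    -(Complex.I / 2) * (primSymbol 1 t ξ + primSymbol (-1) t ξ) =
      ((t * Real.sinc (t * (2 * Real.pi * ‖ξ‖)) : ℝ) : ℂ) := by
  rcases eq_or_ne ‖ξ‖ 0 with h | h
  · rw [primSymbol_of_norm_eq_zero _ _ h, primSymbol_of_norm_eq_zero _ _ h, h]
    simp only [mul_zero, Real.sinc_zero, mul_one]
    linear_combination (-(t : ℂ)) * Complex.I_mul_I
  have hr : (2 * Real.pi * ‖ξ‖ : ℝ) ≠ 0 := by positivity
  have hs : (2 * Real.pi * ‖ξ‖ : ℝ) * (t * Real.sinc (t * (2 * Real.pi * ‖ξ‖))) =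
      Real.sin (t * (2 * Real.pi * ‖ξ‖)) := by
    rcases eq_or_ne t 0 with rfl | ht
    · simp
    rw [Real.sinc_of_ne_zero (mul_ne_zero ht hr)]
    field_simp
  refine mul_left_cancel₀ (Complex.ofReal_ne_zero.2 hr) ?_
  rw [← Complex.ofReal_mul, hs]
  have h1 := freq_mul_primSymbol 1 t ξ
  have h2 := freq_mul_primSymbol (-1) t ξ
  rw [show ((-1 * t * (2 * Real.pi * ‖ξ‖) : ℝ) : ℂ) * Complex.I =
    -((t * (2 * Real.pi * ‖ξ‖) : ℝ) : ℂ) * Complex.I by push_cast; ring] at h2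
  rw [one_mul, one_mul] at h1
  push_cast at h1 h2 ⊢
  rw [Complex.sin]
  linear_combination (-(Complex.I / 2)) * h1 + (Complex.I / 2) * h2

/-- `cos(tr) φ`. -/
def cosTest (t : ℝ) (φ : 𝓢(Plane, ℂ)) : 𝓢(Plane, ℂ) :=
  SchwartzMap.smulLeftCLM ℂ (fun ξ : Plane => ((Real.cos (t * (2 * Real.pi * ‖ξ‖)) : ℝ) : ℂ)) φ

/-- `(sin(tr) / r) φ`. -/
def sinTest (t : ℝ) (φ : 𝓢(Plane, ℂ)) : 𝓢(Plane, ℂ) :=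
  SchwartzMap.smulLeftCLM ℂ
    (fun ξ : Plane => ((t * Real.sinc (t * (2 * Real.pi * ‖ξ‖)) : ℝ) : ℂ)) φ

theorem cosTest_apply (t : ℝ) (φ : 𝓢(Plane, ℂ)) (ξ : Plane) :
    cosTest t φ ξ = ((Real.cos (t * (2 * Real.pi * ‖ξ‖)) : ℝ) : ℂ) * φ ξ := by
  rw [cosTest, SchwartzMap.smulLeftCLM_apply_apply (hasTemperateGrowth_cosSymbol t), smul_eq_mul]

theorem sinTest_apply (t : ℝ) (φ : 𝓢(Plane, ℂ)) (ξ : Plane) :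
    sinTest t φ ξ = ((t * Real.sinc (t * (2 * Real.pi * ‖ξ‖)) : ℝ) : ℂ) * φ ξ := by
  rw [sinTest, SchwartzMap.smulLeftCLM_apply_apply (hasTemperateGrowth_sinSymbol t), smul_eq_mul]

theorem fourier_cosProp (t : ℝ) (f : Dist) (φ : 𝓢(Plane, ℂ)) :
    cosProp t f (𝓕 φ) = (𝓕 f) (cosTest t φ) := by
  rw [← TemperedDistribution.fourier_apply, cosProp,
    TemperedDistribution.fourierMultiplierCLM_apply, FourierTransform.fourier_fourierInv_eq,
    TemperedDistribution.smulLeftCLM_apply_apply]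
  rfl

theorem fourier_sinProp (t : ℝ) (f : Dist) (φ : 𝓢(Plane, ℂ)) :
    sinProp t f (𝓕 φ) = (𝓕 f) (sinTest t φ) := by
  rw [← TemperedDistribution.fourier_apply, sinProp,
    TemperedDistribution.fourierMultiplierCLM_apply, FourierTransform.fourier_fourierInv_eq,
    TemperedDistribution.smulLeftCLM_apply_apply]
  rfl

/-- The Fourier side of `IsFracLaplacian (1/2)`. -/
theorem IsFracLaplacian.half {f : Dist} {g : L2} (h : IsFracLaplacian (1 / 2) f g)
    (φ : 𝓢(Plane, ℂ)) : (𝓕 f) φ = pairing (sobWeight (1 / 2) φ) (𝓕 g) := by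
  rw [h φ (fun h1 => by norm_num at h1), pairing_apply (memLp_sobWeight_half φ)]
  rfl

/-- The Fourier side of `IsFracLaplacian (3/2)`. -/
theorem IsFracLaplacian.three_half {f : Dist} {g : L2} (h : IsFracLaplacian (3 / 2) f g)
    {φ : 𝓢(Plane, ℂ)} (h0 : φ 0 = 0) : (𝓕 f) φ = pairing (sobWeight (3 / 2) φ) (𝓕 g) := by
  rw [h φ (fun _ => h0), pairing_apply (memLp_sobWeight_three_half φ h0)]
  rfl

/-- `(sin(tr) / r) a`. -/
def sincOp (t : ℝ) (a : L2) : L2 := -(Complex.I / 2) • (primOp 1 t a + primOp (-1) t a)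

theorem sincOp_coe (t : ℝ) (a : L2) : sincOp t a =ᵐ[volume]
    fun ξ => ((t * Real.sinc (t * (2 * Real.pi * ‖ξ‖)) : ℝ) : ℂ) • a ξ := by
  filter_upwards [Lp.coeFn_smul (-(Complex.I / 2)) (primOp 1 t a + primOp (-1) t a),
    Lp.coeFn_add (primOp 1 t a) (primOp (-1) t a), primOp_coe 1 t a, primOp_coe (-1) t a]
    with ξ h1 h2 h3 h4
  rw [sincOp, h1, Pi.smul_apply, h2, Pi.add_apply, h3, h4, ← add_smul, smul_smul,
    primSymbol_add_eq]

theorem pairing_sincOp (t : ℝ) (φ : 𝓢(Plane, ℂ)) (a : L2) :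
    pairing (sobWeight (1 / 2) φ) (sincOp t a) = pairing (sobWeight (1 / 2) (sinTest t φ)) a := by
  rw [pairing_apply (memLp_sobWeight_half _), pairing_apply (memLp_sobWeight_half _)]
  refine integral_congr_ae ?_
  filter_upwards [sincOp_coe t a] with ξ h
  rw [h, smul_smul, sobWeight, sobWeight, sinTest_apply]
  congr 1
  ring

theorem sinProp_eq_pairing {f : Dist} {g : L2} (h : IsFracLaplacian (1 / 2) f g) (t : ℝ)
    (φ : 𝓢(Plane, ℂ)) :
    sinProp t f (𝓕 φ) = pairing (sobWeight (1 / 2) φ) (sincOp t (𝓕 g)) := by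
  rw [fourier_sinProp, h.half, pairing_sincOp]

theorem rpow_neg_half_eq {x : ℝ} (hx : 0 < x) : x ^ (-(1 / 2) : ℝ) = x ^ (-(3 / 2) : ℝ) * x := by
  rw [← Real.rpow_add_one hx.ne']; norm_num

theorem sobWeight_half_eq (φ : 𝓢(Plane, ℂ)) {ξ : Plane} (hξ : ξ ≠ 0) :
    sobWeight (1 / 2) φ ξ = sobWeight (3 / 2) φ ξ * ((2 * Real.pi * ‖ξ‖ : ℝ) : ℂ) := by
  have : 0 < ‖ξ‖ := norm_pos_iff.2 hξ
  rw [sobWeight, sobWeight, rpow_neg_half_eq (by positivity), Complex.ofReal_mul _ (2 * Real.pi * ‖ξ‖),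
    mul_assoc (φ ξ)]

theorem cosTest_sub_apply_zero (t : ℝ) (φ : 𝓢(Plane, ℂ)) : (cosTest t φ - φ) 0 = 0 := by
  rw [_root_.sub_apply, cosTest_apply]
  simp

/-- The function (cos(tr) - 1)φ vanishes at the origin, so it may be tested in the identity of order
3/2. The unknown additive constant of f stays in the separate term 𝓕f(φ), and cos(tr) - 1 supplies
the factor r that lowers the order to 1/2. -/
theorem cosProp_eq_pairing {f : Dist} {g : L2} (h : IsFracLaplacian (3 / 2) f g) (t : ℝ)
    (φ : 𝓢(Plane, ℂ)) : cosProp t f (𝓕 φ) = (𝓕 f) φ + pairing (sobWeight (1 / 2) φ)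
      ((1 / 2 : ℂ) • (primOp 1 t (𝓕 g) - primOp (-1) t (𝓕 g))) := by
  have h0 := cosTest_sub_apply_zero t φ
  rw [fourier_cosProp, ← sub_eq_iff_eq_add', ← map_sub, h.three_half h0,
    pairing_apply (memLp_sobWeight_half _), pairing_apply (memLp_sobWeight_three_half _ h0)]
  refine integral_congr_ae ?_
  filter_upwards [Lp.coeFn_smul (1 / 2 : ℂ) (primOp 1 t (𝓕 g) - primOp (-1) t (𝓕 g)),
    Lp.coeFn_sub (primOp 1 t (𝓕 g)) (primOp (-1) t (𝓕 g)), primOp_coe 1 t (𝓕 g),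
    primOp_coe (-1) t (𝓕 g), Measure.ae_ne volume (0 : Plane)]
    with ξ h1 h2 h3 h4 hξ
  rw [h1, Pi.smul_apply, h2, Pi.sub_apply, h3, h4, ← sub_smul, smul_smul, smul_smul,
    sobWeight_half_eq φ hξ]
  congr 1
  have h5 := primSymbol_sub_eq t ξ
  have h6 : sobWeight (3 / 2) (cosTest t φ - φ) ξ = sobWeight (3 / 2) φ ξ *
      (((Real.cos (t * (2 * Real.pi * ‖ξ‖)) : ℝ) : ℂ) - 1) := by
    rw [sobWeight, sobWeight, _root_.sub_apply, cosTest_apply]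
    ring
  rw [h6]
  linear_combination (-(sobWeight (3 / 2) φ ξ)) * h5

variable {T : ℝ}

theorem displacement_eq_sincOp {t : ℝ} (ht : t ∈ Icc 0 T) (g₀ g₁ : L2) (G : Curve T) :
    displacement g₀ g₁ G t = (1 / 2 : ℂ) • (primOp 1 t g₀ - primOp (-1) t g₀) + sincOp t g₁ -
      ∫ σ in (0 : ℝ)..t, (2 : ℂ) • sincOp (t - σ) (G σ) := by
  have e : ∀ x : L2, Complex.I • x = -((2 : ℂ) • -(Complex.I / 2) • x) := fun x => by
    rw [smul_smul, ← neg_smul]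
    congr 1
    ring
  rw [displacement_eq ht]
  simp only [sincOp]
  rw [intervalIntegral.integral_congr (g := fun σ => -((2 : ℂ) • -(Complex.I / 2) •
    (primOp 1 (t - σ) (G σ) + primOp (-1) (t - σ) (G σ)))) fun σ _ => e _,
    intervalIntegral.integral_neg, ← sub_eq_add_neg]
  congr 1
  simp only [map_sub, map_add, map_smul]
  module

theorem intervalIntegrable_sincOp {t : ℝ} (ht : t ∈ Icc 0 T) (G : Curve T) :
    IntervalIntegrable (fun σ => (2 : ℂ) • sincOp (t - σ) (G σ)) volume 0 t := by
  have h1 := (intervalIntegrable_primOp ht 1 G).add (intervalIntegrable_primOp ht (-1) G)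
  have h2 := (h1.smul (-(Complex.I / 2))).smul (2 : ℂ)
  exact h2

/-- Duhamel's formula on the Fourier side. -/
theorem duhamel_fourier {u₀ u₁ : Dist} {g₀ g₁ : L2} {F : ℝ → Dist} {H : Curve T}
    (h₀ : IsFracLaplacian (3 / 2) u₀ g₀) (h₁ : IsFracLaplacian (1 / 2) u₁ g₁)
    (hF : ∀ᵐ t ∂(volume.restrict (Icc 0 T)), IsFracLaplacian (1 / 2) (F t) (𝓕⁻ (H t)))
    {t : ℝ} (ht : t ∈ Icc 0 T) (φ : 𝓢(Plane, ℂ)) :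
    IntervalIntegrable (fun s => sinProp (t - s) ((2 : ℂ) • F s) (𝓕 φ)) volume 0 t ∧
    cosProp t u₀ (𝓕 φ) + sinProp t u₁ (𝓕 φ) -
      (∫ s in (0 : ℝ)..t, sinProp (t - s) ((2 : ℂ) • F s) (𝓕 φ)) =
    (𝓕 u₀) φ + pairing (sobWeight (1 / 2) φ) (displacement (𝓕 g₀) (𝓕 g₁) H t) := by
  have hI := intervalIntegrable_sincOp ht H
  set P := pairing (sobWeight (1 / 2) φ) with hP
  have hsub : Ioc 0 t ⊆ Icc 0 T := fun s hs => ⟨hs.1.le, hs.2.trans ht.2⟩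
  have hae : ∀ᵐ s ∂(volume.restrict (uIoc 0 t)), P ((2 : ℂ) • sincOp (t - s) (H s)) =
      sinProp (t - s) ((2 : ℂ) • F s) (𝓕 φ) := by
    rw [uIoc_of_le ht.1]
    filter_upwards [ae_restrict_of_ae_restrict_of_subset hsub hF] with s hs
    have h := hs.half (sinTest (t - s) φ)
    rw [FourierTransform.fourier_fourierInv_eq] at h
    have e : sinProp (t - s) ((2 : ℂ) • F s) (𝓕 φ) = (2 : ℂ) • (𝓕 (F s)) (sinTest (t - s) φ) := by
      rw [fourier_sinProp]; rfl
    rw [e, h, map_smul, pairing_sincOp]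
  have hPI : IntervalIntegrable (fun s => P ((2 : ℂ) • sincOp (t - s) (H s))) volume 0 t :=
    ⟨P.integrable_comp hI.1, P.integrable_comp hI.2⟩
  refine ⟨hPI.congr_ae hae, ?_⟩
  rw [← intervalIntegral.integral_congr_ae_restrict hae, P.intervalIntegral_comp_comm hI,
    cosProp_eq_pairing h₀, sinProp_eq_pairing h₁, displacement_eq_sincOp ht, map_sub, map_add]
  abel

/-- The integral equation becomes an explicit formula for û(t) on all test functions. The forcing
enters only through its half derivative H, known for almost every time. -/
theorem solvesDuhamel_iff {u₀ u₁ : Dist} {g₀ g₁ : L2} {F u : ℝ → Dist} {H : Curve T}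
    (h₀ : IsFracLaplacian (3 / 2) u₀ g₀) (h₁ : IsFracLaplacian (1 / 2) u₁ g₁)
    (hF : ∀ᵐ t ∂(volume.restrict (Icc 0 T)), IsFracLaplacian (1 / 2) (F t) (𝓕⁻ (H t))) :
    SolvesDuhamel T u₀ u₁ F u ↔ ∀ t ∈ Icc 0 T, ∀ φ : 𝓢(Plane, ℂ), (𝓕 (u t)) φ =
      (𝓕 u₀) φ + pairing (sobWeight (1 / 2) φ) (displacement (𝓕 g₀) (𝓕 g₁) H t) := by
  constructor
  · intro h t ht φ
    rw [← (duhamel_fourier h₀ h₁ hF ht φ).2, ← (h t ht (𝓕 φ)).2, TemperedDistribution.fourier_apply]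
  · intro h t ht ψ
    have hd := duhamel_fourier h₀ h₁ hF ht (𝓕⁻ ψ)
    rw [← h t ht, TemperedDistribution.fourier_apply, FourierTransform.fourier_fourierInv_eq] at hd
    exact ⟨hd.1, hd.2.symm⟩

/-- Multiplying the primitive of the group by r gives ρ(e^{iρτr} - 1), since ρ² = 1. This trades the
weight r^{-1/2} for r^{-3/2}, at the price of test functions vanishing at the origin. -/
theorem pairing_primOp (ρ τ : ℝ) (hρ : ρ = 1 ∨ ρ = -1) {φ : 𝓢(Plane, ℂ)} (h0 : φ 0 = 0) (b : L2) :
    pairing (sobWeight (1 / 2) φ) (primOp ρ τ b) =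
      (ρ : ℂ) • pairing (sobWeight (3 / 2) φ) (waveOp (ρ * τ) b - b) := by
  have hρ2 : (ρ : ℂ) * ρ = 1 := by rcases hρ with rfl | rfl <;> norm_num
  rw [pairing_apply (memLp_sobWeight_half _), pairing_apply (memLp_sobWeight_three_half _ h0),
    ← integral_smul]
  refine integral_congr_ae ?_
  filter_upwards [primOp_coe ρ τ b, Lp.coeFn_sub (waveOp (ρ * τ) b) b, waveOp_coe (ρ * τ) b,
    Measure.ae_ne volume (0 : Plane)] with ξ h1 h2 h3 hξ
  have h5 := freq_mul_primSymbol ρ τ ξ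
  have e : sobWeight (1 / 2) φ ξ * primSymbol ρ τ ξ = ρ * (sobWeight (3 / 2) φ ξ *
      (Complex.exp (((ρ * τ * (2 * Real.pi * ‖ξ‖) : ℝ) : ℂ) * Complex.I) - 1)) := by
    rw [← h5, sobWeight_half_eq φ hξ, Complex.ofReal_mul ρ]
    linear_combination (-(sobWeight (3 / 2) φ ξ * ((2 * Real.pi * ‖ξ‖ : ℝ) : ℂ) *
      primSymbol ρ τ ξ)) * hρ2
  rw [h1, h2, Pi.sub_apply, h3, smul_smul, e, mul_smul, mul_smul, sub_smul, one_smul]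

theorem intervalIntegrable_waveOp_curve {t : ℝ} (ht : t ∈ Icc 0 T) (ρ : ℝ) (h : Curve T) :
    IntervalIntegrable (fun σ => waveOp (ρ * (t - σ)) (h σ)) volume 0 t := by
  have hih := intervalIntegrable_curve h ht
  rw [intervalIntegrable_iff_integrableOn_Ioc_of_le ht.1] at hih ⊢
  have h1 : AEStronglyMeasurable (fun σ : ℝ => ρ * (t - σ)) (volume.restrict (Ioc 0 t)) :=
    (by fun_prop : Continuous fun σ : ℝ => ρ * (t - σ)).aestronglyMeasurable
  have h2 := continuous_waveOp.comp_aestronglyMeasurable (h1.prodMk hih.1)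
  exact Integrable.mono hih h2 (Filter.Eventually.of_forall fun σ => norm_waveOp_le _ _)

/-- This is r times the displacement being the change of state: (r^{3/2}û)(t) - (r^{3/2}û)(0) = r∫₀ᵗ
r^{1/2}∂_tû ds. It identifies the Ḣ^{3/2} representative of u(t). -/
theorem pairing_displacement {t : ℝ} (ht : t ∈ Icc 0 T) {φ : 𝓢(Plane, ℂ)} (h0 : φ 0 = 0)
    (g₀ g₁ : L2) (G : Curve T) :
    pairing (sobWeight (1 / 2) φ) (displacement g₀ g₁ G t) =
      pairing (sobWeight (3 / 2) φ) (stateCurve g₀ g₁ G t - g₀) := by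
  have p1 := fun τ b => pairing_primOp 1 τ (Or.inl rfl) h0 b
  have p2 := fun τ b => pairing_primOp (-1) τ (Or.inr rfl) h0 b
  set P := pairing (sobWeight (1 / 2) φ)
  set Q := pairing (sobWeight (3 / 2) φ)
  have i1 := intervalIntegrable_primOp ht 1 G
  have i2 := intervalIntegrable_primOp ht (-1) G
  have i3 : IntervalIntegrable
      (fun σ => Complex.I • (primOp 1 (t - σ) (G σ) + primOp (-1) (t - σ) (G σ))) volume 0 t :=
    (i1.add i2).smul Complex.I
  have w1 : IntervalIntegrable (fun σ => Complex.I • waveOp (1 * (t - σ)) (G σ)) volume 0 t :=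
    (intervalIntegrable_waveOp_curve ht 1 G).smul Complex.I
  have w2 : IntervalIntegrable (fun σ => -Complex.I • waveOp (-1 * (t - σ)) (G σ)) volume 0 t :=
    (intervalIntegrable_waveOp_curve ht (-1) G).smul (-Complex.I)
  have e1 : P (∫ σ in (0 : ℝ)..t, Complex.I • (primOp 1 (t - σ) (G σ) + primOp (-1) (t - σ) (G σ))) =
      Q ((∫ σ in (0 : ℝ)..t, Complex.I • waveOp (1 * (t - σ)) (G σ)) +
        ∫ σ in (0 : ℝ)..t, -Complex.I • waveOp (-1 * (t - σ)) (G σ)) := by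
    rw [← intervalIntegral.integral_add w1 w2, ← P.intervalIntegral_comp_comm i3,
      ← Q.intervalIntegral_comp_comm (w1.add w2)]
    refine intervalIntegral.integral_congr fun σ _ => ?_
    simp only [map_smul, map_add, p1, p2, map_sub, Complex.ofReal_neg, Complex.ofReal_one]
    module
  have f1 := waveOp_primitive ht 1 Complex.I G
  have f2 := waveOp_primitive ht (-1) (-Complex.I) G
  rw [neg_neg] at f2
  rw [displacement_eq ht, map_add, e1, ← f1, ← f2]
  simp only [stateCurve, halfWavePos, halfWaveNeg, map_sub, map_add, map_smul, p1, p2,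
    Complex.ofReal_neg, Complex.ofReal_one]
  module

end Duhamel

/-! ### The potential (-Δ)^{-1/4} and uniqueness of fractional Laplacians -/

section Potential

/-- The symbol of `(-Δ)^{-1/4}`. -/
def potentialSymbol (ξ : Plane) : ℂ := (((2 * Real.pi * ‖ξ‖) ^ (-(1 / 2) : ℝ) : ℝ) : ℂ)

theorem measurable_potentialSymbol : Measurable potentialSymbol := by
  unfold potentialSymbol
  fun_prop

theorem norm_potentialSymbol_le (ξ : Plane) :
    ‖potentialSymbol ξ‖ ≤ (√(2 * Real.pi))⁻¹ * (√‖ξ‖)⁻¹ := by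
  rw [potentialSymbol, Complex.norm_real, Real.norm_of_nonneg (by positivity), ← mul_inv,
    ← Real.sqrt_mul (by positivity), Real.sqrt_eq_rpow, ← Real.rpow_neg (by positivity)]

theorem integrable_potentialLow_smul (b : L2) : Integrable fun ξ =>
    (Metric.closedBall (0 : Plane) 1).indicator potentialSymbol ξ • b ξ :=
  integrable_smul_of_memLp_two
    (memLp_two_lowFreq measurable_potentialSymbol norm_potentialSymbol_le) (Lp.memLp b)

theorem memLp_potentialHigh :
    MemLp (((Metric.closedBall (0 : Plane) 1)ᶜ : Set Plane).indicator potentialSymbol) ∞ volume :=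
  memLp_top_of_bound (measurable_potentialSymbol.indicator
    measurableSet_closedBall.compl).aestronglyMeasurable 1
    (Filter.Eventually.of_forall (norm_highFreq_le norm_potentialSymbol_le))

/-- The distribution `f` with `𝓕 f = (2π|ξ|)^{-1/2} b`. -/
def potential (b : L2) : Dist :=
  𝓕⁻ (Lp.toTemperedDistribution (memLp_one_iff_integrable.2 (integrable_potentialLow_smul b)).toLp +
    Lp.toTemperedDistribution
      (mulOp (((Metric.closedBall (0 : Plane) 1)ᶜ : Set Plane).indicator potentialSymbol) b) : Dist)

theorem fourier_potential (b : L2) (φ : 𝓢(Plane, ℂ)) :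
    (𝓕 (potential b)) φ = pairing (sobWeight (1 / 2) φ) b := by
  have h1 := (memLp_one_iff_integrable.2 (integrable_potentialLow_smul b))
  set h := mulOp (((Metric.closedBall (0 : Plane) 1)ᶜ : Set Plane).indicator potentialSymbol) b
    with hh
  have e : (𝓕 (potential b)) φ = (Lp.toTemperedDistribution h1.toLp : Dist) φ +
      (Lp.toTemperedDistribution h : Dist) φ := by
    rw [potential, FourierTransform.fourier_fourierInv_eq]
    rfl
  have hφ : MemLp φ 2 (volume : Measure Plane) := φ.memLp 2
  have i1 : Integrable fun ξ => φ ξ • (h1.toLp : Plane → C3) ξ := by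
    obtain ⟨C, _, hC⟩ := schwartz_decay φ 0
    refine Integrable.bdd_smul ((integrable_potentialLow_smul b).congr h1.coeFn_toLp.symm) C
      φ.continuous.aestronglyMeasurable (Filter.Eventually.of_forall fun ξ => ?_)
    simpa using hC ξ
  have i2 : Integrable fun ξ => φ ξ • h ξ := integrable_smul_of_memLp_two hφ (Lp.memLp h)
  rw [e, Lp.toTemperedDistribution_apply, Lp.toTemperedDistribution_apply, ← integral_add i1 i2,
    pairing_apply (memLp_sobWeight_half _)]
  refine integral_congr_ae ?_
  filter_upwards [h1.coeFn_toLp, mulOp_coe memLp_potentialHigh b] with ξ e1 e2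
  rw [e1, hh, e2, ← smul_add, ← add_smul, Set.indicator_self_add_compl_apply, smul_smul]
  rfl

theorem isFracLaplacian_potential (b : L2) : IsFracLaplacian (1 / 2) (potential b) (𝓕⁻ b) :=
  fun φ _ => by
    rw [fourier_potential, FourierTransform.fourier_fourierInv_eq,
      pairing_apply (memLp_sobWeight_half _)]
    rfl

theorem dist_ext_fourier {f g : Dist} (h : ∀ φ, (𝓕 f) φ = (𝓕 g) φ) : f = g := by
  have e : 𝓕 f = 𝓕 g := by ext1 φ; exact h φ
  rw [← FourierTransform.fourierInv_fourier_eq (F := Dist) f, e,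
    FourierTransform.fourierInv_fourier_eq]

theorem IsFracLaplacian.unique_half {f : Dist} {g g' : L2} (h : IsFracLaplacian (1 / 2) f g)
    (h' : IsFracLaplacian (1 / 2) f g') : g = g' := by
  have e : (𝓕 g - 𝓕 g' : L2) = 0 := by
    refine eq_zero_of_forall_pairing (s := 1 / 2) _ fun φ _ => ?_
    have := (h.half φ).symm.trans (h'.half φ)
    rw [← sub_eq_zero, ← map_sub, pairing_apply (memLp_sobWeight_half φ)] at this
    exact this
  have e' := congrArg (fun x : L2 => (𝓕⁻ x : L2)) (sub_eq_zero.1 e)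
  simpa only [FourierTransform.fourierInv_fourier_eq] using e'

theorem IsFracLaplacian.unique_three_half {f : Dist} {g g' : L2}
    (h : IsFracLaplacian (3 / 2) f g) (h' : IsFracLaplacian (3 / 2) f g') : g = g' := by
  have e : (𝓕 g - 𝓕 g' : L2) = 0 := by
    refine eq_zero_of_forall_pairing (s := 3 / 2) _ fun φ h0 => ?_
    have := (h.three_half h0).symm.trans (h'.three_half h0)
    rw [← sub_eq_zero, ← map_sub, pairing_apply (memLp_sobWeight_three_half φ h0)] at this
    exact this
  have e' := congrArg (fun x : L2 => (𝓕⁻ x : L2)) (sub_eq_zero.1 e)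
  simpa only [FourierTransform.fourierInv_fourier_eq] using e'

/-- The infimum in the definition runs over a single element. -/
theorem hdotNorm_half_eq {f : Dist} {g : L2} (h : IsFracLaplacian (1 / 2) f g) :
    hdotNorm (1 / 2) f = ‖g‖ₑ :=
  le_antisymm (iInf₂_le g h) (le_iInf₂ fun g' h' => by rw [h.unique_half h'])

theorem hdotNorm_three_half_eq {f : Dist} {g : L2} (h : IsFracLaplacian (3 / 2) f g) :
    hdotNorm (3 / 2) f = ‖g‖ₑ :=
  le_antisymm (iInf₂_le g h) (le_iInf₂ fun g' h' => by rw [h.unique_three_half h'])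

theorem exists_isFracLaplacian_of_hdotNorm_lt {s : ℝ} {f : Dist} (h : hdotNorm s f < ∞) :
    ∃ g, IsFracLaplacian s f g := by
  rw [hdotNorm, iInf_lt_iff] at h
  obtain ⟨g, hg⟩ := h
  rw [iInf_lt_iff] at hg
  exact ⟨g, hg.1⟩

theorem IsFracLaplacian.sub {s : ℝ} (hs : s = 1 / 2 ∨ s = 3 / 2) {f f' : Dist} {g g' : L2}
    (h : IsFracLaplacian s f g) (h' : IsFracLaplacian s f' g') :
    IsFracLaplacian s (f - f') (g - g') := fun φ hφ => by
  have e1 : (𝓕 (f - f')) φ = (𝓕 f) φ - (𝓕 f') φ := by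
    have e := map_sub (FourierTransform.fourierCLM ℂ Dist) f f'
    exact congrArg (fun x : Dist => x φ) e
  have e2 : (𝓕 (g - g') : L2) = 𝓕 g - 𝓕 g' := map_sub (FourierTransform.fourierCLM ℂ L2) g g'
  have hm : MemLp (sobWeight s φ) 2 := by
    rcases hs with rfl | rfl
    · exact memLp_sobWeight_half φ
    · exact memLp_sobWeight_three_half φ (hφ (by norm_num))
  rw [e1, h φ hφ, h' φ hφ, e2]
  have := map_sub (pairing (sobWeight s φ)) (𝓕 g) (𝓕 g')
  rw [pairing_apply hm, pairing_apply hm, pairing_apply hm] at this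
  exact this.symm

end Potential

/-! ### Regularity and time derivative of a curve given by its displacement -/

section FourierSolution

variable {T : ℝ}

/-- A curve of distributions with displacement given by the velocity of a wave has fractional
Laplacian given by its state. -/
theorem isFracLaplacian_of_displacement {u₀ f : Dist} {g₀ : L2} {a₁ : L2} {H : Curve T}
    (h₀ : IsFracLaplacian (3 / 2) u₀ g₀) {t : ℝ} (ht : t ∈ Icc 0 T)
    (hu : ∀ φ : 𝓢(Plane, ℂ), (𝓕 f) φ =
      (𝓕 u₀) φ + pairing (sobWeight (1 / 2) φ) (displacement (𝓕 g₀) a₁ H t)) :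
    IsFracLaplacian (3 / 2) f (𝓕⁻ (stateCurve (𝓕 g₀) a₁ H t)) := fun φ hφ => by
  have h0 : φ 0 = 0 := hφ (by norm_num)
  rw [hu φ, h₀.three_half h0, pairing_displacement ht h0, map_sub, add_sub_cancel,
    pairing_apply (memLp_sobWeight_three_half _ h0), FourierTransform.fourier_fourierInv_eq]
  rfl

theorem hasDerivWithinAt_displacement (a₀ a₁ : L2) (H : Curve T) {t : ℝ}
    (ht : t ∈ Icc 0 T) :
    HasDerivWithinAt (displacement a₀ a₁ H) (velocityCurve a₀ a₁ H t) (Icc 0 T) t := by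
  have hc := continuousOn_velocityCurve a₀ a₁ H
  have hi : IntervalIntegrable (velocityCurve a₀ a₁ H) volume 0 t :=
    (hc.mono (by rw [uIcc_of_le ht.1]; exact Icc_subset_Icc_right ht.2)).intervalIntegrable
  have : Fact (t ∈ Icc 0 T) := ⟨ht⟩
  exact intervalIntegral.integral_hasDerivWithinAt_right hi
    (hc.stronglyMeasurableAtFilter_nhdsWithin measurableSet_Icc t) (hc t ht)

theorem hasDerivWithinAt_of_displacement {u₀ : Dist} {a₀ a₁ : L2} {H : Curve T}
    {u : ℝ → Dist}
    (hu : ∀ t ∈ Icc 0 T, ∀ φ : 𝓢(Plane, ℂ), (𝓕 (u t)) φ =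
      (𝓕 u₀) φ + pairing (sobWeight (1 / 2) φ) (displacement a₀ a₁ H t)) {t : ℝ}
    (ht : t ∈ Icc 0 T) (φ : 𝓢(Plane, ℂ)) :
    HasDerivWithinAt (fun s => (𝓕 (u s)) φ)
      (pairing (sobWeight (1 / 2) φ) (velocityCurve a₀ a₁ H t)) (Icc 0 T) t := by
  have h1 := ((pairing (sobWeight (1 / 2) φ)).restrictScalars ℝ).hasFDerivAt.comp_hasDerivWithinAt_of_eq t
    (hasDerivWithinAt_displacement a₀ a₁ H ht) rfl
  have h2 := h1.const_add ((𝓕 u₀) φ)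
  exact h2.congr (fun s hs => hu s hs φ) (hu t ht φ)

/-- One-sided derivatives on a nondegenerate interval are unique, so the weak time derivative is
forced to be r^{-1/2} times the velocity on the Fourier side. -/
theorem isTimeDeriv_iff_of_displacement (hT : 0 < T) {u₀ : Dist} {a₀ a₁ : L2} {H : Curve T}
    {u v : ℝ → Dist}
    (hu : ∀ t ∈ Icc 0 T, ∀ φ : 𝓢(Plane, ℂ), (𝓕 (u t)) φ =
      (𝓕 u₀) φ + pairing (sobWeight (1 / 2) φ) (displacement a₀ a₁ H t)) :
    IsTimeDeriv T u v ↔ ∀ t ∈ Icc 0 T, v t = potential (velocityCurve a₀ a₁ H t) := by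
  constructor
  · intro h t ht
    refine dist_ext_fourier fun φ => ?_
    rw [fourier_potential]
    exact (uniqueDiffOn_Icc hT t ht).eq_deriv _ (h t ht (𝓕 φ))
      (hasDerivWithinAt_of_displacement hu ht φ)
  · intro h t ht ψ
    have h1 := hasDerivWithinAt_of_displacement hu ht (𝓕⁻ ψ)
    rw [← fourier_potential, ← h t ht] at h1
    simpa only [TemperedDistribution.fourier_apply, FourierTransform.fourier_fourierInv_eq] using h1

end FourierSolution

open scoped ComplexConjugate

/-! ### Reality as invariance under a(ξ) ↦ conj a(-ξ) -/

section Conjugation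

/-- Complex conjugation of vectors. -/
def conjC3 : C3 ≃ₗᵢ[ℝ] C3 where
  toFun v := WithLp.toLp 2 fun i => conj (v i)
  invFun v := WithLp.toLp 2 fun i => conj (v i)
  map_add' v w := by ext i; simp
  map_smul' r v := by ext i; simp
  left_inv v := by ext i; simp
  right_inv v := by ext i; simp
  norm_map' v := by
    simp [EuclideanSpace.norm_eq]

theorem conjC3_apply (v : C3) (i : Fin 3) : conjC3 v i = conj (v i) := rfl

theorem conjC3_smul (c : ℂ) (v : C3) : conjC3 (c • v) = conj c • conjC3 v := by
  ext i; simp [conjC3_apply]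

theorem conjC3_crossL (v w : C3) : conjC3 (crossL v w) = crossL (conjC3 v) (conjC3 w) := by
  ext i
  simp only [conjC3_apply, crossL_apply, cross_apply]
  fin_cases i <;> simp

theorem conjC3_integral {X : Type*} [MeasurableSpace X] (μ : Measure X) (f : X → C3) :
    conjC3 (∫ x, f x ∂μ) = ∫ x, conjC3 (f x) ∂μ :=
  (conjC3.toContinuousLinearEquiv.integral_comp_comm f).symm

/-- The complex conjugate of a Schwartz function. -/
def schwartzConj (φ : 𝓢(Plane, ℂ)) : 𝓢(Plane, ℂ) :=
  SchwartzMap.postcompCLM (𝕜 := ℝ) (Complex.conjCLE : ℂ →L[ℝ] ℂ) φ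

theorem schwartzConj_apply (φ : 𝓢(Plane, ℂ)) (x : Plane) : schwartzConj φ x = conj (φ x) := rfl

/-- The Schwartz function `conj (φ (-ξ))`. -/
def schwartzRefl (φ : 𝓢(Plane, ℂ)) : 𝓢(Plane, ℂ) :=
  schwartzConj (SchwartzMap.compCLMOfContinuousLinearEquiv ℝ (ContinuousLinearEquiv.neg ℝ) φ)

theorem schwartzRefl_apply (φ : 𝓢(Plane, ℂ)) (x : Plane) :
    schwartzRefl φ x = conj (φ (-x)) := rfl

theorem schwartzRefl_schwartzRefl (φ : 𝓢(Plane, ℂ)) : schwartzRefl (schwartzRefl φ) = φ := by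
  ext x; simp [schwartzRefl_apply]

theorem fourier_schwartzRefl (φ : 𝓢(Plane, ℂ)) : 𝓕 (schwartzRefl φ) = schwartzConj (𝓕 φ) := by
  ext x
  rw [schwartzConj_apply, SchwartzMap.fourier_coe, SchwartzMap.fourier_coe, Real.fourier_eq,
    Real.fourier_eq, ← integral_conj, ← integral_neg_eq_self]
  refine integral_congr_ae (Filter.Eventually.of_forall fun v => ?_)
  simp [schwartzRefl_apply, Circle.smul_def, Real.fourierChar_apply, ← Complex.exp_conj, map_ofNat]

/-- A test function is split into its real and imaginary parts, on each of which f takes real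
values. -/
theorem isReal_iff_conj {f : Dist} : IsReal f ↔ ∀ ψ, f (schwartzConj ψ) = conjC3 (f ψ) := by
  constructor
  · intro h ψ
    have hr : ∀ ψ : 𝓢(Plane, ℂ), (∀ x, (ψ x).im = 0) → conjC3 (f ψ) = f ψ := fun ψ hψ => by
      ext i
      exact Complex.conj_eq_iff_im.2 (h ψ hψ i)
    have h1 := hr ((1 / 2 : ℂ) • (ψ + schwartzConj ψ)) fun x => by
      simp [schwartzConj_apply]
    have h2 := hr ((Complex.I / 2) • (ψ - schwartzConj ψ)) fun x => by
      simp [schwartzConj_apply]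
    simp only [map_smul, map_add, map_sub, conjC3_smul, map_div₀, map_one, map_ofNat,
      Complex.conj_I] at h1 h2
    have h3 := congrArg₂ (fun a b : C3 => a + Complex.I • b) h1 h2
    have e1 : conjC3 (f ψ) = (1 / 2 : ℂ) • (conjC3 (f ψ) + conjC3 (f (schwartzConj ψ))) +
        Complex.I • (-Complex.I / 2) • (conjC3 (f ψ) - conjC3 (f (schwartzConj ψ))) := by
      rw [smul_smul, show Complex.I * (-Complex.I / 2) = 1 / 2 by
        linear_combination (-(1 / 2 : ℂ)) * Complex.I_mul_I]
      module
    have e2 : f (schwartzConj ψ) = (1 / 2 : ℂ) • (f ψ + f (schwartzConj ψ)) +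
        Complex.I • (Complex.I / 2) • (f ψ - f (schwartzConj ψ)) := by
      rw [smul_smul, show Complex.I * (Complex.I / 2) = -(1 / 2) by
        linear_combination (1 / 2 : ℂ) * Complex.I_mul_I]
      module
    exact e2.trans (h3.symm.trans e1.symm)
  · intro h ψ hψ i
    have e : schwartzConj ψ = ψ := by
      ext x
      exact Complex.conj_eq_iff_im.2 (hψ x)
    have := h ψ
    rw [e] at this
    have h2 := congrArg (fun v : C3 => v i) this
    exact Complex.conj_eq_iff_im.1 h2.symm

theorem isReal_iff_fourier {f : Dist} :
    IsReal f ↔ ∀ φ, (𝓕 f) (schwartzRefl φ) = conjC3 ((𝓕 f) φ) := by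
  rw [isReal_iff_conj]
  constructor
  · intro h φ
    rw [TemperedDistribution.fourier_apply, fourier_schwartzRefl, h]
    rfl
  · intro h ψ
    have := h (𝓕⁻ ψ)
    rwa [TemperedDistribution.fourier_apply, fourier_schwartzRefl,
      TemperedDistribution.fourier_apply, FourierTransform.fourier_fourierInv_eq] at this

/-- The operator taking `a` to `conj (a (-ξ))`. -/
def reflOp : L2 →L[ℝ] L2 :=
  ((conjC3 : C3 →L[ℝ] C3).compLpL 2 volume) ∘L
    (Lp.compMeasurePreservingₗᵢ ℝ Neg.neg
      (Measure.measurePreserving_neg (volume : Measure Plane))).toContinuousLinearMap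

theorem reflOp_coe (a : L2) : reflOp a =ᵐ[volume] fun ξ => conjC3 (a (-ξ)) := by
  have hm := Measure.measurePreserving_neg (volume : Measure Plane)
  filter_upwards [(conjC3 : C3 →L[ℝ] C3).coeFn_compLpL (Lp.compMeasurePreserving Neg.neg hm a),
    Lp.coeFn_compMeasurePreserving a hm] with ξ h1 h2
  refine h1.trans ?_
  rw [h2]
  rfl

theorem norm_reflOp_le (a : L2) : ‖reflOp a‖ ≤ ‖a‖ := by
  refine Lp.norm_le_norm_of_ae_le ?_ |>.trans_eq
    (Lp.norm_compMeasurePreserving a (Measure.measurePreserving_neg (volume : Measure Plane)))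
  filter_upwards [reflOp_coe a, Lp.coeFn_compMeasurePreserving a
    (Measure.measurePreserving_neg (volume : Measure Plane))] with ξ h1 h2
  rw [h1, h2, LinearIsometryEquiv.norm_map]
  rfl

theorem ae_neg {P : Plane → Prop} (h : ∀ᵐ ξ, P ξ) : ∀ᵐ ξ : Plane, P (-ξ) :=
  (Measure.measurePreserving_neg (volume : Measure Plane)).quasiMeasurePreserving.ae h

theorem reflOp_smul (c : ℂ) (a : L2) : reflOp (c • a) = conj c • reflOp a := by
  refine Lp.ext ?_
  filter_upwards [reflOp_coe (c • a), ae_neg (Lp.coeFn_smul c a), reflOp_coe a,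
    Lp.coeFn_smul (conj c) (reflOp a)] with ξ h1 h2 h3 h4
  rw [h1, h2, Pi.smul_apply, conjC3_smul, h4, Pi.smul_apply, h3]

/-- The frequency r is even in ξ, so only the conjugation of the exponential matters, and it
reverses time. -/
theorem reflOp_waveOp (t : ℝ) (a : L2) : reflOp (waveOp t a) = waveOp (-t) (reflOp a) := by
  refine Lp.ext ?_
  filter_upwards [reflOp_coe (waveOp t a), ae_neg (waveOp_coe t a), reflOp_coe a,
    waveOp_coe (-t) (reflOp a)] with ξ h1 h2 h3 h4
  rw [h1, h2, conjC3_smul, h4, h3, ← Complex.exp_conj, norm_neg]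
  congr 2
  simp [map_ofNat]

theorem sobWeight_schwartzRefl (s : ℝ) (φ : 𝓢(Plane, ℂ)) (ξ : Plane) :
    sobWeight s (schwartzRefl φ) ξ = conj (sobWeight s φ (-ξ)) := by
  rw [sobWeight, sobWeight, schwartzRefl_apply, norm_neg, map_mul, Complex.conj_ofReal]

theorem pairing_reflOp {s : ℝ} {φ : 𝓢(Plane, ℂ)} (h : MemLp (sobWeight s φ) 2)
    (h' : MemLp (sobWeight s (schwartzRefl φ)) 2) (a : L2) :
    pairing (sobWeight s (schwartzRefl φ)) (reflOp a) = conjC3 (pairing (sobWeight s φ) a) := by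
  rw [pairing_apply h, pairing_apply h', conjC3_integral, ← integral_neg_eq_self]
  refine integral_congr_ae ?_
  filter_upwards [ae_neg (reflOp_coe a)] with ξ h1
  rw [h1, sobWeight_schwartzRefl, conjC3_smul, neg_neg]

/-- The null symbol is real and even under (η,ζ) ↦ (-η,-ζ), and the cross product commutes with
conjugation. -/
theorem nullForm_reflOp (φ : 𝓢(Plane, ℂ)) (a b : L2) :
    nullForm (schwartzRefl φ) (reflOp a) (reflOp b) = conjC3 (nullForm φ a b) := by
  have hn : ((volume : Measure Plane).prod volume).IsNegInvariant :=
    ⟨((Measure.measurePreserving_neg (volume : Measure Plane)).prod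
      (Measure.measurePreserving_neg (volume : Measure Plane))).map_eq⟩
  rw [nullForm_apply, nullForm_apply, conjC3_integral,
    integral_congr_ae (formIntegrand_congr _ (schwartzRefl φ) (reflOp_coe a) (reflOp_coe b)),
    ← integral_neg_eq_self]
  refine integral_congr_ae (Filter.Eventually.of_forall fun p => ?_)
  simp only [formIntegrand, conjC3_smul, conjC3_crossL, schwartzRefl_apply, map_mul,
    Complex.conj_ofReal, Prod.fst_neg, Prod.snd_neg, neg_neg, neg_add_rev, add_comm p.2 p.1,
    nullSymbol, norm_neg, PiLp.neg_apply, neg_mul_neg]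

end Conjugation

/-! ### Reflection of forced waves -/

section ReflectedWave

variable {T : ℝ}

/-- The curve `t ↦ reflOp (H t)`. -/
def reflCurve (H : Curve T) : Curve T := reflOp.compLp H

theorem reflCurve_coe (H : Curve T) :
    reflCurve H =ᵐ[volume.restrict (Icc 0 T)] fun t => reflOp (H t) :=
  reflOp.coeFn_compLp H

theorem norm_reflCurve_le (H : Curve T) : ‖reflCurve H‖ ≤ ‖H‖ := by
  refine Lp.norm_le_norm_of_ae_le ?_
  filter_upwards [reflCurve_coe H] with t h
  rw [h]
  exact norm_reflOp_le _

theorem reflOp_primitive {t : ℝ} (ht : t ∈ Icc 0 T) (c : ℂ) (ρ : ℝ) (H : Curve T) :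
    reflOp (primitive t (c • twist ρ H)) = primitive t (conj c • twist (-ρ) (reflCurve H)) := by
  rw [primitive_eq_intervalIntegral ht, primitive_eq_intervalIntegral ht]
  have hsub : Ioc 0 t ⊆ Icc 0 T := fun s hs => ⟨hs.1.le, hs.2.trans ht.2⟩
  have e := ContinuousLinearMap.intervalIntegral_comp_comm reflOp
    (intervalIntegrable_curve (c • twist ρ H) ht)
  rw [← e]
  refine intervalIntegral.integral_congr_ae_restrict ?_
  rw [uIoc_of_le ht.1]
  filter_upwards [ae_restrict_of_ae_restrict_of_subset hsub (twist_coe ρ H),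
    ae_restrict_of_ae_restrict_of_subset hsub (Lp.coeFn_smul c (twist ρ H)),
    ae_restrict_of_ae_restrict_of_subset hsub (twist_coe (-ρ) (reflCurve H)),
    ae_restrict_of_ae_restrict_of_subset hsub (Lp.coeFn_smul (conj c) (twist (-ρ) (reflCurve H))),
    ae_restrict_of_ae_restrict_of_subset hsub (reflCurve_coe H)] with s h1 h2 h3 h4 h5
  rw [h2, Pi.smul_apply, h1, h4, Pi.smul_apply, h3, h5, reflOp_smul, reflOp_waveOp, neg_mul]

/-- Conjugation exchanges the coefficients of e^{itr} and e^{-itr}, so state and velocity are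
carried to those of the reflected data and forcing. -/
theorem reflOp_halfWaves {t : ℝ} (ht : t ∈ Icc 0 T) (a₀ a₁ : L2) (H : Curve T) :
    reflOp (halfWavePos a₀ a₁ H t) = halfWaveNeg (reflOp a₀) (reflOp a₁) (reflCurve H) t ∧
    reflOp (halfWaveNeg a₀ a₁ H t) = halfWavePos (reflOp a₀) (reflOp a₁) (reflCurve H) t := by
  have e1 : conj (1 / 2 : ℂ) = 1 / 2 := by simp [map_ofNat]
  have e2 : conj (Complex.I / 2) = -(Complex.I / 2) := by simp [neg_div, map_ofNat]
  constructor
  · rw [halfWavePos, halfWaveNeg, map_add, map_sub, reflOp_primitive ht, reflOp_smul, reflOp_smul,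
      e1, e2, Complex.conj_I, neg_neg, neg_smul, sub_neg_eq_add]
  · rw [halfWavePos, halfWaveNeg, map_add, map_add, reflOp_primitive ht, reflOp_smul, reflOp_smul,
      e1, e2, map_neg, Complex.conj_I, neg_neg, neg_smul, ← sub_eq_add_neg]

theorem reflOp_stateCurve {t : ℝ} (ht : t ∈ Icc 0 T) (a₀ a₁ : L2) (H : Curve T) :
    reflOp (stateCurve a₀ a₁ H t) = stateCurve (reflOp a₀) (reflOp a₁) (reflCurve H) t := by
  obtain ⟨h1, h2⟩ := reflOp_halfWaves ht a₀ a₁ H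
  rw [stateCurve, stateCurve, map_add, reflOp_waveOp, reflOp_waveOp, h1, h2, add_comm]
  congr 2 <;> simp

theorem reflOp_velocityCurve {t : ℝ} (ht : t ∈ Icc 0 T) (a₀ a₁ : L2) (H : Curve T) :
    reflOp (velocityCurve a₀ a₁ H t) = velocityCurve (reflOp a₀) (reflOp a₁) (reflCurve H) t := by
  obtain ⟨h1, h2⟩ := reflOp_halfWaves ht a₀ a₁ H
  rw [velocityCurve, velocityCurve, reflOp_smul, map_sub, reflOp_waveOp, reflOp_waveOp, h1, h2,
    Complex.conj_I, neg_smul, ← smul_neg, neg_sub]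
  congr 3 <;> simp

theorem reflOp_displacement {t : ℝ} (ht : t ∈ Icc 0 T) (a₀ a₁ : L2) (H : Curve T) :
    reflOp (displacement a₀ a₁ H t) = displacement (reflOp a₀) (reflOp a₁) (reflCurve H) t := by
  have hsub : uIcc 0 t ⊆ Icc 0 T := by
    rw [uIcc_of_le ht.1]; exact Icc_subset_Icc_right ht.2
  have e := ContinuousLinearMap.intervalIntegral_comp_comm reflOp
    (((continuousOn_velocityCurve a₀ a₁ H).mono hsub).intervalIntegrable (μ := volume))
  rw [displacement, displacement, ← e]
  exact intervalIntegral.integral_congr fun s hs => reflOp_velocityCurve (hsub hs) _ _ _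

theorem IsNullFormCurve.refl {a b : ℝ → L2} {M : Curve T} (h : IsNullFormCurve T a b M) :
    IsNullFormCurve T (fun t => reflOp (a t)) (fun t => reflOp (b t)) (reflCurve M) := by
  filter_upwards [h, reflCurve_coe M] with t h1 h2 φ
  rw [h2, ← schwartzRefl_schwartzRefl φ, nullForm_reflOp,
    pairing_reflOp (memLp_sobWeight_half _) (memLp_sobWeight_half _), h1]

theorem reflOp_fourier_of_isReal_half {f : Dist} {g : L2} (h : IsFracLaplacian (1 / 2) f g)
    (hr : IsReal f) : reflOp (𝓕 g) = 𝓕 g := by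
  refine eq_of_forall_pairing_half fun φ => ?_
  have h1 := isReal_iff_fourier.1 hr (schwartzRefl φ)
  rw [h.half, h.half, schwartzRefl_schwartzRefl] at h1
  rw [h1, ← pairing_reflOp (memLp_sobWeight_half _) (memLp_sobWeight_half _),
    schwartzRefl_schwartzRefl]

theorem reflOp_fourier_of_isReal_three_half {f : Dist} {g : L2}
    (h : IsFracLaplacian (3 / 2) f g) (hr : IsReal f) : reflOp (𝓕 g) = 𝓕 g := by
  rw [← sub_eq_zero]
  refine eq_zero_of_forall_pairing (s := 3 / 2) _ fun φ h0 => ?_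
  have h0' : schwartzRefl φ 0 = 0 := by rw [schwartzRefl_apply, neg_zero, h0, map_zero]
  have h1 := isReal_iff_fourier.1 hr (schwartzRefl φ)
  rw [schwartzRefl_schwartzRefl, h.three_half h0, h.three_half h0'] at h1
  have h2 := pairing_reflOp (φ := schwartzRefl φ) (memLp_sobWeight_three_half _ h0')
    (by rw [schwartzRefl_schwartzRefl]; exact memLp_sobWeight_three_half _ h0) (𝓕 g)
  rw [schwartzRefl_schwartzRefl] at h2
  rw [← pairing_apply (memLp_sobWeight_three_half φ h0), map_sub, h2, h1, sub_self]

theorem isReal_of_displacement {u₀ f : Dist} {a₀ a₁ : L2} {H : Curve T} (h₀ : IsReal u₀)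
    (ha₀ : reflOp a₀ = a₀) (ha₁ : reflOp a₁ = a₁) (hH : reflCurve H = H) {t : ℝ}
    (ht : t ∈ Icc 0 T) (hu : ∀ φ : 𝓢(Plane, ℂ), (𝓕 f) φ =
      (𝓕 u₀) φ + pairing (sobWeight (1 / 2) φ) (displacement a₀ a₁ H t)) : IsReal f := by
  refine isReal_iff_fourier.2 fun φ => ?_
  have h1 := reflOp_displacement ht a₀ a₁ H
  rw [ha₀, ha₁, hH] at h1
  rw [hu, hu, map_add, isReal_iff_fourier.1 h₀, ← pairing_reflOp (memLp_sobWeight_half _)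
    (memLp_sobWeight_half _), h1]

end ReflectedWave

/-! ### The contraction argument -/

section FixedPoint

variable {T K : ℝ}

/-- `H` is the nonlinearity `u_x ∧ u_y` of the wave with data `a₀`, `a₁` and forcing `H`. -/
def IsSelfConsistent (a₀ a₁ : L2) (H : Curve T) : Prop :=
  IsNullFormCurve T (stateCurve a₀ a₁ H) (stateCurve a₀ a₁ H) H

/-- For a symmetric bilinear Q, Q(a,a) - Q(a',a') = Q(a-a',a) + Q(a-a',a'), and the bilinear
estimate applies to each term. -/
theorem norm_nullFormCurve_sub_le (hT : 0 ≤ T) {a₀ a₁ a₀' a₁' : L2} {H H' M M' : Curve T}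
    (h : IsNullFormCurve T (stateCurve a₀ a₁ H) (stateCurve a₀ a₁ H) M)
    (h' : IsNullFormCurve T (stateCurve a₀' a₁' H') (stateCurve a₀' a₁' H') M') :
    ‖M - M'‖ ≤ 8 * stateSize (a₀ - a₀') (a₁ - a₁') (H - H') *
      (stateSize a₀ a₁ H + stateSize a₀' a₁' H') := by
  obtain ⟨M₁, h1, n1⟩ := exists_nullFormCurve_stateCurve hT (a₀ - a₀') (a₁ - a₁') a₀ a₁ (H - H') H
  obtain ⟨M₂, h2, n2⟩ :=
    exists_nullFormCurve_stateCurve hT (a₀ - a₀') (a₁ - a₁') a₀' a₁' (H - H') H'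
  have e : M - M' = M₁ + M₂ := by
    refine Lp.ext ?_
    filter_upwards [h, h', h1, h2, Lp.coeFn_sub M M', Lp.coeFn_add M₁ M₂] with t k k' k1 k2 l1 l2
    refine eq_of_forall_pairing_half fun φ => ?_
    rw [l1, l2, Pi.sub_apply, Pi.add_apply, map_sub, map_add, ← k, ← k', ← k1, ← k2,
      stateCurve_sub, map_sub, sub_apply, sub_apply,
      nullForm_swap φ (stateCurve a₀' a₁' H' t) (stateCurve a₀ a₁ H t)]
    abel
  rw [e]
  refine (norm_add_le _ _).trans ((add_le_add n1 n2).trans_eq ?_)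
  ring

theorem stateSize_nonneg (a₀ a₁ : L2) (H : Curve T) : 0 ≤ stateSize a₀ a₁ H := by
  unfold stateSize; positivity

/-- The forcing contributes at most 2√T · 64K² = K, as much as the data. -/
theorem stateSize_le (hK : 0 < K) (hT : 128 * K * √T = 1) {a₀ a₁ : L2} (ha : ‖a₀‖ + ‖a₁‖ ≤ K)
    {H : Curve T} (hH : ‖H‖ ≤ 64 * K ^ 2) : stateSize a₀ a₁ H ≤ 2 * K := by
  have : 2 * √T * ‖H‖ ≤ 2 * √T * (64 * K ^ 2) := by gcongr
  unfold stateSize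
  nlinarith

/-- Two states of size 2K give the factor 8 · 4K = 32K. The coefficient of ‖H-H'‖ is 32K · 2√T = 1/2
by the choice of T. -/
theorem norm_nullFormCurve_sub_le_of_small (hK : 0 < K) (hT0 : 0 ≤ T) (hT : 128 * K * √T = 1)
    {a₀ a₁ a₀' a₁' : L2} (ha : ‖a₀‖ + ‖a₁‖ ≤ K) (ha' : ‖a₀'‖ + ‖a₁'‖ ≤ K) {H H' M M' : Curve T}
    (hH : ‖H‖ ≤ 64 * K ^ 2) (hH' : ‖H'‖ ≤ 64 * K ^ 2)
    (h : IsNullFormCurve T (stateCurve a₀ a₁ H) (stateCurve a₀ a₁ H) M)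
    (h' : IsNullFormCurve T (stateCurve a₀' a₁' H') (stateCurve a₀' a₁' H') M') :
    ‖M - M'‖ ≤ 32 * K * (‖a₀ - a₀'‖ + ‖a₁ - a₁'‖) + 1 / 2 * ‖H - H'‖ := by
  have h0 := stateSize_nonneg (a₀ - a₀') (a₁ - a₁') (H - H')
  have s1 := stateSize_le hK hT ha hH
  have s2 := stateSize_le hK hT ha' hH'
  refine (norm_nullFormCurve_sub_le hT0 h h').trans ?_
  calc 8 * stateSize (a₀ - a₀') (a₁ - a₁') (H - H') * (stateSize a₀ a₁ H + stateSize a₀' a₁' H')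
      ≤ 8 * stateSize (a₀ - a₀') (a₁ - a₁') (H - H') * (2 * K + 2 * K) := by gcongr
    _ = 32 * K * (‖a₀ - a₀'‖ + ‖a₁ - a₁'‖) + 1 / 2 * (128 * K * √T) * ‖H - H'‖ := by
        unfold stateSize; ring
    _ = _ := by rw [hT, mul_one]

theorem IsSelfConsistent.norm_sub_le (hK : 0 < K) (hT0 : 0 ≤ T) (hT : 128 * K * √T = 1)
    {a₀ a₁ a₀' a₁' : L2} (ha : ‖a₀‖ + ‖a₁‖ ≤ K) (ha' : ‖a₀'‖ + ‖a₁'‖ ≤ K) {H H' : Curve T}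
    (hH : ‖H‖ ≤ 64 * K ^ 2) (hH' : ‖H'‖ ≤ 64 * K ^ 2) (h : IsSelfConsistent a₀ a₁ H)
    (h' : IsSelfConsistent a₀' a₁' H') :
    ‖H - H'‖ ≤ 64 * K * (‖a₀ - a₀'‖ + ‖a₁ - a₁'‖) := by
  have := norm_nullFormCurve_sub_le_of_small hK hT0 hT ha ha' hH hH' h h'
  linarith

theorem IsSelfConsistent.unique (hK : 0 < K) (hT0 : 0 ≤ T) (hT : 128 * K * √T = 1)
    {a₀ a₁ : L2} (ha : ‖a₀‖ + ‖a₁‖ ≤ K) {H H' : Curve T}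
    (hH : ‖H‖ ≤ 64 * K ^ 2) (hH' : ‖H'‖ ≤ 64 * K ^ 2) (h : IsSelfConsistent a₀ a₁ H)
    (h' : IsSelfConsistent a₀ a₁ H') : H = H' := by
  have := h.norm_sub_le hK hT0 hT ha ha hH hH' h'
  rw [sub_self, sub_self, norm_zero, add_zero, mul_zero] at this
  exact sub_eq_zero.1 (norm_le_zero_iff.1 this)

/-- The ball of radius 64K² is mapped into the one of radius 8(2K)² = 32K². The larger ball is the
domain in which uniqueness is needed, since solutions will be known to satisfy only the bound 2A. -/
theorem exists_isSelfConsistent (hK : 0 < K) (hT0 : 0 ≤ T) (hT : 128 * K * √T = 1)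
    {a₀ a₁ : L2} (ha : ‖a₀‖ + ‖a₁‖ ≤ K) :
    ∃ H : Curve T, IsSelfConsistent a₀ a₁ H ∧ ‖H‖ ≤ 32 * K ^ 2 := by
  choose Φ hΦ hΦn using fun H : Curve T => exists_nullFormCurve_stateCurve hT0 a₀ a₁ a₀ a₁ H H
  have hle : ∀ H : Curve T, ‖H‖ ≤ 64 * K ^ 2 → ‖Φ H‖ ≤ 32 * K ^ 2 := fun H hH => by
    have s := stateSize_le hK hT ha hH
    have s0 := stateSize_nonneg a₀ a₁ H
    calc ‖Φ H‖ ≤ 8 * stateSize a₀ a₁ H * stateSize a₀ a₁ H := hΦn H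
      _ ≤ 8 * (2 * K) * (2 * K) := by gcongr
      _ = _ := by ring
  set S : Set (Curve T) := Metric.closedBall 0 (64 * K ^ 2) with hS
  have hmem : ∀ H, H ∈ S ↔ ‖H‖ ≤ 64 * K ^ 2 := fun H => mem_closedBall_zero_iff
  have hmaps : MapsTo Φ S S := fun H hH =>
    (hmem _).2 ((hle H ((hmem H).1 hH)).trans (by nlinarith [sq_nonneg K]))
  have hcon : ContractingWith (1 / 2) (hmaps.restrict Φ S S) := by
    refine ⟨by rw [← NNReal.coe_lt_coe]; norm_num, LipschitzWith.of_dist_le_mul fun x y => ?_⟩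
    have := norm_nullFormCurve_sub_le_of_small hK hT0 hT ha ha ((hmem _).1 x.2) ((hmem _).1 y.2)
      (hΦ x) (hΦ y)
    rw [sub_self, sub_self, norm_zero, add_zero, mul_zero, zero_add] at this
    rw [Subtype.dist_eq, Subtype.dist_eq, dist_eq_norm, dist_eq_norm]
    simpa using this
  obtain ⟨H, hHS, hfix, -⟩ := hcon.exists_fixedPoint' Metric.isClosed_closedBall.isComplete hmaps
    (Metric.mem_closedBall_self (by positivity)) (edist_ne_top _ _)
  have hfix' : Φ H = H := hfix
  refine ⟨H, ?_, ?_⟩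
  · have := hΦ H
    rw [hfix'] at this
    exact this
  · have := hle H ((hmem H).1 hHS)
    rwa [hfix'] at this

/-- The reflected curve is self-consistent for the same, reflection invariant, data and lies in the
same ball; uniqueness makes it equal to H. -/
theorem IsSelfConsistent.reflCurve_eq (hK : 0 < K) (hT0 : 0 ≤ T) (hT : 128 * K * √T = 1)
    {a₀ a₁ : L2} (ha : ‖a₀‖ + ‖a₁‖ ≤ K) (ha₀ : reflOp a₀ = a₀) (ha₁ : reflOp a₁ = a₁)
    {H : Curve T} (hH : ‖H‖ ≤ 64 * K ^ 2) (h : IsSelfConsistent a₀ a₁ H) : reflCurve H = H := by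
  have e : ∀ t ∈ Icc 0 T, reflOp (stateCurve a₀ a₁ H t) = stateCurve a₀ a₁ (reflCurve H) t :=
    fun t ht => by rw [reflOp_stateCurve ht, ha₀, ha₁]
  have h' : IsSelfConsistent a₀ a₁ (reflCurve H) := h.refl.congr e e
  exact h'.unique hK hT0 hT ha ((norm_reflCurve_le H).trans hH) hH h

end FixedPoint

/-! ### From fixed points to solutions and back -/

section Solutions

variable {T : ℝ}

theorem norm_fourierInv_L2 (a : L2) : ‖(𝓕⁻ a : L2)‖ = ‖a‖ := by
  rw [← Lp.norm_fourier_eq, FourierTransform.fourier_fourierInv_eq]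

theorem fourier_wedge_eq_pairing {f h : Dist} {a b : L2}
    (hf : IsFracLaplacian (3 / 2) f (𝓕⁻ a)) (hw : IsWedge (dx f) (dy f) h) :
    IsFracLaplacian (1 / 2) h (𝓕⁻ b) ↔
      ∀ φ, nullForm φ a a = pairing (sobWeight (1 / 2) φ) b := by
  have hφ := fourier_wedge hf hw
  rw [FourierTransform.fourier_fourierInv_eq] at hφ
  constructor
  · intro hb φ
    rw [← hφ, hb.half, FourierTransform.fourier_fourierInv_eq]
  · intro hb φ _
    rw [hφ, hb, pairing_apply (memLp_sobWeight_half φ), FourierTransform.fourier_fourierInv_eq]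
    rfl

/-- The nonlinearity of a solution, on the Fourier side. -/
theorem IsSolution.exists_curve (hT : 0 < T) {A : ℝ} (hA : 0 < A) {u₀ u₁ : Dist} {g₀ g₁ : L2}
    (h₀ : IsFracLaplacian (3 / 2) u₀ g₀) (h₁ : IsFracLaplacian (1 / 2) u₁ g₁) {u v : ℝ → Dist}
    (h : IsSolution T A u₀ u₁ u v) :
    ∃ H : Curve T, ‖H‖ ≤ 2 * A ∧ IsSelfConsistent (𝓕 g₀) (𝓕 g₁) H ∧
      (∀ t ∈ Icc 0 T, ∀ φ : 𝓢(Plane, ℂ), (𝓕 (u t)) φ =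
        (𝓕 u₀) φ + pairing (sobWeight (1 / 2) φ) (displacement (𝓕 g₀) (𝓕 g₁) H t)) ∧
      ∀ t ∈ Icc 0 T, v t = potential (velocityCurve (𝓕 g₀) (𝓕 g₁) H t) := by
  obtain ⟨F, hw, hFA, hd⟩ := h.duhamel
  -- The norm is an infimum over representatives; giving up a factor 2 makes the inequality strict,
  -- which produces an actual representative.
  have hlt : l2HdotNorm T (1 / 2) F < ENNReal.ofReal (2 * A) :=
    hFA.trans_lt ((ENNReal.ofReal_lt_ofReal_iff (by linarith)).2 (by linarith))
  rw [l2HdotNorm, iInf_lt_iff] at hlt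
  obtain ⟨G, hG⟩ := hlt
  rw [iInf_lt_iff] at hG
  obtain ⟨hGm, hG⟩ := hG
  rw [iInf_lt_iff] at hG
  obtain ⟨hGF, hGA⟩ := hG
  have hGL : MemLp G 2 (volume.restrict (Icc 0 T)) := ⟨hGm, hGA.trans ENNReal.ofReal_lt_top⟩
  set H : Curve T := (FourierTransform.fourierCLM ℂ L2).compLp hGL.toLp with hH
  have hHG : ∀ᵐ t ∂(volume.restrict (Icc 0 T)), H t = 𝓕 (G t) := by
    filter_upwards [(FourierTransform.fourierCLM ℂ L2).coeFn_compLp hGL.toLp, hGL.coeFn_toLp]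
      with t k1 k2
    rw [hH, k1, k2]
    rfl
  have hHn : ‖H‖ ≤ 2 * A := by
    have k1 : ‖H‖ ≤ ‖hGL.toLp‖ := by
      refine Lp.norm_le_norm_of_ae_le ?_
      filter_upwards [hHG, hGL.coeFn_toLp] with t k1 k2
      rw [k1, k2, Lp.norm_fourier_eq]
    refine k1.trans ?_
    rw [Lp.norm_toLp]
    exact ENNReal.toReal_le_of_le_ofReal (by linarith) hGA.le
  have hHF : ∀ᵐ t ∂(volume.restrict (Icc 0 T)), IsFracLaplacian (1 / 2) (F t) (𝓕⁻ (H t)) := by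
    filter_upwards [hHG, hGF] with t k1 k2
    rw [k1, FourierTransform.fourierInv_fourier_eq]
    exact k2
  have hu := (solvesDuhamel_iff h₀ h₁ hHF).1 hd
  refine ⟨H, hHn, ?_, hu, (isTimeDeriv_iff_of_displacement hT hu).1 h.timeDeriv⟩
  filter_upwards [hHF, ae_restrict_mem measurableSet_Icc] with t k ht
  exact (fourier_wedge_eq_pairing (isFracLaplacian_of_displacement h₀ ht (hu t ht))
    (hw t ht)).1 k

/-- A self-consistent curve gives a solution. -/
theorem IsSelfConsistent.exists_isSolution (hT : 0 < T) {A : ℝ} {u₀ u₁ : Dist} {g₀ g₁ : L2}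
    (h₀ : IsFracLaplacian (3 / 2) u₀ g₀) (h₁ : IsFracLaplacian (1 / 2) u₁ g₁)
    (hr₀ : IsReal u₀) (hr₁ : IsReal u₁) {H : Curve T}
    (h : IsSelfConsistent (𝓕 g₀) (𝓕 g₁) H) (hHA : ‖H‖ ≤ A) (hH : reflCurve H = H) :
    ∃ u v : ℝ → Dist, IsSolution T A u₀ u₁ u v ∧
      IsContinuousInHdot T (3 / 2) u ∧ IsContinuousInHdot T (1 / 2) v := by
  set u : ℝ → Dist := fun t => u₀ + potential (displacement (𝓕 g₀) (𝓕 g₁) H t) with hu_def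
  set v : ℝ → Dist := fun t => potential (velocityCurve (𝓕 g₀) (𝓕 g₁) H t) with hv_def
  have hu : ∀ t ∈ Icc 0 T, ∀ φ : 𝓢(Plane, ℂ), (𝓕 (u t)) φ =
      (𝓕 u₀) φ + pairing (sobWeight (1 / 2) φ) (displacement (𝓕 g₀) (𝓕 g₁) H t) :=
    fun t _ φ => by
      rw [← fourier_potential]
      exact congrArg (fun x : Dist => x φ) (map_add (FourierTransform.fourierCLM ℂ Dist) u₀
        (potential (displacement (𝓕 g₀) (𝓕 g₁) H t)))
  have hu' : ∀ t ∈ Icc 0 T,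
      IsFracLaplacian (3 / 2) (u t) (𝓕⁻ (stateCurve (𝓕 g₀) (𝓕 g₁) H t)) :=
    fun t ht => isFracLaplacian_of_displacement h₀ ht (hu t ht)
  have hv' : ∀ t, IsFracLaplacian (1 / 2) (v t) (𝓕⁻ (velocityCurve (𝓕 g₀) (𝓕 g₁) H t)) :=
    fun t => isFracLaplacian_potential _
  -- The value outside [0,T] is irrelevant and set to zero, so that the wedge can be chosen for
  -- every real t.
  have hex : ∀ t, ∃ F : Dist, t ∈ Icc 0 T → IsWedge (dx (u t)) (dy (u t)) F := fun t => by
    by_cases ht : t ∈ Icc 0 T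
    · obtain ⟨F, hF⟩ := exists_wedge (hu' t ht)
      exact ⟨F, fun _ => hF⟩
    · exact ⟨0, fun h => absurd h ht⟩
  choose F hF using hex
  have hFH : ∀ᵐ t ∂(volume.restrict (Icc 0 T)), IsFracLaplacian (1 / 2) (F t) (𝓕⁻ (H t)) := by
    filter_upwards [h, ae_restrict_mem measurableSet_Icc] with t k ht
    exact (fourier_wedge_eq_pairing (hu' t ht) (hF t ht)).2 k
  refine ⟨u, v, ⟨fun t ht => isReal_of_displacement hr₀ (reflOp_fourier_of_isReal_three_half h₀ hr₀)
    (reflOp_fourier_of_isReal_half h₁ hr₁) hH ht (hu t ht),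
    (isTimeDeriv_iff_of_displacement hT hu).2 fun t _ => rfl, ?_, ?_,
    F, hF, ?_, (solvesDuhamel_iff h₀ h₁ hFH).2 hu⟩, ?_, ?_⟩
  · refine lt_of_le_of_lt (iSup₂_le fun t ht => ?_)
      (ENNReal.ofReal_lt_top (r := stateSize (𝓕 g₀) (𝓕 g₁) H))
    rw [hdotNorm_three_half_eq (hu' t ht), ← ofReal_norm, norm_fourierInv_L2]
    exact ENNReal.ofReal_le_ofReal (norm_stateCurve_le hT.le _ _ _ _)
  · refine lt_of_le_of_lt (iSup₂_le fun t ht => ?_)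
      (ENNReal.ofReal_lt_top (r := stateSize (𝓕 g₀) (𝓕 g₁) H))
    rw [hdotNorm_half_eq (hv' t), ← ofReal_norm, norm_fourierInv_L2]
    exact ENNReal.ofReal_le_ofReal (norm_velocityCurve_le hT.le _ _ _ _)
  · have hc : Continuous fun a : L2 => (𝓕⁻ a : L2) :=
      (FourierTransform.fourierInvCLM ℂ L2).continuous
    refine (iInf_le_of_le (fun t => 𝓕⁻ (H t)) (iInf₂_le_of_le
      (hc.comp_aestronglyMeasurable (Lp.aestronglyMeasurable H)) hFH le_rfl)).trans ?_
    rw [eLpNorm_congr_norm_ae (g := H) (Filter.Eventually.of_forall fun t => norm_fourierInv_L2 _),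
      ← Lp.enorm_def, ← ofReal_norm]
    exact ENNReal.ofReal_le_ofReal hHA
  · exact ⟨_, (FourierTransform.fourierInvCLM ℂ L2).continuous.comp_continuousOn
      (continuousOn_stateCurve (𝓕 g₀) (𝓕 g₁) H), hu'⟩
  · exact ⟨_, (FourierTransform.fourierInvCLM ℂ L2).continuous.comp_continuousOn
      (continuousOn_velocityCurve (𝓕 g₀) (𝓕 g₁) H), fun t _ => hv' t⟩

theorem exists_of_mem_dataBall {K : ℝ} (hK : 0 ≤ K) {d : Dist × Dist} (hd : d ∈ dataBall K) :
    ∃ g₀ g₁ : L2, IsFracLaplacian (3 / 2) d.1 g₀ ∧ IsFracLaplacian (1 / 2) d.2 g₁ ∧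
      ‖(𝓕 g₀ : L2)‖ + ‖(𝓕 g₁ : L2)‖ ≤ K := by
  have hlt := hd.2.2.trans_lt ENNReal.ofReal_lt_top
  obtain ⟨g₀, h₀⟩ := exists_isFracLaplacian_of_hdotNorm_lt ((le_add_right le_rfl).trans_lt hlt)
  obtain ⟨g₁, h₁⟩ := exists_isFracLaplacian_of_hdotNorm_lt ((le_add_left le_rfl).trans_lt hlt)
  refine ⟨g₀, g₁, h₀, h₁, ?_⟩
  have h := hd.2.2
  rw [hdotNorm_three_half_eq h₀, hdotNorm_half_eq h₁, ← ofReal_norm, ← ofReal_norm,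
    ← ENNReal.ofReal_add (norm_nonneg _) (norm_nonneg _), ENNReal.ofReal_le_ofReal_iff hK] at h
  rwa [Lp.norm_fourier_eq, Lp.norm_fourier_eq]

theorem exists_isSolution {K : ℝ} (hK : 0 < K) (hT0 : 0 < T) (hT : 128 * K * √T = 1)
    {d : Dist × Dist} (hd : d ∈ dataBall K) :
    ∃ u v : ℝ → Dist, IsSolution T (32 * K ^ 2) d.1 d.2 u v ∧
      IsContinuousInHdot T (3 / 2) u ∧ IsContinuousInHdot T (1 / 2) v := by
  obtain ⟨g₀, g₁, h₀, h₁, hg⟩ := exists_of_mem_dataBall hK.le hd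
  obtain ⟨H, hH, hHn⟩ := exists_isSelfConsistent hK hT0.le hT hg
  exact hH.exists_isSolution hT0 h₀ h₁ hd.1 hd.2.1 hHn (hH.reflCurve_eq hK hT0.le hT hg
    (reflOp_fourier_of_isReal_three_half h₀ hd.1) (reflOp_fourier_of_isReal_half h₁ hd.2.1)
    (hHn.trans (by nlinarith [sq_nonneg K])))

theorem isSolution_unique {K : ℝ} (hK : 0 < K) (hT0 : 0 < T) (hT : 128 * K * √T = 1)
    {d : Dist × Dist} (hd : d ∈ dataBall K) {u v u' v' : ℝ → Dist}
    (h : IsSolution T (32 * K ^ 2) d.1 d.2 u v) (h' : IsSolution T (32 * K ^ 2) d.1 d.2 u' v')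
    {t : ℝ} (ht : t ∈ Icc 0 T) : u t = u' t ∧ v t = v' t := by
  obtain ⟨g₀, g₁, h₀, h₁, hg⟩ := exists_of_mem_dataBall hK.le hd
  obtain ⟨H, hHn, hH, hu, hv⟩ := h.exists_curve hT0 (by positivity) h₀ h₁
  obtain ⟨H', hHn', hH', hu', hv'⟩ := h'.exists_curve hT0 (by positivity) h₀ h₁
  have e := hH.unique hK hT0.le hT hg (hHn.trans_eq (by ring)) (hHn'.trans_eq (by ring)) hH'
  subst e
  exact ⟨dist_ext_fourier fun φ => by rw [hu t ht, hu' t ht], by rw [hv t ht, hv' t ht]⟩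

/-- Lipschitz dependence of the solution on the data. -/
theorem supHdotNorm_sub_le {K : ℝ} (hK : 0 < K) (hT0 : 0 < T) (hT : 128 * K * √T = 1)
    {d d' : Dist × Dist} (hd : d ∈ dataBall K) (hd' : d' ∈ dataBall K) {u v u' v' : ℝ → Dist}
    (h : IsSolution T (32 * K ^ 2) d.1 d.2 u v) (h' : IsSolution T (32 * K ^ 2) d'.1 d'.2 u' v') :
    supHdotNorm T (3 / 2) (u - u') + supHdotNorm T (1 / 2) (v - v') ≤
      (hdotNorm (3 / 2) (d.1 - d'.1) + hdotNorm (1 / 2) (d.2 - d'.2)) * 4 := by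
  obtain ⟨g₀, g₁, h₀, h₁, hg⟩ := exists_of_mem_dataBall hK.le hd
  obtain ⟨g₀', g₁', h₀', h₁', hg'⟩ := exists_of_mem_dataBall hK.le hd'
  obtain ⟨H, hHn, hH, hu, hv⟩ := h.exists_curve hT0 (by positivity) h₀ h₁
  obtain ⟨H', hHn', hH', hu', hv'⟩ := h'.exists_curve hT0 (by positivity) h₀' h₁'
  have hs := hH.norm_sub_le hK hT0.le hT hg hg' (hHn.trans_eq (by ring)) (hHn'.trans_eq (by ring))
    hH'
  set D : ℝ := ‖(𝓕 g₀ - 𝓕 g₀' : L2)‖ + ‖(𝓕 g₁ - 𝓕 g₁' : L2)‖ with hD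
  -- The Lipschitz bound ‖H-H'‖ ≤ 64KD and 128K√T = 1 make the forcing contribute at most D. State
  -- and velocity are thus each bounded by 2D, whence the constant 4.
  have hsize : stateSize (𝓕 g₀ - 𝓕 g₀') (𝓕 g₁ - 𝓕 g₁') (H - H') ≤ 2 * D := by
    have : 2 * √T * ‖H - H'‖ ≤ 2 * √T * (64 * K * D) := by gcongr
    have e : 2 * √T * (64 * K * D) = (128 * K * √T) * D := by ring
    rw [hT, one_mul] at e
    unfold stateSize
    linarith
  have hdata : hdotNorm (3 / 2) (d.1 - d'.1) + hdotNorm (1 / 2) (d.2 - d'.2) =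
      ENNReal.ofReal D := by
    have e₀ : ‖g₀ - g₀'‖ = ‖(𝓕 g₀ - 𝓕 g₀' : L2)‖ := by
      rw [← Lp.norm_fourier_eq]
      exact congrArg norm (map_sub (FourierTransform.fourierCLM ℂ L2) g₀ g₀')
    have e₁ : ‖g₁ - g₁'‖ = ‖(𝓕 g₁ - 𝓕 g₁' : L2)‖ := by
      rw [← Lp.norm_fourier_eq]
      exact congrArg norm (map_sub (FourierTransform.fourierCLM ℂ L2) g₁ g₁')
    rw [hdotNorm_three_half_eq (h₀.sub (Or.inr rfl) h₀'),
      hdotNorm_half_eq (h₁.sub (Or.inl rfl) h₁'), ← ofReal_norm, ← ofReal_norm, e₀, e₁,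
      ← ENNReal.ofReal_add (norm_nonneg _) (norm_nonneg _)]
  have hsubInv : ∀ a b : L2, ‖(𝓕⁻ a - 𝓕⁻ b : L2)‖ = ‖a - b‖ := fun a b => by
    rw [← norm_fourierInv_L2 (a - b)]
    exact congrArg norm (map_sub (FourierTransform.fourierInvCLM ℂ L2) a b).symm
  have hU : supHdotNorm T (3 / 2) (u - u') ≤ ENNReal.ofReal (2 * D) := by
    refine iSup₂_le fun t ht => ?_
    rw [Pi.sub_apply, hdotNorm_three_half_eq ((isFracLaplacian_of_displacement h₀ ht (hu t ht)).sub
      (Or.inr rfl) (isFracLaplacian_of_displacement h₀' ht (hu' t ht))), ← ofReal_norm, hsubInv,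
      ← stateCurve_sub]
    exact ENNReal.ofReal_le_ofReal ((norm_stateCurve_le hT0.le _ _ _ _).trans hsize)
  have hV : supHdotNorm T (1 / 2) (v - v') ≤ ENNReal.ofReal (2 * D) := by
    refine iSup₂_le fun t ht => ?_
    rw [Pi.sub_apply, hv t ht, hv' t ht, hdotNorm_half_eq ((isFracLaplacian_potential _).sub
      (Or.inl rfl) (isFracLaplacian_potential _)), ← ofReal_norm, hsubInv, ← velocityCurve_sub]
    exact ENNReal.ofReal_le_ofReal ((norm_velocityCurve_le hT0.le _ _ _ _).trans hsize)
  have hD0 : 0 ≤ D := by positivity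
  rw [hdata, show (4 : ℝ≥0∞) = ENNReal.ofReal 4 by simp, ← ENNReal.ofReal_mul hD0]
  refine (add_le_add hU hV).trans_eq ?_
  rw [← ENNReal.ofReal_add (by positivity) (by positivity)]
  congr 1
  ring

end Solutions

end WaveCMC

end

theorem theorem3 (K : ℝ) (hK : 0 < K) :
    ∃ T > 0, ∃ A > 0,
      -- existence, with continuity in time
      (∀ d ∈ WaveCMC.dataBall K, ∃ u v : ℝ → WaveCMC.Dist,
        WaveCMC.IsSolution T A d.1 d.2 u v ∧
        WaveCMC.IsContinuousInHdot T (3 / 2) u ∧ WaveCMC.IsContinuousInHdot T (1 / 2) v) ∧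
      -- uniqueness
      (∀ d ∈ WaveCMC.dataBall K, ∀ u v u' v' : ℝ → WaveCMC.Dist,
        WaveCMC.IsSolution T A d.1 d.2 u v → WaveCMC.IsSolution T A d.1 d.2 u' v' →
        ∀ t ∈ Set.Icc 0 T, u t = u' t ∧ v t = v' t) ∧
      -- continuity of the map from the data to the solution
      (∀ d ∈ WaveCMC.dataBall K, ∀ ε : ENNReal, 0 < ε → ∃ δ : ENNReal, 0 < δ ∧
        ∀ d' ∈ WaveCMC.dataBall K,
          WaveCMC.hdotNorm (3 / 2) (d.1 - d'.1) + WaveCMC.hdotNorm (1 / 2) (d.2 - d'.2) < δ →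
          ∀ u v u' v' : ℝ → WaveCMC.Dist,
            WaveCMC.IsSolution T A d.1 d.2 u v → WaveCMC.IsSolution T A d'.1 d'.2 u' v' →
            WaveCMC.supHdotNorm T (3 / 2) (u - u') +
              WaveCMC.supHdotNorm T (1 / 2) (v - v') < ε) := by
  -- T = (128K)^{-2} is the time at which the contraction constant is 1/2.
  have hT : 128 * K * √((1 / (128 * K)) ^ 2) = 1 := by
    rw [Real.sqrt_sq (by positivity)]
    field_simp
  have hT0 : 0 < (1 / (128 * K)) ^ 2 := by positivity
  refine ⟨(1 / (128 * K)) ^ 2, hT0, 32 * K ^ 2, by positivity,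
    fun d hd => WaveCMC.exists_isSolution hK hT0 hT hd,
    fun d hd u v u' v' h h' t ht => WaveCMC.isSolution_unique hK hT0 hT hd h h' ht,
    -- The data-to-solution map is Lipschitz with constant 4, so δ = ε/4 works.
    fun d hd ε hε => ⟨ε / 4, ENNReal.div_pos hε.ne' (by simp), fun d' hd' hlt u v u' v' h h' => ?_⟩⟩
  refine (WaveCMC.supHdotNorm_sub_le hK hT0 hT hd hd' h h').trans_lt ?_
  rwa [← ENNReal.lt_div_iff_mul_lt (Or.inl (by simp)) (Or.inl (by simp))]
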